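/- **Conventions.** Let $\hat f(\xi)=\frac1{\sqrt{2\pi}}\int_{\mathbb R}e^{-i\xi x}f(x)\,dx$. Let $H^{-1}(\mathbb R)$ be the space of real-valued tempered distributions $q$ for which $\hat q$ is a function and $\|q\|_{H^{-1}}^2=\int_{\mathbb R}\frac{|\hat q(\xi)|^2}{\xi^2+4}\,d\xi<\infty$, and let $B_\delta=\{q\in H^{-1}(\mathbb R):\|q\|_{H^{-1}}\le\delta\}$. For $q\in H^{-1}(\mathbb R)$ let $L=-\partial_x^2+q$ be the operator on $L^2(\mathbb R)$ associated with the quadratic form $\psi\mapsto\int|\psi'|^2+q|\psi|^2\,dx$ with domain $H^1(\mathbb R)$ (where $\int q|\psi|^2\,dx$ denotes the pairing of $H^{-1}$ with $H^1$). For $\kappa\ge 1$ let $G(x,y)=G(x,y;\kappa,q)$ be the continuous integral kernel of the resolvent $(L+\kappa^2)^{-1}$, and put $g(x)=g(x;\kappa,q)=G(x,x;\kappa,q)$. Let $R_0=(-\partial_x^2+\kappa^2)^{-1}$. For a Hilbert–Schmidt operator $A$, $\det_2(1+A)=\prod_j(1+\lambda_j)e^{-\lambda_j}$ is the renormalized Fredholm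 determinant, where $\lambda_j$ are the nonzero eigenvalues of $A$ counted with algebraic multiplicity. **Proposition 2.5.** There exists $\delta>0$ so that for all $q\in B_\delta$ and all $\kappa\ge1$ the continuous kernel $G$ exists, is unique and real-valued, $g(x)>0$ for all $x$, and $$\rho(x;\kappa,q):=\kappa-\frac1{2g(x)}+\frac12\int_{\mathbb R}e^{-2\kappa|x-y|}q(y)\,dy$$ belongs to $L^1(\mathbb R)\cap H^1(\mathbb R)$. Moreover, for each fixed $x\in\mathbb R$ and $\kappa\ge1$, the map $q\mapsto\rho(x;\kappa,q)$ is non-negative and convex on $B_\delta$. Additionally, for each $\kappa\ge1$, $$\alpha(\kappa;q):=\int_{\mathbb R}\rho(x;\kappa,q)\,dx$$ defines a non-negative, real-analytic, strictly convex function of $q\in B_\delta$, and there is a constant $C>0$, independent of $q\in B_\delta$ and $\kappa\ge1$, such that $$C^{-1}\,\frac1\kappa\int_{\mathbb R}\frac{|\hat q(\xi)|^2}{\xi^2+4\kappa^2}\,d\xi\;\le\;\alpha(\kappa;q)\;\le\; C\,\frac1\kappa\int_{\mathbb R}\frac{|\hat q(\xi)|^2}{\xi^2+4\kappa^2}\,d\xi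 .$$ Lastly, for all $q\in B_\delta$ and $\kappa\ge1$, the operator $\sqrt{R_0}\,q\,\sqrt{R_0}$ is a bounded Hilbert–Schmidt operator on $L^2(\mathbb R)$, $\det_2\bigl(1+\sqrt{R_0}\,q\,\sqrt{R_0}\bigr)>0$, and $$\alpha(\kappa;q)=-\log{\det}_2\bigl(1+\sqrt{R_0}\,q\,\sqrt{R_0}\bigr).$$ -/

import Mathlib

open MeasureTheory
open scoped SchwartzMap FourierTransform LineDeriv

noncomputable section

namespace KdV

/-- The Hilbert space `L²(ℝ; ℂ)`. -/
abbrev L2 : Type := Lp ℂ 2 (volume : Measure ℝ)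

/-! ### The space `H⁻¹(ℝ)` of real-valued distributions -/

/-- A tempered distribution is real-valued if it is real on real-valued test functions. -/
def IsReal (q : 𝓢'(ℝ, ℂ)) : Prop :=
  ∀ φ : 𝓢(ℝ, ℂ), (∀ x, (φ x).im = 0) → (q φ).im = 0

/-- Real-valued tempered distributions of Sobolev order `-1`, as a real vector space. -/
def hMinusOneSubmodule : Submodule ℝ 𝓢'(ℝ, ℂ) where
  carrier := {q | TemperedDistribution.MemSobolev (-1) 2 q ∧ IsReal q}
  zero_mem' := ⟨TemperedDistribution.memSobolev_fun_zero ℝ ℂ _ _, fun φ _ => by simp⟩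
  add_mem' := fun {a b} ha hb => ⟨ha.1.add hb.1, fun φ hφ => by
    simp [ha.2 φ hφ, hb.2 φ hφ]⟩
  smul_mem' := fun c a ha => by
    have h : c • a = (c : ℂ) • a := by ext φ; simp
    refine ⟨?_, fun φ hφ => ?_⟩
    · rw [h]; exact ha.1.smul (c : ℂ)
    · simp [ha.2 φ hφ]

/-- `H⁻¹(ℝ)`; it carries the norm defined below, not the topology of distributions. -/
def HMinusOne : Type := hMinusOneSubmodule

namespace HMinusOne

instance : AddCommGroup HMinusOne := inferInstanceAs (AddCommGroup hMinusOneSubmodule)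

instance : Module ℝ HMinusOne := inferInstanceAs (Module ℝ hMinusOneSubmodule)

/-- The underlying tempered distribution. -/
def toDistribution (q : HMinusOne) : 𝓢'(ℝ, ℂ) := Subtype.val q

theorem exists_freq (q : HMinusOne) : ∃ f : L2,
    TemperedDistribution.smulLeftCLM ℂ
      (fun x : ℝ => (((1 + ‖x‖ ^ 2) ^ ((-1 : ℝ) / 2) : ℝ) : ℂ)) (𝓕 q.toDistribution) = f :=
  TemperedDistribution.memSobolev_iff_exists_smulLeftCLM_fourier.1 (Subtype.prop q).1

/-- The square-integrable function `(1 + ξ²)^(-1/2) 𝓕q(ξ)`. -/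
def freq (q : HMinusOne) : L2 := q.exists_freq.choose

theorem freq_spec (q : HMinusOne) :
    TemperedDistribution.smulLeftCLM ℂ
      (fun x : ℝ => (((1 + ‖x‖ ^ 2) ^ ((-1 : ℝ) / 2) : ℝ) : ℂ)) (𝓕 q.toDistribution) =
    (q.freq : 𝓢'(ℝ, ℂ)) :=
  q.exists_freq.choose_spec

theorem toTemperedDistribution_injective {f g : L2}
    (h : (f : 𝓢'(ℝ, ℂ)) = (g : 𝓢'(ℝ, ℂ))) : f = g := by
  have hk := Lp.ker_toTemperedDistributionCLM_eq_bot (F := ℂ) (μ := (volume : Measure ℝ)) (p := 2)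
  exact LinearMap.ker_eq_bot.1 hk h

/-- The Fourier transform of `q` as a function, for Mathlib's normalization
`𝓕f(ξ) = ∫ exp(-2πixξ) f(x) dx`. -/
def fourierFn (q : HMinusOne) (ξ : ℝ) : ℂ :=
  (((1 + ξ ^ 2) ^ ((1 : ℝ) / 2) : ℝ) : ℂ) * q.freq ξ

/-- The Fourier transform of `q` as a function, for the unitary normalization
`f̂(ξ) = (2π)^(-1/2) ∫ exp(-ixξ) f(x) dx`. -/
def hat (q : HMinusOne) (ξ : ℝ) : ℂ :=
  (((Real.sqrt (2 * Real.pi))⁻¹ : ℝ) : ℂ) * q.fourierFn (ξ / (2 * Real.pi))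

theorem freq_add (p q : HMinusOne) : (p + q).freq = p.freq + q.freq := by
  apply toTemperedDistribution_injective
  have h : (p + q).toDistribution = p.toDistribution + q.toDistribution := rfl
  rw [← Lp.toTemperedDistributionCLM_apply (p.freq + q.freq), map_add,
    Lp.toTemperedDistributionCLM_apply, Lp.toTemperedDistributionCLM_apply,
    ← freq_spec, ← freq_spec, ← freq_spec, h, FourierTransform.fourier_add, map_add]

theorem freq_smul (c : ℝ) (q : HMinusOne) : (c • q).freq = c • q.freq := by
  apply toTemperedDistribution_injective
  have h : (c • q).toDistribution = (c : ℂ) • q.toDistribution := by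
    ext φ
    exact (Complex.real_smul (x := c) (z := q.toDistribution φ))
  have h' : c • q.freq = (c : ℂ) • q.freq := rfl
  rw [h', ← Lp.toTemperedDistributionCLM_apply ((c : ℂ) • q.freq), map_smul,
    Lp.toTemperedDistributionCLM_apply, ← freq_spec, ← freq_spec, h,
    FourierTransform.fourier_smul, map_smul]

theorem eq_zero_of_freq {q : HMinusOne} (h : q.freq = 0) : q = 0 := by
  have h1 := q.freq_spec
  rw [h, ← Lp.toTemperedDistributionCLM_apply, map_zero] at h1
  have h2 := congrArg (TemperedDistribution.smulLeftCLM ℂ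
      (fun x : ℝ => (((1 + ‖x‖ ^ 2) ^ ((1 : ℝ) / 2) : ℝ) : ℂ))) h1
  rw [TemperedDistribution.smulLeftCLM_smulLeftCLM_apply (by fun_prop) (by fun_prop), map_zero] at h2
  have h3 : ((fun x : ℝ => (((1 + ‖x‖ ^ 2) ^ ((1 : ℝ) / 2) : ℝ) : ℂ)) *
      (fun x : ℝ => (((1 + ‖x‖ ^ 2) ^ ((-1 : ℝ) / 2) : ℝ) : ℂ))) = fun _ => 1 := by
    ext x
    rw [Pi.mul_apply, ← Complex.ofReal_mul, ← Real.rpow_add (by positivity)]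
    norm_num
  have h4 : 𝓕 q.toDistribution = 0 := by
    first
      | rw [h3] at h2
      | rw [mul_comm, h3] at h2
    rwa [TemperedDistribution.smulLeftCLM_const, one_smul] at h2
  have h5 : q.toDistribution = 0 := by
    rw [← FourierTransform.fourierInv_fourier_eq (F := 𝓢'(ℝ, ℂ)) q.toDistribution, h4]
    exact FourierTransform.fourierInv_zero
  exact Subtype.ext h5

/-- The weight that turns `freq q` into `(4π²ξ² + 4)^(-1/2) 𝓕q(ξ)`. -/
def ratio (ξ : ℝ) : ℝ := Real.sqrt ((1 + ξ ^ 2) / (4 * Real.pi ^ 2 * ξ ^ 2 + 4))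

theorem ratio_pos (ξ : ℝ) : 0 < ratio ξ := by unfold ratio; positivity

theorem ratio_le_one (ξ : ℝ) : ratio ξ ≤ 1 := by
  unfold ratio
  rw [Real.sqrt_le_one, div_le_one (by positivity)]
  nlinarith [mul_nonneg (sq_nonneg ξ) (show 0 ≤ Real.pi ^ 2 - 9 by nlinarith [Real.pi_gt_three]),
    sq_nonneg ξ]

theorem memLp_ratio (q : HMinusOne) :
    MemLp (fun ξ => (ratio ξ : ℂ) * q.freq ξ) 2 (volume : Measure ℝ) := by
  refine (Lp.memLp q.freq).of_le ?_ (Filter.Eventually.of_forall fun ξ => ?_)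
  · refine AEStronglyMeasurable.mul ?_ (Lp.aestronglyMeasurable _)
    have : Measurable ratio := by unfold ratio; fun_prop
    exact (Complex.measurable_ofReal.comp this).aestronglyMeasurable
  · rw [norm_mul, Complex.norm_real, Real.norm_of_nonneg (ratio_pos ξ).le]
    exact mul_le_of_le_one_left (norm_nonneg _) (ratio_le_one ξ)

/-- The real-linear injection `q ↦ (4π²ξ² + 4)^(-1/2) 𝓕q(ξ)` into `L²`, whose pullback norm is
the norm of `H⁻¹`. -/
def toL2 : HMinusOne →ₗ[ℝ] L2 where
  toFun q := (memLp_ratio q).toLp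
  map_add' p q := by
    rw [← MemLp.toLp_add]
    apply MemLp.toLp_congr
    rw [freq_add]
    filter_upwards [Lp.coeFn_add p.freq q.freq] with ξ hξ
    simp only [Pi.add_apply, hξ, mul_add]
  map_smul' c q := by
    rw [RingHom.id_apply, ← MemLp.toLp_const_smul]
    apply MemLp.toLp_congr
    rw [freq_smul]
    filter_upwards [Lp.coeFn_smul c q.freq] with ξ hξ
    simp only [Pi.smul_apply, hξ, Complex.real_smul]
    ring

theorem toL2_injective : Function.Injective toL2 := by
  rw [← LinearMap.ker_eq_bot, LinearMap.ker_eq_bot']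
  intro q hq
  apply eq_zero_of_freq
  rw [Lp.eq_zero_iff_ae_eq_zero]
  have h1 : (fun ξ => (ratio ξ : ℂ) * q.freq ξ) =ᵐ[volume] 0 := by
    have h2 := (memLp_ratio q).coeFn_toLp
    have h3 : (memLp_ratio q).toLp = 0 := hq
    rw [h3] at h2
    exact h2.symm.trans (Lp.coeFn_zero _ _ _)
  filter_upwards [h1] with ξ hξ
  have := (ratio_pos ξ).ne'
  simpa [this] using hξ

instance : NormedAddCommGroup HMinusOne :=
  NormedAddCommGroup.induced HMinusOne L2 toL2 toL2_injective

instance : NormedSpace ℝ HMinusOne := NormedSpace.induced ℝ HMinusOne L2 toL2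

/-- The norm is `‖q‖² = ∫ |q̂(ξ)|² / (ξ² + 4) dξ`. -/
theorem norm_sq_eq (q : HMinusOne) :
    ‖q‖ ^ 2 = ∫ ξ : ℝ, ‖q.hat ξ‖ ^ 2 / (ξ ^ 2 + 4) := by
  have h1 : ‖q‖ = ‖toL2 q‖ := rfl
  have h2 : ‖toL2 q‖ ^ 2 = ∫ ξ : ℝ, ‖toL2 q ξ‖ ^ 2 := by
    have h := L2.inner_def (𝕜 := ℂ) (toL2 q) (toL2 q)
    rw [inner_self_eq_norm_sq_to_K] at h
    have h' : (((‖toL2 q‖ ^ 2 : ℝ)) : ℂ) = ((∫ ξ : ℝ, ‖toL2 q ξ‖ ^ 2 : ℝ) : ℂ) := by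
      rw [← integral_complex_ofReal]
      push_cast
      refine h.trans (integral_congr_ae (Filter.Eventually.of_forall fun ξ => ?_))
      simp [inner_self_eq_norm_sq_to_K]
    exact_mod_cast h'
  have h3 : ∫ ξ : ℝ, ‖toL2 q ξ‖ ^ 2 =
      ∫ ξ : ℝ, ‖q.fourierFn ξ‖ ^ 2 / (4 * Real.pi ^ 2 * ξ ^ 2 + 4) := by
    apply integral_congr_ae
    filter_upwards [(memLp_ratio q).coeFn_toLp] with ξ hξ
    have h4 : toL2 q ξ = (ratio ξ : ℂ) * q.freq ξ := hξ
    rw [h4, fourierFn, norm_mul, norm_mul, Complex.norm_real, Complex.norm_real, mul_pow, mul_pow,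
      Real.norm_eq_abs, Real.norm_eq_abs, sq_abs, sq_abs, ratio, Real.sq_sqrt (by positivity),
      ← Real.sqrt_eq_rpow, Real.sq_sqrt (by positivity)]
    ring
  have h5 := Measure.integral_comp_div
    (fun ξ : ℝ => ‖q.fourierFn ξ‖ ^ 2 / (4 * Real.pi ^ 2 * ξ ^ 2 + 4)) (2 * Real.pi)
  rw [h1, h2, h3]
  have hpi := Real.pi_pos
  have h6 : (∫ ξ : ℝ, ‖q.hat ξ‖ ^ 2 / (ξ ^ 2 + 4)) = (2 * Real.pi)⁻¹ *
      ∫ ξ : ℝ, ‖q.fourierFn (ξ / (2 * Real.pi))‖ ^ 2 /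
        (4 * Real.pi ^ 2 * (ξ / (2 * Real.pi)) ^ 2 + 4) := by
    rw [← integral_const_mul]
    congr 1
    ext ξ
    have h7 : 4 * Real.pi ^ 2 * (ξ / (2 * Real.pi)) ^ 2 = ξ ^ 2 := by field_simp; ring
    rw [h7, hat, norm_mul, Complex.norm_real, mul_pow, Real.norm_eq_abs, sq_abs, inv_pow,
      Real.sq_sqrt (by positivity)]
    ring
  rw [h6, h5, abs_of_pos (by positivity), smul_eq_mul, ← mul_assoc,
    inv_mul_cancel₀ (by positivity), one_mul]

/-- The pairing of `q ∈ H⁻¹(ℝ)` with `h ∈ L¹(ℝ) ∩ H¹(ℝ)` that extends the bilinear pairing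
`∫ q(x) h(x) dx` of functions. -/
def pairing (q : HMinusOne) (h : ℝ → ℂ) : ℂ := ∫ ξ : ℝ, q.fourierFn ξ * 𝓕⁻ h ξ

/-- On Schwartz functions the pairing is the action of the distribution `q`. -/
theorem pairing_schwartz (q : HMinusOne) (φ : 𝓢(ℝ, ℂ)) : q.pairing φ = q.toDistribution φ := by
  have h1 : 𝓕 q.toDistribution = TemperedDistribution.smulLeftCLM ℂ
      (fun x : ℝ => (((1 + ‖x‖ ^ 2) ^ ((1 : ℝ) / 2) : ℝ) : ℂ)) (q.freq : 𝓢'(ℝ, ℂ)) := by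
    rw [← freq_spec, TemperedDistribution.smulLeftCLM_smulLeftCLM_apply (by fun_prop) (by fun_prop)]
    have h3 : ((fun x : ℝ => (((1 + ‖x‖ ^ 2) ^ ((1 : ℝ) / 2) : ℝ) : ℂ)) *
        (fun x : ℝ => (((1 + ‖x‖ ^ 2) ^ ((-1 : ℝ) / 2) : ℝ) : ℂ))) = fun _ => 1 := by
      ext x
      rw [Pi.mul_apply, ← Complex.ofReal_mul, ← Real.rpow_add (by positivity)]
      norm_num
    first
      | rw [h3]
      | rw [mul_comm, h3]
    rw [TemperedDistribution.smulLeftCLM_const, one_smul]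
  have h2 : q.toDistribution φ = (𝓕 q.toDistribution) (𝓕⁻ φ) := by
    rw [TemperedDistribution.fourier_apply, FourierTransform.fourier_fourierInv_eq]
  rw [h2, h1, TemperedDistribution.smulLeftCLM_apply_apply, Lp.toTemperedDistribution_apply, pairing]
  congr 1
  ext ξ
  rw [SchwartzMap.smulLeftCLM_apply_apply (by fun_prop), SchwartzMap.fourierInv_coe, fourierFn]
  simp only [Real.norm_eq_abs, sq_abs, smul_eq_mul]
  ring

end HMinusOne

/-! ### The Schrödinger operator and its Green's function -/

/-- `u' = v` in the sense of distributions, for `u, v ∈ L²(ℝ)`. -/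
def HasWeakDeriv (u v : L2) : Prop :=
  ∂_{(1 : ℝ)} (u : 𝓢'(ℝ, ℂ)) = (v : 𝓢'(ℝ, ℂ))

/-- The function `f` belongs to `H¹(ℝ)`. -/
def MemH1 (f : ℝ → ℂ) : Prop := ∃ u v : L2, u =ᵐ[volume] f ∧ HasWeakDeriv u v

/-- `IsSchrodinger q u w` says that `u` lies in the domain of `L = -∂² + q` and `L u = w`, where
`L` is the operator associated with the quadratic form `ψ ↦ ∫ |ψ'|² + q |ψ|²` on `H¹(ℝ)`:
`u ∈ H¹` and `∫ conj(v') u' + ⟨q, conj(v) u⟩ = ∫ conj(v) w` for all `v ∈ H¹`. -/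
def IsSchrodinger (q : HMinusOne) (u w : L2) : Prop :=
  ∃ u' : L2, HasWeakDeriv u u' ∧ ∀ v v' : L2, HasWeakDeriv v v' →
    inner ℂ v' u' + q.pairing (fun x => starRingEnd ℂ (v x) * u x) = inner ℂ v w

/-- `IsResolvent κ q f u` says that `L + κ²` takes the value `f` at `u` and nowhere else, that is,
`u = (L + κ²)⁻¹ f`. -/
def IsResolvent (κ : ℝ) (q : HMinusOne) (f u : L2) : Prop :=
  ∀ v : L2, IsSchrodinger q v (f - ((κ ^ 2 : ℝ) : ℂ) • v) ↔ v = u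

/-- `G` is a continuous integral kernel of the resolvent `(L + κ²)⁻¹`. -/
structure IsGreen (κ : ℝ) (q : HMinusOne) (G : ℝ → ℝ → ℝ) : Prop where
  continuous : Continuous (Function.uncurry G)
  kernel : ∀ f : L2, ∃ u : L2, IsResolvent κ q f u ∧
    ∀ᵐ x : ℝ, Integrable (fun y => (G x y : ℂ) * f y) ∧ u x = ∫ y : ℝ, (G x y : ℂ) * f y

open Classical in
/-- The Green's function `G(x, y; κ, q)` (zero if there is none). -/
def green (κ : ℝ) (q : HMinusOne) : ℝ → ℝ → ℝ :=
  if h : ∃ G, IsGreen κ q G then h.choose else 0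

/-- The diagonal Green's function `g(x; κ, q) = G(x, x; κ, q)`. -/
def g (κ : ℝ) (q : HMinusOne) (x : ℝ) : ℝ := green κ q x x

/-- The convolution `∫ exp(-2κ|x - y|) q(y) dy`. -/
def expConv (κ : ℝ) (q : HMinusOne) (x : ℝ) : ℝ :=
  (q.pairing fun y => (Real.exp (-2 * κ * |x - y|) : ℂ)).re

/-- The density `ρ(x; κ, q)`. -/
def rho (κ : ℝ) (q : HMinusOne) (x : ℝ) : ℝ :=
  κ - 1 / (2 * g κ q x) + 1 / 2 * expConv κ q x

/-- The functional `α(κ; q) = ∫ ρ(x; κ, q) dx`. -/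
def alpha (κ : ℝ) (q : HMinusOne) : ℝ := ∫ x : ℝ, rho κ q x

/-! ### The renormalized determinant -/

open Classical in
/-- The square root of the free resolvent `R₀ = (-∂² + κ²)⁻¹`, `κ ≠ 0`: the Fourier multiplier with
symbol `(4π²ξ² + κ²)^(-1/2)` in Mathlib's normalization of the Fourier transform. The symbol is
bounded, so the condition in the definition always holds. -/
def sqrtR0 (κ : ℝ) (f : L2) : L2 :=
  if h : MemLp (fun ξ : ℝ => (((4 * Real.pi ^ 2 * ξ ^ 2 + κ ^ 2) ^ (-(1 : ℝ) / 2) : ℝ) : ℂ) *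
      (𝓕 f : L2) ξ) 2 (volume : Measure ℝ)
  then 𝓕⁻ (h.toLp : L2) else 0

/-- `A` is the bounded operator `√R₀ q √R₀` on `L²(ℝ)`, that is,
`⟨φ, A ψ⟩ = ⟨q, conj(√R₀ φ) √R₀ ψ⟩` for all `φ, ψ ∈ L²`. -/
def IsSandwich (κ : ℝ) (q : HMinusOne) (A : L2 →L[ℂ] L2) : Prop :=
  ∀ φ ψ : L2, inner ℂ φ (A ψ) =
    q.pairing fun x => starRingEnd ℂ (sqrtR0 κ φ x) * sqrtR0 κ ψ x

/-- Hilbert–Schmidt operators on `L²(ℝ)`. -/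
def IsHilbertSchmidt (A : L2 →L[ℂ] L2) : Prop :=
  ∃ (ι : Type) (b : HilbertBasis ι ℂ L2), Summable fun i => ‖A (b i)‖ ^ 2

/-- `d` is the renormalized Fredholm determinant `det₂(1 + A) = ∏ (1 + μ) exp(-μ)` of the
Hilbert–Schmidt operator `A`; the product runs over the nonzero eigenvalues of `A`, counted with
algebraic multiplicity (other `μ` contribute the factor `1`). -/
def HasDet2 (A : L2 →L[ℂ] L2) (d : ℂ) : Prop :=
  HasProd (fun μ : ℂ => ((1 + μ) * Complex.exp (-μ)) ^
    Module.finrank ℂ (Module.End.maxGenEigenspace (A : L2 →ₗ[ℂ] L2) μ)) d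

end KdV

end

/-! Everything is expressed through the self-adjoint operator A = √R₀ q √R₀ (`sand`). In frequency
space it is an integral operator, and its squared Hilbert–Schmidt norm is exactly
(1/κ)∫|q̂|²/(ξ²+4κ²) (`hsSq_sand`), at most ‖q‖² when κ ≥ 1. Hence ‖q‖ ≤ 1/2 gives ‖A‖ ≤ 1/2 for all
κ ≥ 1 at once. Since √R₀ maps L² onto H¹, the resolvent is √R₀(1+A)⁻¹√R₀. With the vectors E_x
(`kerE`) for which (√R₀φ)(x) = ⟨E_x, φ⟩, the Green's function is G(x,y) = ⟨E_x, (1+A)⁻¹E_y⟩.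

Convexity is variational: 1/g(x) is the minimum of ⟨v, (1+A)v⟩ over ⟨E_x, v⟩ = 1, an infimum of
functions affine in q, hence concave (`inner_sq_le_form`, `rho_subgrad`). The linear term of ρ
cancels the first-order part at q = 0, so ρ is convex with minimum ρ = 0 at q = 0. The subgradient
inequality between q and 0 also gives ρ(x) ≤ C‖A E_x‖², and ∫‖B E_x‖² dx is at most the squared
Hilbert–Schmidt norm of B (`lintegral_apply_kerE`), so ρ is integrable. The same estimate for
E_{x+t} − E_x, which costs a factor t², puts ρ in H¹. The form is coercive, so the subgradient
inequality has a quadratic remainder in the minimizers. If α is not strictly convex between p and q,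
then their minimizers agree for every x, which forces p = q (`eq_of_minVec_eq`).

If μ_i are the eigenvalues of A, then −log det₂(1+A) = Σ(μ_i − log(1+μ_i)), which is comparable to
Σμ_i² and hence gives the two-sided bound. It is also the trace of A²φ(A) for the power series φ(t)
= (t − log(1+t))/t², that is, a Hilbert–Schmidt inner product of A with φ(A)A, hence real-analytic
in q.

The identity α = −log det₂ is proved first for Schwartz potentials f. Along s ↦ sf both sides are
convex with the same subgradient ∫ f(z)(1/(2κ) − g(z; sf)) dz, so they have equal increments
(`eq_of_common_subgradient`). For the determinant this is an expansion in eigenvectors. For α it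
rests on ∫ G(x,y)²/(2g(x)²) dx = g(y) (`IsGreenFn.integral_sq_div`), a consequence of the
factorization of G into two decaying solutions. General q follow by density, as α (convex and
bounded) and the determinant (analytic) are both continuous. -/

noncomputable section

set_option linter.unusedSectionVars false

namespace KdV

/-! ### Hilbert–Schmidt operators on a Hilbert space -/

section HilbertSchmidt

open scoped ENNReal InnerProductSpace

variable {H : Type*} [NormedAddCommGroup H] [InnerProductSpace ℂ H] [CompleteSpace H]
variable {ι ι' : Type*}

/-- The square of the Hilbert–Schmidt norm, computed in the basis `b`. -/
def hsSq (b : HilbertBasis ι ℂ H) (B : H →L[ℂ] H) : ℝ≥0∞ := ∑' i, ‖B (b i)‖ₑ ^ 2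

theorem hasSum_norm_inner_sq (b : HilbertBasis ι ℂ H) (v : H) :
    HasSum (fun i => ‖⟪b i, v⟫_ℂ‖ ^ 2) (‖v‖ ^ 2) := by
  have h := b.hasSum_inner_mul_inner v v
  rw [inner_self_eq_norm_sq_to_K] at h
  have h2 := Complex.hasSum_re h
  convert h2 using 1
  · ext i
    rw [← inner_conj_symm v (b i), mul_comm, RCLike.mul_conj]
    norm_cast
  · norm_cast

theorem tsum_enorm_inner_sq (b : HilbertBasis ι ℂ H) (v : H) :
    ∑' i, ‖⟪b i, v⟫_ℂ‖ₑ ^ 2 = ‖v‖ₑ ^ 2 := by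
  have h := hasSum_norm_inner_sq b v
  have h2 := ENNReal.ofReal_tsum_of_nonneg (fun i => by positivity) h.summable
  rw [h.tsum_eq] at h2
  simp only [ENNReal.ofReal_pow (norm_nonneg _), ofReal_norm] at h2
  exact h2.symm

/-- Both sides are the double sum of |⟨c_j, B b_i⟩|², summed in the two orders. Using it twice makes
`hsSq` independent of the basis. -/
theorem hsSq_eq_adjoint (b : HilbertBasis ι ℂ H) (c : HilbertBasis ι' ℂ H) (B : H →L[ℂ] H) :
    hsSq b B = hsSq c B.adjoint := by
  unfold hsSq
  simp_rw [← tsum_enorm_inner_sq c (B (b _)), ← tsum_enorm_inner_sq b (B.adjoint (c _))]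
  rw [ENNReal.tsum_comm]
  refine tsum_congr fun j => tsum_congr fun i => ?_
  rw [ContinuousLinearMap.adjoint_inner_right]
  simp only [enorm_eq_nnnorm, ← inner_conj_symm (c j), RCLike.nnnorm_conj]

theorem hsSq_eq (b : HilbertBasis ι ℂ H) (c : HilbertBasis ι' ℂ H) (B : H →L[ℂ] H) :
    hsSq b B = hsSq c B := by
  rw [hsSq_eq_adjoint b b, hsSq_eq_adjoint b c, ContinuousLinearMap.adjoint_adjoint]

theorem hsSq_comp_le (b : HilbertBasis ι ℂ H) (C B : H →L[ℂ] H) :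
    hsSq b (C ∘L B) ≤ ‖C‖ₑ ^ 2 * hsSq b B := by
  unfold hsSq
  rw [← ENNReal.tsum_mul_left]
  refine ENNReal.tsum_le_tsum fun i => ?_
  rw [← mul_pow]
  gcongr
  exact C.le_opENorm _

theorem enorm_apply_sq_le (b : HilbertBasis ι ℂ H) (B : H →L[ℂ] H) (v : H) :
    ‖B v‖ₑ ^ 2 ≤ hsSq b B * ‖v‖ₑ ^ 2 := by
  rw [hsSq_eq_adjoint b b, hsSq, ← tsum_enorm_inner_sq b (B v), ← ENNReal.tsum_mul_right]
  refine ENNReal.tsum_le_tsum fun i => ?_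
  rw [← ContinuousLinearMap.adjoint_inner_left, ← mul_pow]
  gcongr
  simp only [enorm_eq_nnnorm]
  exact_mod_cast nnnorm_inner_le_nnnorm (𝕜 := ℂ) _ _

theorem enorm_sq_le_hsSq (b : HilbertBasis ι ℂ H) (B : H →L[ℂ] H) (hB : hsSq b B ≠ ∞) :
    ‖B‖ ≤ Real.sqrt (hsSq b B).toReal := by
  refine B.opNorm_le_bound (Real.sqrt_nonneg _) fun v => ?_
  have h := enorm_apply_sq_le b B v
  have h2 := ENNReal.toReal_mono (ENNReal.mul_ne_top hB (by simp)) h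
  simp only [ENNReal.toReal_pow, ENNReal.toReal_mul, toReal_enorm] at h2
  apply Real.le_sqrt_of_sq_le at h2
  rwa [Real.sqrt_mul ENNReal.toReal_nonneg, Real.sqrt_sq (norm_nonneg _)] at h2

theorem hsSq_ne_top_iff (b : HilbertBasis ι ℂ H) (B : H →L[ℂ] H) :
    hsSq b B ≠ ∞ ↔ Summable fun i => ‖B (b i)‖ ^ 2 := by
  have h : hsSq b B = ∑' i, ((‖B (b i)‖₊ ^ 2 : NNReal) : ℝ≥0∞) := by
    simp [hsSq, enorm_eq_nnnorm]
  rw [h, ENNReal.tsum_coe_ne_top_iff_summable, ← NNReal.summable_coe]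
  simp

theorem toReal_hsSq (b : HilbertBasis ι ℂ H) (B : H →L[ℂ] H) :
    (hsSq b B).toReal = ∑' i, ‖B (b i)‖ ^ 2 := by
  rw [hsSq, ENNReal.tsum_toReal_eq (by simp)]
  simp

/-- A Hilbert–Schmidt operator is compact. -/
theorem isCompactOperator_of_hsSq (b : HilbertBasis ι ℂ H) (B : H →L[ℂ] H) (hB : hsSq b B ≠ ∞) :
    IsCompactOperator B := by
  classical
  have hs := (hsSq_ne_top_iff b B).1 hB
  -- Finite-rank truncations of `B`: the squared Hilbert–Schmidt norm of `F s - B` is the tail of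
  -- the convergent sum of ‖B b_i‖², so `F s` tends to `B` in operator norm.
  let F : Finset ι → (H →L[ℂ] H) := fun s =>
    ∑ i ∈ s, (innerSL ℂ (b i)).smulRight (B (b i))
  have hF : ∀ s, IsCompactOperator (F s) := by
    intro s
    have : F s ∈ compactOperator (RingHom.id ℂ) H H := by
      refine Submodule.sum_mem _ fun i _ => ?_
      have h1 : IsCompactOperator (innerSL ℂ (b i)) :=
        isCompactOperator_of_locallyCompactSpace_dom (innerSL ℂ (b i))
      exact h1.clm_comp (ContinuousLinearMap.toSpanSingleton ℂ (B (b i)))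
    exact this
  have hFb : ∀ s i, F s (b i) = if i ∈ s then B (b i) else 0 := by
    intro s i
    simp only [F, sum_apply, ContinuousLinearMap.smulRight_apply,
      innerSL_apply_apply, orthonormal_iff_ite.1 b.orthonormal, ite_smul, one_smul, zero_smul,
      Finset.sum_ite_eq']
  refine isCompactOperator_of_tendsto (F := F) (l := Filter.atTop) ?_ (Filter.Eventually.of_forall hF)
  rw [tendsto_iff_norm_sub_tendsto_zero]
  have hnorm : ∀ s, ‖F s - B‖ ≤ Real.sqrt (∑' i : {i // i ∉ s}, ‖B (b i)‖ ^ 2) := by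
    intro s
    have e1 : hsSq b (F s - B) = ∑' i : {i // i ∉ s}, ‖B (b i)‖ₑ ^ 2 := by
      rw [hsSq]
      have : ∀ i, ‖(F s - B) (b i)‖ₑ ^ 2 =
          Set.indicator {i | i ∉ s} (fun i => ‖B (b i)‖ₑ ^ 2) i := by
        intro i
        by_cases h : i ∈ s <;> simp [hFb, h]
      simp_rw [this]
      exact (tsum_subtype _ _).symm
    have e2 : hsSq b (F s - B) ≠ ∞ := by
      rw [e1]
      refine ne_top_of_le_ne_top hB ?_
      exact ENNReal.tsum_comp_le_tsum_of_injective Subtype.val_injective _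
    refine (enorm_sq_le_hsSq b _ e2).trans (le_of_eq ?_)
    rw [e1, ENNReal.tsum_toReal_eq (by simp)]
    simp
  refine squeeze_zero (fun _ => norm_nonneg _) hnorm ?_
  have := (tendsto_tsum_compl_atTop_zero (fun i => ‖B (b i)‖ ^ 2)).sqrt
  simpa using this

theorem summable_inner_apply_sq (b : HilbertBasis ι ℂ H) (c : HilbertBasis ι' ℂ H) (C : H →L[ℂ] H)
    (hC : hsSq b C ≠ ∞) : Summable fun p : ι × ι' => ‖⟪c p.2, C (b p.1)⟫_ℂ‖ ^ 2 := by
  have h : ∀ i, HasSum (fun j => ‖⟪c j, C (b i)⟫_ℂ‖ ^ 2) (‖C (b i)‖ ^ 2) := fun i =>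
    hasSum_norm_inner_sq c _
  have h0 : (0 : ι × ι' → ℝ) ≤ fun p => ‖⟪c p.2, C (b p.1)⟫_ℂ‖ ^ 2 := fun p => sq_nonneg _
  refine (summable_prod_of_nonneg h0).2 ⟨fun i => (h i).summable, ?_⟩
  exact ((hsSq_ne_top_iff b C).1 hC).congr fun i => ((h i).tsum_eq).symm

/-- Parseval expands each side into the same double sum. The two Hilbert–Schmidt hypotheses, through
2xy ≤ x² + y², make it absolutely summable, which justifies the interchange. -/
theorem tsum_inner_eq_tsum_adjoint (b : HilbertBasis ι ℂ H) (c : HilbertBasis ι' ℂ H)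
    (A B : H →L[ℂ] H) (hA : hsSq b A ≠ ∞) (hB : hsSq b B ≠ ∞) :
    ∑' i, ⟪A (b i), B (b i)⟫_ℂ = ∑' j, ⟪B.adjoint (c j), A.adjoint (c j)⟫_ℂ := by
  have h0 : ∀ i j, ⟪B.adjoint (c j), b i⟫_ℂ * ⟪b i, A.adjoint (c j)⟫_ℂ =
      ⟪A (b i), c j⟫_ℂ * ⟪c j, B (b i)⟫_ℂ := by
    intro i j
    rw [ContinuousLinearMap.adjoint_inner_left, ContinuousLinearMap.adjoint_inner_right, mul_comm]
  have h1 : ∀ i, ⟪A (b i), B (b i)⟫_ℂ = ∑' j, ⟪A (b i), c j⟫_ℂ * ⟪c j, B (b i)⟫_ℂ :=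
    fun i => (c.tsum_inner_mul_inner _ _).symm
  have h2 : ∀ j, ⟪B.adjoint (c j), A.adjoint (c j)⟫_ℂ =
      ∑' i, ⟪A (b i), c j⟫_ℂ * ⟪c j, B (b i)⟫_ℂ := by
    intro j
    rw [← b.tsum_inner_mul_inner]
    exact tsum_congr fun i => h0 i j
  rw [tsum_congr h1, tsum_congr h2]
  have hs : Summable fun p : ι × ι' => ⟪A (b p.1), c p.2⟫_ℂ * ⟪c p.2, B (b p.1)⟫_ℂ := by
    refine Summable.of_norm_bounded
      ((summable_inner_apply_sq b c A hA).add (summable_inner_apply_sq b c B hB)) fun p => ?_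
    rw [norm_mul, norm_inner_symm]
    generalize ‖⟪c p.2, A (b p.1)⟫_ℂ‖ = x
    generalize ‖⟪c p.2, B (b p.1)⟫_ℂ‖ = y
    nlinarith [sq_nonneg (x - y), sq_nonneg x, sq_nonneg y]
  refine (Summable.tsum_comm' (f := fun i j => ⟪A (b i), c j⟫_ℂ * ⟪c j, B (b i)⟫_ℂ) hs ?_ ?_).symm
  · exact fun i => c.summable_inner_mul_inner _ _
  · intro j
    exact (b.summable_inner_mul_inner (B.adjoint (c j)) (A.adjoint (c j))).congr fun i => h0 i j

/-- The trace of `A* B` does not depend on the basis. -/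
theorem tsum_inner_eq (b : HilbertBasis ι ℂ H) (c : HilbertBasis ι' ℂ H) (A B : H →L[ℂ] H)
    (hA : hsSq b A ≠ ∞) (hB : hsSq b B ≠ ∞) :
    ∑' i, ⟪A (b i), B (b i)⟫_ℂ = ∑' j, ⟪A (c j), B (c j)⟫_ℂ := by
  rw [tsum_inner_eq_tsum_adjoint b c A B hA hB, tsum_inner_eq_tsum_adjoint c c A B
    (hsSq_eq b c A ▸ hA) (hsSq_eq b c B ▸ hB)]

/-- A compact self-adjoint operator has a Hilbert basis of eigenvectors. -/
theorem exists_eigenbasis (A : H →L[ℂ] H) (hA : IsCompactOperator A)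
    (hs : (A : H →ₗ[ℂ] H).IsSymmetric) :
    ∃ (w : Set H) (b : HilbertBasis w ℂ H) (μ : w → ℝ), ∀ i, A (b i) = (μ i : ℂ) • b i := by
  have key := ContinuousLinearMap.orthogonalComplement_iSup_eigenspaces_eq_bot hA hs
  let V : ℂ → Submodule ℂ H := fun z => Module.End.eigenspace (A : Module.End ℂ H) z
  have hV : ∀ z, IsClosed (V z : Set H) := by
    intro z
    have : (V z : Set H) = {v | A v = z • v} := by
      ext v; exact Module.End.mem_eigenspace_iff
    rw [this]
    exact isClosed_eq A.continuous (continuous_const_smul z)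
  have : ∀ z, CompleteSpace (V z) := fun z => (hV z).completeSpace_coe
  -- One basis for each eigenspace, the kernel included. By symmetry distinct eigenspaces are
  -- orthogonal, and by compactness they span a dense subspace.
  choose w b hb using fun z => exists_hilbertBasis ℂ (V z)
  let v : (Σ z, w z) → H := fun p => ((b p.1 p.2 : V p.1) : H)
  have hAv : ∀ p, A (v p) = p.1 • v p := fun p =>
    Module.End.mem_eigenspace_iff.1 (b p.1 p.2).2
  have hortho := hs.orthogonalFamily_eigenspaces
  have hv : Orthonormal ℂ v := by
    have := hortho.orthonormal_sigma_orthonormal (v_family := fun z => (b z : w z → V z))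
      (fun z => (b z).orthonormal)
    exact this
  have hspan : (Submodule.span ℂ (Set.range v))ᗮ = ⊥ := by
    rw [eq_bot_iff, ← key]
    intro x hx
    rw [Submodule.mem_orthogonal'] at hx
    rw [Submodule.mem_orthogonal']
    have hcl : ∀ u ∈ (Submodule.span ℂ (Set.range v)).topologicalClosure, ⟪x, u⟫_ℂ = 0 := by
      intro u hu
      have hc : IsClosed {u | ⟪x, u⟫_ℂ = 0} := isClosed_eq (by fun_prop) continuous_const
      exact closure_minimal (fun u hu => hx u hu) hc hu
    intro u hu
    apply hcl
    have : (⨆ z, V z) ≤ (Submodule.span ℂ (Set.range v)).topologicalClosure := by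
      refine iSup_le fun z y hy => ?_
      have h1 := (b z).hasSum_repr ⟨y, hy⟩
      have h2 := ((V z).subtypeL).hasSum h1
      refine (Submodule.isClosed_topologicalClosure _).mem_of_tendsto h2
        (Filter.Eventually.of_forall fun s => ?_)
      refine Submodule.sum_mem _ fun i _ => ?_
      apply Submodule.le_topologicalClosure
      simp only [map_smul]
      exact Submodule.smul_mem _ _ (Submodule.subset_span ⟨⟨z, i⟩, rfl⟩)
    exact this hu
  have hinj : Function.Injective v := hv.linearIndependent.injective
  let e : (Σ z, w z) ≃ Set.range v := Equiv.ofInjective v hinj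
  have hv' : Orthonormal ℂ (fun i : Set.range v => v (e.symm i)) := hv.comp _ e.symm.injective
  have hr : Set.range (fun i : Set.range v => v (e.symm i)) = Set.range v :=
    e.symm.surjective.range_comp v
  refine ⟨Set.range v, HilbertBasis.mkOfOrthogonalEqBot hv' (by rw [hr, hspan]),
    fun i => (e.symm i).1.re, fun i => ?_⟩
  rw [HilbertBasis.coe_mkOfOrthogonalEqBot, hAv]
  congr 1
  have hne : v (e.symm i) ≠ 0 := hv.ne_zero _
  have hev : Module.End.HasEigenvalue (A : Module.End ℂ H) (e.symm i).1 :=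
    Module.End.hasEigenvalue_of_hasEigenvector ⟨Module.End.mem_eigenspace_iff.2 (hAv _), hne⟩
  exact (Complex.conj_eq_iff_re.1 (hs.conj_eigenvalue_eq_self hev)).symm

end HilbertSchmidt

/-! ### The renormalized determinant in an eigenbasis -/

section Det2

open scoped InnerProductSpace

/-- Minus the logarithm of the factor `(1 + t) exp (-t)`. -/
def logFactor (t : ℝ) : ℝ := t - Real.log (1 + t)

theorem exp_neg_logFactor {t : ℝ} (ht : -1 < t) :
    Real.exp (-logFactor t) = (1 + t) * Real.exp (-t) := by
  rw [logFactor, neg_sub, sub_eq_add_neg, Real.exp_add, Real.exp_log (by linarith)]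

theorem logFactor_le {t : ℝ} (ht : |t| ≤ 1 / 2) : logFactor t ≤ 2 * t ^ 2 := by
  obtain ⟨h1, h2⟩ := abs_le.1 ht
  have h := Real.one_sub_inv_le_log_of_pos (show 0 < 1 + t by linarith)
  have h3 : t - (1 - (1 + t)⁻¹) ≤ 2 * t ^ 2 := by
    have : t - (1 - (1 + t)⁻¹) = t ^ 2 / (1 + t) := by
      field_simp [show (1 + t) ≠ 0 by linarith]; ring
    rw [this, div_le_iff₀ (by linarith)]
    nlinarith [sq_nonneg t]
  unfold logFactor; linarith

/-- The bound log r ≤ r − 1 is applied to r = √(1+t). It gives t − log(1+t) ≥ t − 2(r−1) = (r−1)²,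
while t = (r−1)(r+1) and (r+1)² ≤ 8. -/
theorem le_logFactor {t : ℝ} (ht : |t| ≤ 1 / 2) : t ^ 2 / 8 ≤ logFactor t := by
  obtain ⟨h1, h2⟩ := abs_le.1 ht
  have hpos : 0 < 1 + t := by linarith
  set r := Real.sqrt (1 + t) with hr
  have hr0 : 0 < r := Real.sqrt_pos.2 hpos
  have hr2 : r ^ 2 = 1 + t := Real.sq_sqrt hpos.le
  have hlog : Real.log (1 + t) ≤ 2 * (r - 1) := by
    rw [← hr2, Real.log_pow]
    have := Real.log_le_sub_one_of_pos hr0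
    push_cast; linarith
  have hr3 : r ≤ 5 / 4 := by nlinarith
  have e : t = (r - 1) * (r + 1) := by nlinarith
  have : t ^ 2 ≤ 8 * (r - 1) ^ 2 := by
    rw [e, mul_pow, mul_comm]
    gcongr
    nlinarith
  unfold logFactor
  nlinarith

theorem logFactor_nonneg {t : ℝ} (ht : |t| ≤ 1 / 2) : 0 ≤ logFactor t :=
  le_trans (by positivity) (le_logFactor ht)

/-- The tangent-line inequality of a convex function, whose derivative is t/(1+t). Summed over
eigenvalues it is the subgradient inequality of −log det₂. -/
theorem logFactor_sub_ge {t t' : ℝ} (ht : -1 < t) (ht' : -1 < t') :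
    (t' - t) * (t / (1 + t)) ≤ logFactor t' - logFactor t := by
  have h1 : 0 < 1 + t := by linarith
  have h2 : 0 < 1 + t' := by linarith
  have h := Real.log_le_sub_one_of_pos (div_pos h2 h1)
  rw [Real.log_div h2.ne' h1.ne'] at h
  have h3 : (t' - t) * (t / (1 + t)) = (t' - t) - ((1 + t') / (1 + t) - 1) := by
    field_simp; ring
  unfold logFactor; linarith

variable {H : Type*} [NormedAddCommGroup H] [InnerProductSpace ℂ H] [CompleteSpace H]
variable {ι : Type*}

theorem finite_eigenvalue_eq {μ : ι → ℝ} (hμ : Summable fun i => μ i ^ 2) {z : ℂ} (hz : z ≠ 0) :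
    Finite {i // (μ i : ℂ) = z} := by
  have h := hμ.tendsto_cofinite_zero
  have h2 := h.eventually (gt_mem_nhds (show 0 < ‖z‖ ^ 2 by positivity))
  rw [Filter.eventually_cofinite] at h2
  have h3 : {i | (μ i : ℂ) = z}.Finite := by
    refine h2.subset fun i hi => ?_
    rw [Set.mem_ofPred_eq] at hi ⊢
    rw [← hi, Complex.norm_real, Real.norm_eq_abs, sq_abs, not_lt]
  exact h3.to_subtype

/-- A symmetric operator has no Jordan blocks, so algebraic multiplicity is geometric. An
eigenvector for z has zero coefficients on the b_i with μ_i ≠ z, hence lies in the span of the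
finitely many remaining ones, which is closed. -/
theorem finrank_maxGenEigenspace {A : H →L[ℂ] H} (hA : (A : H →ₗ[ℂ] H).IsSymmetric)
    (b : HilbertBasis ι ℂ H) {μ : ι → ℝ} (h : ∀ i, A (b i) = (μ i : ℂ) • b i)
    {z : ℂ} [Fintype {i // (μ i : ℂ) = z}] :
    Module.finrank ℂ (Module.End.maxGenEigenspace (A : H →ₗ[ℂ] H) z) =
      Fintype.card {i // (μ i : ℂ) = z} := by
  rw [hA.isFinitelySemisimple.maxGenEigenspace_eq_eigenspace]
  have hli : LinearIndependent ℂ (fun i : {i // (μ i : ℂ) = z} => b i) :=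
    b.orthonormal.linearIndependent.comp _ Subtype.val_injective
  rw [← finrank_span_eq_card hli]
  have hle : Submodule.span ℂ (Set.range fun i : {i // (μ i : ℂ) = z} => b i) =
      Module.End.eigenspace (A : H →ₗ[ℂ] H) z := by
    apply le_antisymm
    · rw [Submodule.span_le]
      rintro _ ⟨i, rfl⟩
      rw [SetLike.mem_coe, Module.End.mem_eigenspace_iff]
      exact (h i).trans (by rw [i.2])
    · intro v hv
      rw [Module.End.mem_eigenspace_iff] at hv
      have hzero : ∀ i, (μ i : ℂ) ≠ z → ⟪b i, v⟫_ℂ = 0 := by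
        intro i hi
        have h1 : ⟪A (b i), v⟫_ℂ = ⟪b i, A v⟫_ℂ := hA (b i) v
        have hv' : A v = z • v := hv
        rw [h, hv', inner_smul_left, inner_smul_right, Complex.conj_ofReal] at h1
        have h2 : ((μ i : ℂ) - z) * ⟪b i, v⟫_ℂ = 0 := by rw [sub_mul, h1, sub_self]
        exact (mul_eq_zero.1 h2).resolve_left (sub_ne_zero.2 hi)
      have hfd : FiniteDimensional ℂ
          (Submodule.span ℂ (Set.range fun i : {i // (μ i : ℂ) = z} => b i)) :=
        FiniteDimensional.span_of_finite ℂ (Set.finite_range _)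
      refine (Submodule.closed_of_finiteDimensional _).mem_of_tendsto (b.hasSum_repr v)
        (Filter.Eventually.of_forall fun s => Submodule.sum_mem _ fun i _ => ?_)
      rw [b.repr_apply_apply]
      by_cases hi : (μ i : ℂ) = z
      · exact Submodule.smul_mem _ _ (Submodule.subset_span ⟨⟨i, hi⟩, rfl⟩)
      · rw [hzero i hi, zero_smul]; exact Submodule.zero_mem _
  rw [hle]

theorem summable_logFactor {μ : ι → ℝ} (hμ : Summable fun i => μ i ^ 2)
    (hμ1 : ∀ i, |μ i| ≤ 1 / 2) : Summable fun i => logFactor (μ i) :=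
  Summable.of_nonneg_of_le (fun i => logFactor_nonneg (hμ1 i)) (fun i => logFactor_le (hμ1 i))
    (hμ.mul_left 2)

/-- The renormalized determinant in terms of the eigenvalues in an eigenbasis. -/
theorem hasProd_det2 {A : H →L[ℂ] H} (hA : (A : H →ₗ[ℂ] H).IsSymmetric)
    (b : HilbertBasis ι ℂ H) {μ : ι → ℝ} (h : ∀ i, A (b i) = (μ i : ℂ) • b i)
    (hμ : Summable fun i => μ i ^ 2) (hμ1 : ∀ i, |μ i| ≤ 1 / 2) :
    HasProd (fun z : ℂ => ((1 + z) * Complex.exp (-z)) ^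
      Module.finrank ℂ (Module.End.maxGenEigenspace (A : H →ₗ[ℂ] H) z))
      ((Real.exp (-∑' i, logFactor (μ i)) : ℝ) : ℂ) := by
  have h1 : HasProd (fun i => (1 + μ i) * Real.exp (-μ i)) (Real.exp (-∑' i, logFactor (μ i))) := by
    have h2 := (summable_logFactor hμ hμ1).hasSum.neg.rexp
    refine h2.congr_fun fun i => ?_
    have h3 := (abs_le.1 (hμ1 i)).1
    have h4 : -1 < μ i := by linarith
    exact (exp_neg_logFactor h4).symm
  have h3 : HasProd (fun i => (1 + (μ i : ℂ)) * Complex.exp (-(μ i : ℂ)))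
      ((Real.exp (-∑' i, logFactor (μ i)) : ℝ) : ℂ) := by
    have := h1.map Complex.ofRealHom Complex.continuous_ofReal
    refine this.congr_fun fun i => ?_
    simp
  -- The product over basis vectors is grouped by eigenvalue, which turns it into the product over
  -- all complex z required by the determinant.
  have h4 := (Equiv.sigmaFiberEquiv fun i => (μ i : ℂ)).hasProd_iff.2 h3
  refine h4.sigma fun z => ?_
  have h5 : ∀ c : {i // (μ i : ℂ) = z}, ((fun i => (1 + (μ i : ℂ)) * Complex.exp (-(μ i : ℂ))) ∘
      Equiv.sigmaFiberEquiv fun i => (μ i : ℂ)) ⟨z, c⟩ = (1 + z) * Complex.exp (-z) := by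
    intro c
    simp [Equiv.sigmaFiberEquiv, c.2]
  simp_rw [h5]
  -- The eigenvalue 0 may have infinite multiplicity, but its factor is 1, whatever the value of
  -- `finrank`.
  by_cases hz : z = 0
  · subst hz
    simp
  · have := finite_eigenvalue_eq hμ hz
    have := Fintype.ofFinite {i // (μ i : ℂ) = z}
    rw [finrank_maxGenEigenspace hA b h]
    convert hasProd_fintype (fun _ : {i // (μ i : ℂ) = z} => (1 + z) * Complex.exp (-z)) using 1
    rw [Finset.prod_const, Finset.card_univ]

end Det2

/-! ### The Fourier transform on `L²(ℝ)` -/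

section Fourier

open scoped ENNReal InnerProductSpace ComplexConjugate ContDiff
open Filter Topology

/-- The character `exp (2πit)`. -/
def ec (t : ℝ) : ℂ := Complex.exp (((2 * Real.pi * t : ℝ) : ℂ) * Complex.I)

theorem norm_ec (t : ℝ) : ‖ec t‖ = 1 := Complex.norm_exp_ofReal_mul_I _

theorem continuous_ec : Continuous ec := by unfold ec; fun_prop

theorem ec_add (s t : ℝ) : ec (s + t) = ec s * ec t := by
  rw [ec, ec, ec, ← Complex.exp_add]; push_cast; ring_nf

theorem ec_zero : ec 0 = 1 := by simp [ec]

theorem conj_ec (t : ℝ) : conj (ec t) = ec (-t) := by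
  rw [ec, ec, ← Complex.exp_conj, map_mul, Complex.conj_ofReal, Complex.conj_I]; simp

theorem norm_ec_sub_one_le (t : ℝ) : ‖ec t - 1‖ ≤ 2 * Real.pi * |t| := by
  have := Real.norm_exp_I_mul_ofReal_sub_one_le (x := 2 * Real.pi * t)
  rw [mul_comm] at this
  refine this.trans (le_of_eq ?_)
  rw [Real.norm_eq_abs, abs_mul, abs_of_pos (by positivity)]

theorem fourierInv_eq_ec (f : ℝ → ℂ) (w : ℝ) : 𝓕⁻ f w = ∫ v, ec (v * w) * f v := by
  rw [Real.fourierInv_eq']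
  simp [ec, mul_comm, mul_left_comm, mul_assoc]

theorem fourier_eq_ec (f : ℝ → ℂ) (w : ℝ) : 𝓕 f w = ∫ v, ec (-(v * w)) * f v := by
  rw [Real.fourier_eq']
  simp [ec, mul_comm, mul_left_comm, mul_assoc]

theorem integral_fourierInv_mul {f g : ℝ → ℂ} (hf : Integrable f) (hg : Integrable g) :
    ∫ ξ, 𝓕⁻ f ξ * g ξ = ∫ x, f x * 𝓕⁻ g x := by
  have h := VectorFourier.integral_fourierIntegral_smul_eq_flip (L := -innerₗ ℝ) (μ := volume)
    (ν := volume) Real.continuous_fourierChar (by simp only [LinearMap.neg_apply, innerₗ_apply_apply]; fun_prop) hf hg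
  have e : (-innerₗ ℝ : ℝ →ₗ[ℝ] ℝ →ₗ[ℝ] ℝ).flip = -innerₗ ℝ := by
    ext; simp
  rw [e] at h
  exact h

theorem integral_fourier_mul {f g : ℝ → ℂ} (hf : Integrable f) (hg : Integrable g) :
    ∫ ξ, 𝓕 f ξ * g ξ = ∫ x, f x * 𝓕 g x := by
  have h := VectorFourier.integral_fourierIntegral_smul_eq_flip (L := innerₗ ℝ) (μ := volume)
    (ν := volume) Real.continuous_fourierChar (by simp only [innerₗ_apply_apply]; fun_prop) hf hg
  have e : (innerₗ ℝ : ℝ →ₗ[ℝ] ℝ →ₗ[ℝ] ℝ).flip = innerₗ ℝ := by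
    ext; simp
  rw [e] at h
  exact h

theorem continuous_fourierInv {f : ℝ → ℂ} (hf : Integrable f) : Continuous (𝓕⁻ f) :=
  VectorFourier.fourierIntegral_continuous Real.continuous_fourierChar
    (by simp only [LinearMap.neg_apply, innerₗ_apply_apply]; fun_prop) hf

theorem continuous_fourier {f : ℝ → ℂ} (hf : Integrable f) : Continuous (𝓕 f) :=
  VectorFourier.fourierIntegral_continuous Real.continuous_fourierChar
    (by simp only [innerₗ_apply_apply]; fun_prop) hf

/-- A locally integrable function is determined by its integrals against Schwartz functions. -/
theorem ae_eq_of_schwartz {f f' : ℝ → ℂ} (hf : LocallyIntegrable f) (hf' : LocallyIntegrable f')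
    (h : ∀ g : 𝓢(ℝ, ℂ), (∀ x, (g x).im = 0) → ∫ x, g x * f x = ∫ x, g x * f' x) : f =ᵐ[volume] f' := by
  refine ae_eq_of_integral_contDiff_smul_eq hf hf' fun g hg hgs => ?_
  have hg1 : HasCompactSupport (fun x => (g x : ℂ)) := hgs.comp_left Complex.ofReal_zero
  have hg2 : ContDiff ℝ ∞ (fun x => (g x : ℂ)) := Complex.ofRealCLM.contDiff.comp hg
  have := h (hg1.toSchwartzMap hg2) (fun x => by simp)
  simpa using this

theorem locallyIntegrable_L2 (f : L2) : LocallyIntegrable f :=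
  (Lp.memLp f).locallyIntegrable (by norm_num)

/-- On `L¹ ∩ L²` the inverse Fourier transform of `L²` is given by the integral. -/
theorem coeFn_fourierInv_toLp {w : ℝ → ℂ} (h1 : Integrable w) (h2 : MemLp w 2) :
    (𝓕⁻ (h2.toLp w : L2) : L2) =ᵐ[volume] 𝓕⁻ w := by
  refine ae_eq_of_schwartz (locallyIntegrable_L2 _) (continuous_fourierInv h1).locallyIntegrable
    fun g _ => ?_
  have e1 : ∫ x, g x * (𝓕⁻ (h2.toLp w : L2) : L2) x =
      ((𝓕⁻ (h2.toLp w : L2) : L2) : 𝓢'(ℝ, ℂ)) g := by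
    rw [Lp.toTemperedDistribution_apply]; rfl
  rw [e1, ← Lp.fourierInv_toTemperedDistribution_eq, TemperedDistribution.fourierInv_apply,
    Lp.toTemperedDistribution_apply, ← integral_fourierInv_mul g.integrable h1]
  refine integral_congr_ae ?_
  filter_upwards [h2.coeFn_toLp] with x hx
  rw [hx, SchwartzMap.fourierInv_coe]; rfl

theorem coeFn_fourier_toLp {w : ℝ → ℂ} (h1 : Integrable w) (h2 : MemLp w 2) :
    (𝓕 (h2.toLp w : L2) : L2) =ᵐ[volume] 𝓕 w := by
  refine ae_eq_of_schwartz (locallyIntegrable_L2 _) (continuous_fourier h1).locallyIntegrable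
    fun g _ => ?_
  have e1 : ∫ x, g x * (𝓕 (h2.toLp w : L2) : L2) x =
      ((𝓕 (h2.toLp w : L2) : L2) : 𝓢'(ℝ, ℂ)) g := by
    rw [Lp.toTemperedDistribution_apply]; rfl
  rw [e1, ← Lp.fourier_toTemperedDistribution_eq, TemperedDistribution.fourier_apply,
    Lp.toTemperedDistribution_apply, ← integral_fourier_mul g.integrable h1]
  refine integral_congr_ae ?_
  filter_upwards [h2.coeFn_toLp] with x hx
  rw [hx, SchwartzMap.fourier_coe]; rfl

theorem lintegral_enorm_sq (f : L2) : ∫⁻ x, ‖f x‖ₑ ^ 2 = ‖f‖ₑ ^ 2 := by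
  rw [Lp.enorm_def, eLpNorm_eq_lintegral_rpow_enorm_toReal (by norm_num) (by norm_num)]
  simp only [ENNReal.toReal_ofNat, one_div, ENNReal.rpow_ofNat]
  rw [← ENNReal.rpow_natCast, ← ENNReal.rpow_mul]
  norm_num

theorem lintegral_enorm_sq_toLp {w : ℝ → ℂ} (h2 : MemLp w 2) :
    ‖(h2.toLp w : L2)‖ₑ ^ 2 = ∫⁻ x, ‖w x‖ₑ ^ 2 := by
  rw [← lintegral_enorm_sq]
  refine lintegral_congr_ae ?_
  filter_upwards [h2.coeFn_toLp] with x hx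
  rw [hx]

theorem memLp_two_iff {w : ℝ → ℂ} (hw : AEStronglyMeasurable w) :
    MemLp w 2 ↔ ∫⁻ x, ‖w x‖ₑ ^ 2 < ⊤ := by
  rw [MemLp, eLpNorm_lt_top_iff_lintegral_rpow_enorm_lt_top (by norm_num) (by norm_num)]
  simp [hw]

theorem enorm_fourierInv_L2 (f : L2) : ‖(𝓕⁻ f : L2)‖ₑ = ‖f‖ₑ := by
  have := (Lp.fourierTransformₗᵢ ℝ ℂ).symm.norm_map f
  rw [← ofReal_norm, ← ofReal_norm f]
  congr 1

theorem lintegral_fourierInv_sq {w : ℝ → ℂ} (h1 : Integrable w) (h2 : MemLp w 2) :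
    ∫⁻ x, ‖𝓕⁻ w x‖ₑ ^ 2 = ∫⁻ x, ‖w x‖ₑ ^ 2 := by
  rw [← lintegral_enorm_sq_toLp h2, ← enorm_fourierInv_L2, ← lintegral_enorm_sq]
  refine lintegral_congr_ae ?_
  filter_upwards [coeFn_fourierInv_toLp h1 h2] with x hx
  rw [hx]

theorem inner_fourierInv_right (f g : L2) : ⟪f, (𝓕⁻ g : L2)⟫_ℂ = ⟪(𝓕 f : L2), g⟫_ℂ := by
  rw [← Lp.inner_fourier_eq, FourierTransform.fourier_fourierInv_eq]

theorem inner_fourierInv_left (f g : L2) : ⟪(𝓕⁻ f : L2), g⟫_ℂ = ⟪f, (𝓕 g : L2)⟫_ℂ := by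
  rw [← Lp.inner_fourier_eq, FourierTransform.fourier_fourierInv_eq]

theorem inner_L2 (f g : L2) : ⟪f, g⟫_ℂ = ∫ x, conj (f x) * g x := by
  rw [L2.inner_def]
  simp [mul_comm]

theorem inner_toLp_left {w : ℝ → ℂ} (h2 : MemLp w 2) (g : L2) :
    ⟪(h2.toLp w : L2), g⟫_ℂ = ∫ x, conj (w x) * g x := by
  rw [inner_L2]
  refine integral_congr_ae ?_
  filter_upwards [h2.coeFn_toLp] with x hx
  rw [hx]

theorem inner_toLp_toLp {v w : ℝ → ℂ} (hv : MemLp v 2) (hw : MemLp w 2) :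
    ⟪(hv.toLp v : L2), (hw.toLp w : L2)⟫_ℂ = ∫ x, conj (v x) * w x := by
  rw [inner_toLp_left]
  refine integral_congr_ae ?_
  filter_upwards [hw.coeFn_toLp] with x hx
  rw [hx]

theorem integrable_conj_mul {v w : ℝ → ℂ} (hv : MemLp v 2) (hw : MemLp w 2) :
    Integrable fun x => conj (v x) * w x := by
  have : MemLp (fun x => conj (v x)) 2 := hv.star
  exact this.integrable_mul hw

theorem inner_star_star (f g : L2) : ⟪star f, star g⟫_ℂ = conj ⟪f, g⟫_ℂ := by
  rw [inner_L2, inner_L2, ← integral_conj]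
  refine integral_congr_ae ?_
  filter_upwards [Lp.coeFn_star f, Lp.coeFn_star g] with x hf hg
  rw [hf, hg]
  simp

theorem fourier_exp_neg_abs {k : ℝ} (hk : 0 < k) (ξ : ℝ) :
    𝓕 (fun x : ℝ => (Real.exp (-k * |x|) : ℂ)) ξ =
      ((2 * k / (4 * Real.pi ^ 2 * ξ ^ 2 + k ^ 2) : ℝ) : ℂ) := by
  set a : ℂ := -(2 * Real.pi * ξ * Complex.I) - k with ha
  set b : ℂ := -(2 * Real.pi * ξ * Complex.I) + k with hb
  have hare : a.re = -k := by simp [ha]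
  have hbre : b.re = k := by simp [hb]
  have e1 : ∀ x ∈ Set.Ioi (0 : ℝ), ec (-(x * ξ)) * (Real.exp (-k * |x|) : ℂ) = Complex.exp (a * x) := by
    intro x hx
    rw [abs_of_pos hx, ec, Complex.ofReal_exp, ← Complex.exp_add, ha]
    push_cast; ring_nf
  have e2 : ∀ x ∈ Set.Iic (0 : ℝ), ec (-(x * ξ)) * (Real.exp (-k * |x|) : ℂ) = Complex.exp (b * x) := by
    intro x hx
    rw [abs_of_nonpos hx, ec, Complex.ofReal_exp, ← Complex.exp_add, hb]
    push_cast; ring_nf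
  rw [fourier_eq_ec, ← intervalIntegral.integral_Iic_add_Ioi (b := 0),
    setIntegral_congr_fun measurableSet_Ioi e1, setIntegral_congr_fun measurableSet_Iic e2,
    integral_exp_mul_complex_Ioi (by rw [hare]; linarith),
    integral_exp_mul_complex_Iic (by rw [hbre]; linarith)]
  · have ha0 : a ≠ 0 := fun h => by rw [h] at hare; simp at hare; linarith
    have hb0 : b ≠ 0 := fun h => by rw [h] at hbre; simp at hbre; linarith
    have hab : ((4 * Real.pi ^ 2 * ξ ^ 2 + k ^ 2 : ℝ) : ℂ) = -(a * b) := by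
      rw [ha, hb]; push_cast
      linear_combination (4 * Real.pi ^ 2 * (ξ : ℂ) ^ 2) * Complex.I_sq
    rw [Complex.ofReal_div, hab]
    simp only [Complex.ofReal_zero, mul_zero, Complex.exp_zero]
    have h2k : ((2 * k : ℝ) : ℂ) = b - a := by rw [ha, hb]; push_cast; ring
    rw [h2k]
    field_simp
    ring
  · exact (integrableOn_exp_mul_complex_Iic (by rw [hbre]; linarith) 0).congr_fun
      (fun x hx => (e2 x hx).symm) measurableSet_Iic
  · exact (integrableOn_exp_mul_complex_Ioi (by rw [hare]; linarith) 0).congr_fun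
      (fun x hx => (e1 x hx).symm) measurableSet_Ioi

theorem integrable_exp_neg_abs {k : ℝ} (hk : 0 < k) :
    Integrable (fun x : ℝ => Real.exp (-k * |x|)) := by
  have h1 : IntegrableOn (fun x : ℝ => Real.exp (-k * |x|)) (Set.Iic 0) :=
    (integrableOn_exp_mul_Iic hk 0).congr_fun
      (fun x hx => by rw [abs_of_nonpos hx]; ring_nf) measurableSet_Iic
  have h2 : IntegrableOn (fun x : ℝ => Real.exp (-k * |x|)) (Set.Ioi 0) :=
    (integrableOn_exp_mul_Ioi (neg_lt_zero.2 hk) 0).congr_fun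
      (fun x hx => by rw [abs_of_pos hx]) measurableSet_Ioi
  have := h1.union h2
  rwa [Set.Iic_union_Ioi, integrableOn_univ] at this

theorem integrable_inv_sq_add {k : ℝ} (hk : 0 < k) :
    Integrable fun ξ : ℝ => (4 * Real.pi ^ 2 * ξ ^ 2 + k ^ 2)⁻¹ := by
  have h := (integrable_inv_one_add_sq.comp_mul_left' (R := 2 * Real.pi / k)
    (by positivity)).const_mul (k ^ 2)⁻¹
  refine h.congr (Eventually.of_forall fun ξ => ?_)
  simp only
  rw [← mul_inv]
  congr 1
  field_simp
  ring

theorem fourierInv_inv_sq_add {k : ℝ} (hk : 0 < k) (x : ℝ) :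
    𝓕⁻ (fun ξ : ℝ => (((4 * Real.pi ^ 2 * ξ ^ 2 + k ^ 2)⁻¹ : ℝ) : ℂ)) x =
      ((Real.exp (-k * |x|) / (2 * k) : ℝ) : ℂ) := by
  have hF : 𝓕 (fun x : ℝ => (Real.exp (-k * |x|) : ℂ)) =
      fun ξ => (2 * k : ℂ) * (((4 * Real.pi ^ 2 * ξ ^ 2 + k ^ 2)⁻¹ : ℝ) : ℂ) := by
    ext ξ; rw [fourier_exp_neg_abs hk]; push_cast; ring
  have hc : Continuous fun x : ℝ => (Real.exp (-k * |x|) : ℂ) := by fun_prop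
  have h := hc.fourierInv_fourier_eq (integrable_exp_neg_abs hk).ofReal
    (by rw [hF]; exact (integrable_inv_sq_add hk).ofReal.const_mul _)
  rw [hF] at h
  have h2 := congrFun h x
  rw [fourierInv_eq_ec] at h2
  rw [fourierInv_eq_ec]
  have h3 : ∀ v : ℝ, ec (v * x) * ((2 * k : ℂ) * (((4 * Real.pi ^ 2 * v ^ 2 + k ^ 2)⁻¹ : ℝ) : ℂ)) =
    (2 * k : ℂ) * (ec (v * x) * (((4 * Real.pi ^ 2 * v ^ 2 + k ^ 2)⁻¹ : ℝ) : ℂ)) := fun v => by ring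
  simp_rw [h3] at h2
  rw [integral_const_mul] at h2
  have hk' : (2 * k : ℂ) ≠ 0 := by exact_mod_cast (by positivity : (2 * k : ℝ) ≠ 0)
  rw [Complex.ofReal_div, ← h2]
  push_cast
  rw [mul_div_cancel_left₀ _ hk']

end Fourier

/-! ### The square root of the free resolvent and its kernel -/

section FreeResolvent

open scoped ENNReal InnerProductSpace ComplexConjugate ContDiff
open Filter Topology

/-- The symbol of `√R₀`. -/
def msym (κ ξ : ℝ) : ℝ := (4 * Real.pi ^ 2 * ξ ^ 2 + κ ^ 2) ^ (-(1 : ℝ) / 2)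

variable {κ : ℝ}

theorem sym_pos (hκ : 1 ≤ κ) (ξ : ℝ) : 0 < 4 * Real.pi ^ 2 * ξ ^ 2 + κ ^ 2 := by
  have : 0 < κ := by linarith
  positivity

theorem msym_pos (hκ : 1 ≤ κ) (ξ : ℝ) : 0 < msym κ ξ := Real.rpow_pos_of_pos (sym_pos hκ ξ) _

theorem msym_sq (hκ : 1 ≤ κ) (ξ : ℝ) : msym κ ξ ^ 2 = (4 * Real.pi ^ 2 * ξ ^ 2 + κ ^ 2)⁻¹ := by
  rw [msym, ← Real.rpow_natCast, ← Real.rpow_mul (sym_pos hκ ξ).le, ← Real.rpow_neg_one]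
  norm_num

theorem msym_le_one (hκ : 1 ≤ κ) (ξ : ℝ) : msym κ ξ ≤ 1 := by
  have h : msym κ ξ ^ 2 ≤ 1 := by
    rw [msym_sq hκ]
    apply inv_le_one_of_one_le₀
    nlinarith [sq_nonneg (Real.pi * ξ)]
  nlinarith [msym_pos hκ ξ]

theorem msym_neg (κ ξ : ℝ) : msym κ (-ξ) = msym κ ξ := by simp [msym]

theorem continuous_msym (hκ : 1 ≤ κ) : Continuous (msym κ) := by
  unfold msym
  exact Continuous.rpow_const (by fun_prop) fun ξ => Or.inl (sym_pos hκ ξ).ne'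

theorem abs_mul_msym_le (hκ : 1 ≤ κ) (ξ : ℝ) : 2 * Real.pi * |ξ| * msym κ ξ ≤ 1 := by
  have h : (2 * Real.pi * |ξ| * msym κ ξ) ^ 2 ≤ 1 := by
    rw [mul_pow, msym_sq hκ, ← div_eq_mul_inv, div_le_one (sym_pos hκ ξ), mul_pow, sq_abs]
    nlinarith [sq_nonneg κ]
  have h0 : 0 ≤ 2 * Real.pi * |ξ| * msym κ ξ := by
    have := msym_pos hκ ξ; positivity
  nlinarith

/-- The Fourier transform of `√R₀ φ`. -/
def wsym (κ : ℝ) (φ : L2) (ξ : ℝ) : ℂ := (msym κ ξ : ℂ) * (𝓕 φ : L2) ξ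

theorem memLp_msym_mul (hκ : 1 ≤ κ) {f : ℝ → ℂ} (hf : MemLp f 2) :
    MemLp (fun ξ => (msym κ ξ : ℂ) * f ξ) 2 := by
  refine hf.of_le ?_ (Eventually.of_forall fun ξ => ?_)
  · exact (Complex.continuous_ofReal.comp (continuous_msym hκ)).aestronglyMeasurable.mul hf.1
  · rw [norm_mul, Complex.norm_real, Real.norm_of_nonneg (msym_pos hκ ξ).le]
    exact mul_le_of_le_one_left (norm_nonneg _) (msym_le_one hκ ξ)

theorem memLp_wsym (hκ : 1 ≤ κ) (φ : L2) : MemLp (wsym κ φ) 2 :=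
  memLp_msym_mul hκ (Lp.memLp _)

theorem memLp_msym (hκ : 1 ≤ κ) : MemLp (fun ξ => (msym κ ξ : ℂ)) 2 := by
  have hm : AEStronglyMeasurable fun ξ => (msym κ ξ : ℂ) :=
    (Complex.continuous_ofReal.comp (continuous_msym hκ)).aestronglyMeasurable
  rw [memLp_two_iff_integrable_sq_norm hm]
  refine (integrable_inv_sq_add (show 0 < κ by linarith)).congr (Eventually.of_forall fun ξ => ?_)
  simp only
  rw [Complex.norm_real, Real.norm_eq_abs, sq_abs, msym_sq hκ]

theorem integrable_wsym (hκ : 1 ≤ κ) (φ : L2) : Integrable (wsym κ φ) :=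
  (memLp_msym hκ).integrable_mul (Lp.memLp _)

theorem sqrtR0_eq (hκ : 1 ≤ κ) (φ : L2) : sqrtR0 κ φ = 𝓕⁻ ((memLp_wsym hκ φ).toLp : L2) :=
  dif_pos (memLp_wsym hκ φ)

theorem sqrtR0_ae (hκ : 1 ≤ κ) (φ : L2) : sqrtR0 κ φ =ᵐ[volume] 𝓕⁻ (wsym κ φ) := by
  rw [sqrtR0_eq hκ]
  exact coeFn_fourierInv_toLp (integrable_wsym hκ φ) (memLp_wsym hκ φ)

theorem memLp_kerSym (hκ : 1 ≤ κ) (x : ℝ) :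
    MemLp (fun ξ => (msym κ ξ : ℂ) * ec (-(x * ξ))) 2 := by
  have hc := continuous_ec
  refine (memLp_msym hκ).of_le ?_ (Eventually.of_forall fun ξ => ?_)
  · exact (memLp_msym hκ).1.mul (by fun_prop)
  · rw [norm_mul, norm_ec, mul_one]

/-- The kernel vectors: `√R₀ φ (x) = ⟨E x, φ⟩`. -/
def kerE (κ : ℝ) (hκ : 1 ≤ κ) (x : ℝ) : L2 := 𝓕⁻ ((memLp_kerSym hκ x).toLp : L2)

theorem inner_kerE (hκ : 1 ≤ κ) (x : ℝ) (φ : L2) : ⟪kerE κ hκ x, φ⟫_ℂ = 𝓕⁻ (wsym κ φ) x := by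
  rw [kerE, inner_fourierInv_left, inner_toLp_left, fourierInv_eq_ec]
  refine integral_congr_ae (Eventually.of_forall fun ξ => ?_)
  simp only [wsym]
  rw [map_mul, conj_ec, Complex.conj_ofReal, neg_neg, mul_comm x ξ]
  ring

theorem sqrtR0_ae_inner (hκ : 1 ≤ κ) (φ : L2) :
    sqrtR0 κ φ =ᵐ[volume] fun x => ⟪kerE κ hκ x, φ⟫_ℂ := by
  refine (sqrtR0_ae hκ φ).trans (Eventually.of_forall fun x => ?_)
  exact (inner_kerE hκ x φ).symm

/-- The product of the two symbols is that of R₀ times a character, so the Gram matrix of the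
vectors E_x is the free Green's function. -/
theorem inner_kerE_kerE (hκ : 1 ≤ κ) (x y : ℝ) :
    ⟪kerE κ hκ x, kerE κ hκ y⟫_ℂ = ((Real.exp (-κ * |x - y|) / (2 * κ) : ℝ) : ℂ) := by
  rw [← fourierInv_inv_sq_add (show 0 < κ by linarith), fourierInv_eq_ec, kerE, kerE,
    inner_fourierInv_left, FourierTransform.fourier_fourierInv_eq, inner_toLp_toLp]
  refine integral_congr_ae (Eventually.of_forall fun ξ => ?_)
  simp only
  rw [map_mul, conj_ec, Complex.conj_ofReal, neg_neg, ← msym_sq hκ,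
    show ξ * (x - y) = x * ξ + -(y * ξ) by ring, ec_add]
  push_cast
  ring

theorem norm_kerE_sq (hκ : 1 ≤ κ) (x : ℝ) : ‖kerE κ hκ x‖ ^ 2 = 1 / (2 * κ) := by
  have h := inner_kerE_kerE hκ x x
  rw [inner_self_eq_norm_sq_to_K] at h
  have h2 : ((‖kerE κ hκ x‖ ^ 2 : ℝ) : ℂ) = ((Real.exp (-κ * |x - x|) / (2 * κ) : ℝ) : ℂ) := by
    rw [← h]; push_cast; rfl
  have h3 := Complex.ofReal_injective h2
  rw [h3]; simp

theorem norm_kerE_le_one (hκ : 1 ≤ κ) (x : ℝ) : ‖kerE κ hκ x‖ ≤ 1 := by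
  have h := norm_kerE_sq hκ x
  have : 1 / (2 * κ) ≤ 1 := by rw [div_le_one (by linarith)]; linarith
  nlinarith [norm_nonneg (kerE κ hκ x)]

theorem norm_kerE_sub_sq (hκ : 1 ≤ κ) (x y : ℝ) :
    ‖kerE κ hκ x - kerE κ hκ y‖ ^ 2 = (1 - Real.exp (-κ * |x - y|)) / κ := by
  have h0 : 0 < κ := by linarith
  rw [@norm_sub_sq ℂ, inner_kerE_kerE, norm_kerE_sq, norm_kerE_sq]
  simp only [RCLike.re_eq_complex_re, Complex.ofReal_re]
  field_simp
  ring

theorem continuous_kerE (hκ : 1 ≤ κ) : Continuous (kerE κ hκ) := by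
  rw [continuous_iff_continuousAt]
  intro x
  rw [ContinuousAt, tendsto_iff_norm_sub_tendsto_zero]
  have h : ∀ y, ‖kerE κ hκ y - kerE κ hκ x‖ = Real.sqrt ((1 - Real.exp (-κ * |y - x|)) / κ) := by
    intro y
    rw [← norm_kerE_sub_sq hκ, Real.sqrt_sq (norm_nonneg _)]
  simp_rw [h]
  have hc : Continuous fun y => Real.sqrt ((1 - Real.exp (-κ * |y - x|)) / κ) := by fun_prop
  have := hc.tendsto x
  simpa using this

/-- By Plancherel the left side is ‖√R₀φ‖², and the symbol of √R₀ is at most 1. -/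
theorem lintegral_inner_kerE (hκ : 1 ≤ κ) (φ : L2) :
    ∫⁻ x, ‖⟪kerE κ hκ x, φ⟫_ℂ‖ₑ ^ 2 ≤ ‖φ‖ₑ ^ 2 := by
  simp_rw [inner_kerE]
  rw [lintegral_fourierInv_sq (integrable_wsym hκ φ) (memLp_wsym hκ φ),
    ← enorm_fourierInv_L2, ← FourierTransform.fourierInv_fourier_eq (F := L2) φ,
    enorm_fourierInv_L2, enorm_fourierInv_L2, ← lintegral_enorm_sq,
    FourierTransform.fourierInv_fourier_eq]
  refine lintegral_mono fun ξ => ?_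
  gcongr
  rw [← ofReal_norm, ← ofReal_norm]
  apply ENNReal.ofReal_le_ofReal
  rw [wsym, norm_mul, Complex.norm_real, Real.norm_of_nonneg (msym_pos hκ ξ).le]
  exact mul_le_of_le_one_left (norm_nonneg _) (msym_le_one hκ ξ)

/-- √R₀ gains one derivative: translation by t multiplies the transform by a character, |e^{2πiξt} −
1| ≤ 2π|ξt|, and 2π|ξ| times the symbol of √R₀ is at most 1. -/
theorem lintegral_inner_kerE_sub (hκ : 1 ≤ κ) (t : ℝ) (φ : L2) :
    ∫⁻ x, ‖⟪kerE κ hκ (x + t) - kerE κ hκ x, φ⟫_ℂ‖ₑ ^ 2 ≤ ‖t‖ₑ ^ 2 * ‖φ‖ₑ ^ 2 := by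
  have hc := continuous_ec
  let W : ℝ → ℂ := fun ξ => (ec (ξ * t) - 1) * wsym κ φ ξ
  have hWm : AEStronglyMeasurable W :=
    (Continuous.aestronglyMeasurable (by fun_prop)).mul (memLp_wsym hκ φ).1
  have hb : ∀ ξ : ℝ, ‖ec (ξ * t) - 1‖ ≤ 2 := fun ξ =>
    (norm_sub_le _ _).trans (by rw [norm_ec, norm_one]; norm_num)
  have h1 : Integrable W :=
    (integrable_wsym hκ φ).bdd_mul (Continuous.aestronglyMeasurable (by fun_prop))
      (Eventually.of_forall hb)
  have h2 : MemLp W 2 := by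
    refine (memLp_wsym hκ φ).of_le_mul (c := 2) hWm (Eventually.of_forall fun ξ => ?_)
    rw [norm_mul]
    gcongr
    exact hb ξ
  have e : ∀ x, ⟪kerE κ hκ (x + t) - kerE κ hκ x, φ⟫_ℂ = 𝓕⁻ W x := by
    intro x
    rw [inner_sub_left, inner_kerE, inner_kerE, fourierInv_eq_ec, fourierInv_eq_ec,
      fourierInv_eq_ec, ← integral_sub]
    · refine integral_congr_ae (Eventually.of_forall fun ξ => ?_)
      simp only [W]
      rw [mul_add, ec_add]; ring
    all_goals
      exact (integrable_wsym hκ φ).bdd_mul (c := 1)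
        (Continuous.aestronglyMeasurable (by fun_prop))
        (Eventually.of_forall fun ξ => (norm_ec _).le)
  simp_rw [e]
  rw [lintegral_fourierInv_sq h1 h2]
  have e2 : ‖φ‖ₑ ^ 2 = ∫⁻ ξ, ‖(𝓕 φ : L2) ξ‖ₑ ^ 2 := by
    rw [lintegral_enorm_sq, ← enorm_fourierInv_L2 (𝓕 φ), FourierTransform.fourierInv_fourier_eq]
  rw [e2, ← lintegral_const_mul' _ _ (by simp)]
  refine lintegral_mono fun ξ => ?_
  rw [← mul_pow]
  gcongr
  rw [← ofReal_norm, ← ofReal_norm, ← ofReal_norm, ← ENNReal.ofReal_mul (norm_nonneg _)]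
  apply ENNReal.ofReal_le_ofReal
  simp only [W, wsym, norm_mul]
  rw [Complex.norm_real, Real.norm_of_nonneg (msym_pos hκ ξ).le, Real.norm_eq_abs, ← mul_assoc]
  gcongr
  calc ‖ec (ξ * t) - 1‖ * msym κ ξ ≤ (2 * Real.pi * |ξ * t|) * msym κ ξ := by
        gcongr
        · exact (msym_pos hκ ξ).le
        · exact norm_ec_sub_one_le _
    _ = |t| * (2 * Real.pi * |ξ| * msym κ ξ) := by rw [abs_mul]; ring
    _ ≤ |t| * 1 := by gcongr; exact abs_mul_msym_le hκ ξ
    _ = |t| := mul_one _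

theorem tendsto_inner_kerE (hκ : 1 ≤ κ) (φ : L2) :
    Tendsto (fun x => ⟪kerE κ hκ x, φ⟫_ℂ) (cocompact ℝ) (𝓝 0) := by
  simp_rw [inner_kerE, Real.fourierInv_eq_fourier_neg]
  refine (Real.zero_at_infty_fourier (wsym κ φ)).comp ?_
  exact (Homeomorph.neg ℝ).isClosedEmbedding.tendsto_cocompact

theorem sqrtR0_eq_zero (hκ : 1 ≤ κ) {φ : L2} (h : sqrtR0 κ φ = 0) : φ = 0 := by
  rw [sqrtR0_eq hκ] at h
  have h1 : ((memLp_wsym hκ φ).toLp : L2) = 0 := by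
    have := congrArg (fun f : L2 => (𝓕 f : L2)) h
    simpa only [FourierTransform.fourier_fourierInv_eq, FourierTransform.fourier_zero] using this
  have h2 : (𝓕 φ : L2) = 0 := by
    rw [Lp.eq_zero_iff_ae_eq_zero]
    have h3 := (memLp_wsym hκ φ).coeFn_toLp
    rw [h1] at h3
    filter_upwards [h3, Lp.coeFn_zero ℂ 2 (volume : Measure ℝ)] with ξ hξ h0
    rw [h0] at hξ
    have hm : (msym κ ξ : ℂ) ≠ 0 := by exact_mod_cast (msym_pos hκ ξ).ne'
    exact (mul_eq_zero.1 hξ.symm).resolve_left hm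
  rw [← FourierTransform.fourierInv_fourier_eq (F := L2) φ, h2]
  exact FourierTransform.fourierInv_zero

theorem eq_zero_of_inner_kerE (hκ : 1 ≤ κ) {φ : L2} (h : ∀ x, ⟪kerE κ hκ x, φ⟫_ℂ = 0) : φ = 0 := by
  apply sqrtR0_eq_zero hκ
  rw [Lp.eq_zero_iff_ae_eq_zero]
  filter_upwards [sqrtR0_ae_inner hκ φ] with x hx
  rw [hx, h]; rfl

theorem inner_sqrtR0 (hκ : 1 ≤ κ) (φ f : L2) : ⟪φ, sqrtR0 κ f⟫_ℂ = ⟪sqrtR0 κ φ, f⟫_ℂ := by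
  rw [sqrtR0_eq hκ, sqrtR0_eq hκ, inner_fourierInv_right, inner_fourierInv_left, inner_toLp_left,
    ← inner_conj_symm, inner_toLp_left, ← integral_conj]
  refine integral_congr_ae (Eventually.of_forall fun ξ => ?_)
  simp only [wsym, map_mul, Complex.conj_conj, Complex.conj_ofReal]
  ring

theorem star_L2_continuous : Continuous fun f : L2 => (star f : L2) := by
  have h : ∀ f g : L2, dist (star f) (star g) = dist f g := by
    intro f g
    have e : star f - star g = star (f - g) := by
      apply Lp.ext
      filter_upwards [Lp.coeFn_star f, Lp.coeFn_star g, Lp.coeFn_sub (star f) (star g),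
        Lp.coeFn_sub f g, Lp.coeFn_star (f - g)] with x h1 h2 h3 h4 h5
      rw [h3, h5, Pi.sub_apply, h1, h2, Pi.star_apply, Pi.star_apply, Pi.star_apply, h4,
        Pi.sub_apply, star_sub]
    rw [dist_eq_norm, e, dist_eq_norm]
    have h2 : ‖star (f - g)‖ ^ 2 = ‖f - g‖ ^ 2 := by
      have h3 := inner_star_star (f - g) (f - g)
      rw [inner_self_eq_norm_sq_to_K, inner_self_eq_norm_sq_to_K] at h3
      have h4 : ((‖star (f - g)‖ ^ 2 : ℝ) : ℂ) = ((‖f - g‖ ^ 2 : ℝ) : ℂ) := by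
        push_cast
        refine h3.trans ?_
        simp
      exact_mod_cast h4
    exact (sq_eq_sq₀ (norm_nonneg _) (norm_nonneg _)).1 h2
  exact (Isometry.of_dist_eq h).continuous

/-- √R₀ commutes with complex conjugation because its symbol is real and even. This is checked on
Schwartz functions and extended by density; it is what makes the Green's function real. -/
theorem inner_kerE_star (hκ : 1 ≤ κ) (x : ℝ) (φ : L2) :
    ⟪kerE κ hκ x, star φ⟫_ℂ = conj ⟪kerE κ hκ x, φ⟫_ℂ := by
  refine DenseRange.induction_on (p := fun φ : L2 => ⟪kerE κ hκ x, star φ⟫_ℂ =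
    conj ⟪kerE κ hκ x, φ⟫_ℂ) (SchwartzMap.denseRange_toLpCLM (p := 2) ENNReal.ofNat_ne_top)
    φ ?_ ?_
  · have := star_L2_continuous
    exact isClosed_eq (continuous_const.inner this)
      (Complex.continuous_conj.comp (continuous_const.inner continuous_id))
  intro f
  have hi : Integrable fun y => conj (f y) := by
    have := (Complex.conjCLE : ℂ →L[ℝ] ℂ).integrable_comp (f.integrable (μ := volume))
    exact this
  have h1 : MemLp f 2 (volume : Measure ℝ) := f.memLp 2 volume
  have h2 : MemLp (fun y => conj (f y)) 2 (volume : Measure ℝ) := h1.star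
  have e1 : star (f.toLp 2 volume : L2) = h2.toLp := by
    apply Lp.ext
    filter_upwards [Lp.coeFn_star (f.toLp 2 volume : L2), f.coeFn_toLp 2 volume, h2.coeFn_toLp] with y a b c
    rw [a, c, Pi.star_apply, b]; rfl
  have e2 : ∀ ξ, 𝓕 (fun y => conj (f y)) ξ = conj (𝓕 f (-ξ)) := by
    intro ξ
    rw [fourier_eq_ec, SchwartzMap.fourier_coe, fourier_eq_ec, ← integral_conj]
    refine integral_congr_ae (Eventually.of_forall fun y => ?_)
    simp only [map_mul, conj_ec]
    ring_nf
  rw [SchwartzMap.toLpCLM_apply, e1, inner_kerE, inner_kerE, fourierInv_eq_ec, fourierInv_eq_ec,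
    ← integral_conj]
  have e3 : ∀ᵐ ξ, ec (ξ * x) * wsym κ (h2.toLp : L2) ξ =
      ec (ξ * x) * ((msym κ ξ : ℂ) * conj (𝓕 f (-ξ))) := by
    filter_upwards [coeFn_fourier_toLp hi h2] with ξ hξ
    rw [wsym, hξ, e2]
  have e4 : ∀ᵐ ξ, conj (ec (ξ * x) * wsym κ (f.toLp 2 volume : L2) ξ) =
      conj (ec (ξ * x) * ((msym κ ξ : ℂ) * 𝓕 f ξ)) := by
    have := SchwartzMap.toLp_fourier_eq f
    filter_upwards [(𝓕 f).coeFn_toLp 2 volume] with ξ hξ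
    rw [wsym, this, hξ]
  rw [integral_congr_ae e3, integral_congr_ae e4,
    ← integral_neg_eq_self]
  refine integral_congr_ae (Eventually.of_forall fun ξ => ?_)
  simp only [map_mul, conj_ec, Complex.conj_ofReal, neg_neg, msym_neg]
  ring_nf

theorem sqrtR0_star (hκ : 1 ≤ κ) (φ : L2) : sqrtR0 κ (star φ) = star (sqrtR0 κ φ) := by
  apply Lp.ext
  filter_upwards [sqrtR0_ae_inner hκ φ, sqrtR0_ae_inner hκ (star φ), Lp.coeFn_star (sqrtR0 κ φ)]
    with x h1 h2 h3
  rw [h2, h3, Pi.star_apply, h1, inner_kerE_star]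
  rfl

theorem star_kerE (hκ : 1 ≤ κ) (x : ℝ) : star (kerE κ hκ x) = kerE κ hκ x := by
  refine ext_inner_right ℂ fun φ => ?_
  have h := inner_star_star (kerE κ hκ x) (star φ)
  rw [star_star, inner_kerE_star, Complex.conj_conj] at h
  exact h

theorem sqrtR0_kerE_ae (hκ : 1 ≤ κ) (x : ℝ) :
    sqrtR0 κ (kerE κ hκ x) =ᵐ[volume] fun y => ((Real.exp (-κ * |x - y|) / (2 * κ) : ℝ) : ℂ) := by
  refine (sqrtR0_ae_inner hκ _).trans (Eventually.of_forall fun y => ?_)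
  simp only
  rw [inner_kerE_kerE, abs_sub_comm]

end FreeResolvent

/-! ### The Sobolev space `H¹(ℝ)` -/

section Sobolev

open scoped ENNReal InnerProductSpace ComplexConjugate ContDiff
open Filter Topology

theorem enorm_fourier_L2 (f : L2) : ‖(𝓕 f : L2)‖ₑ = ‖f‖ₑ := by
  rw [← enorm_fourierInv_L2, FourierTransform.fourierInv_fourier_eq]

theorem hasWeakDeriv_iff (u v : L2) : HasWeakDeriv u v ↔
    ∀ᵐ ξ, (𝓕 v : L2) ξ = (2 * Real.pi * ξ * Complex.I : ℂ) * (𝓕 u : L2) ξ := by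
  have hg : (fun x : ℝ => inner ℝ x (1 : ℝ)).HasTemperateGrowth := by fun_prop
  have hg' : (fun x : ℝ => ((inner ℝ x (1 : ℝ) : ℝ) : ℂ)).HasTemperateGrowth := by fun_prop
  have h1 : HasWeakDeriv u v ↔ 𝓕 (∂_{(1 : ℝ)} (u : 𝓢'(ℝ, ℂ))) = 𝓕 (v : 𝓢'(ℝ, ℂ)) := by
    unfold HasWeakDeriv
    constructor
    · intro h; rw [h]
    · intro h
      rw [← FourierTransform.fourierInv_fourier_eq (F := 𝓢'(ℝ, ℂ)) (∂_{(1 : ℝ)} (u : 𝓢'(ℝ, ℂ))), h,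
        FourierTransform.fourierInv_fourier_eq]
  rw [h1, TemperedDistribution.fourier_lineDerivOp_eq, Lp.fourier_toTemperedDistribution_eq,
    Lp.fourier_toTemperedDistribution_eq]
  have key : ∀ g : 𝓢(ℝ, ℂ), ((2 * Real.pi * Complex.I : ℂ) • TemperedDistribution.smulLeftCLM ℂ
      (fun x : ℝ => ((inner ℝ x (1 : ℝ) : ℝ) : ℂ)) ((𝓕 u : L2) : 𝓢'(ℝ, ℂ))) g =
      ∫ ξ, g ξ * ((2 * Real.pi * ξ * Complex.I : ℂ) * (𝓕 u : L2) ξ) := by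
    intro g
    rw [smul_apply, TemperedDistribution.smulLeftCLM_apply_apply,
      Lp.toTemperedDistribution_apply, smul_eq_mul, ← integral_const_mul]
    refine integral_congr_ae (Eventually.of_forall fun ξ => ?_)
    simp only
    rw [SchwartzMap.smulLeftCLM_apply_apply hg']
    simp only [smul_eq_mul, RCLike.inner_apply, conj_trivial, one_mul]
    ring
  have hloc : LocallyIntegrable fun ξ : ℝ => (2 * Real.pi * ξ * Complex.I : ℂ) * (𝓕 u : L2) ξ := by
    have := (locallyIntegrable_L2 (𝓕 u)).continuous_smul
      (g := fun ξ : ℝ => (2 * Real.pi * ξ * Complex.I : ℂ)) (by fun_prop)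
    simpa using this
  constructor
  · intro h
    refine ae_eq_of_schwartz (locallyIntegrable_L2 _) hloc fun g _ => ?_
    rw [← key g]
    have h2 := DFunLike.congr_fun h g
    rw [Lp.toTemperedDistribution_apply] at h2
    exact h2.symm
  · intro h
    ext g
    rw [Lp.toTemperedDistribution_apply]
    refine (key g).trans (integral_congr_ae ?_)
    filter_upwards [h] with ξ hξ
    rw [hξ, smul_eq_mul]

variable {κ : ℝ}

theorem memLp_deriv_wsym (hκ : 1 ≤ κ) (φ : L2) :
    MemLp (fun ξ : ℝ => (2 * Real.pi * ξ * Complex.I : ℂ) * wsym κ φ ξ) 2 := by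
  refine (Lp.memLp (𝓕 φ : L2)).of_le ?_ (Eventually.of_forall fun ξ => ?_)
  · exact (Continuous.aestronglyMeasurable (by fun_prop)).mul (memLp_wsym hκ φ).1
  · rw [wsym, ← mul_assoc, norm_mul]
    refine mul_le_of_le_one_left (norm_nonneg _) ?_
    simp only [norm_mul, Complex.norm_real, Complex.norm_I, mul_one, RCLike.norm_ofNat]
    rw [Real.norm_of_nonneg Real.pi_pos.le, Real.norm_of_nonneg (msym_pos hκ ξ).le,
      Real.norm_eq_abs]
    exact abs_mul_msym_le hκ ξ

/-- The weak derivative of `√R₀ φ`. -/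
def derivSqrtR0 (κ : ℝ) (hκ : 1 ≤ κ) (φ : L2) : L2 := 𝓕⁻ ((memLp_deriv_wsym hκ φ).toLp : L2)

theorem fourier_sqrtR0_ae (hκ : 1 ≤ κ) (φ : L2) : (𝓕 (sqrtR0 κ φ) : L2) =ᵐ[volume] wsym κ φ := by
  rw [sqrtR0_eq hκ, FourierTransform.fourier_fourierInv_eq]
  exact (memLp_wsym hκ φ).coeFn_toLp

theorem hasWeakDeriv_sqrtR0 (hκ : 1 ≤ κ) (φ : L2) :
    HasWeakDeriv (sqrtR0 κ φ) (derivSqrtR0 κ hκ φ) := by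
  rw [hasWeakDeriv_iff, derivSqrtR0, FourierTransform.fourier_fourierInv_eq]
  filter_upwards [(memLp_deriv_wsym hκ φ).coeFn_toLp, fourier_sqrtR0_ae hκ φ] with ξ h1 h2
  rw [h1, h2]

theorem HasWeakDeriv.unique {u v v' : L2} (h : HasWeakDeriv u v) (h' : HasWeakDeriv u v') :
    v = v' := HMinusOne.toTemperedDistribution_injective (h.symm.trans h')

/-- Together with `hasWeakDeriv_sqrtR0` this identifies H¹ with the range of √R₀. The preimage is
obtained by dividing by the symbol, since √(4π²ξ²+κ²) ≤ 2π|ξ| + κ is controlled by the norms of u'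
and u. -/
theorem exists_sqrtR0_eq (hκ : 1 ≤ κ) {u u' : L2} (h : HasWeakDeriv u u') :
    ∃ φ : L2, sqrtR0 κ φ = u := by
  rw [hasWeakDeriv_iff] at h
  have hm : MemLp (fun ξ => ((msym κ ξ)⁻¹ : ℂ) * (𝓕 u : L2) ξ) 2 := by
    have hc : Continuous fun ξ => ((msym κ ξ)⁻¹ : ℂ) := by
      have := continuous_msym hκ
      refine Continuous.inv₀ (by fun_prop) fun ξ => ?_
      exact_mod_cast (msym_pos hκ ξ).ne'
    refine (((Lp.memLp (𝓕 u' : L2)).norm.add ((Lp.memLp (𝓕 u : L2)).norm.const_mul κ))).of_le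
      (hc.aestronglyMeasurable.mul (Lp.memLp (𝓕 u : L2)).1) ?_
    filter_upwards [h] with ξ hξ
    simp only [Pi.add_apply]
    rw [hξ, norm_mul, norm_mul, norm_inv, Complex.norm_real, Real.norm_of_nonneg (msym_pos hκ ξ).le,
      ← add_mul]
    have e : ‖(2 * Real.pi * ξ * Complex.I : ℂ)‖ = 2 * Real.pi * |ξ| := by
      simp only [norm_mul, Complex.norm_real, Complex.norm_I, mul_one, RCLike.norm_ofNat]
      rw [Real.norm_of_nonneg Real.pi_pos.le, Real.norm_eq_abs]
    have hκ0 : 0 < κ := by linarith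
    have hp := Real.pi_pos
    rw [e, Real.norm_of_nonneg (by positivity)]
    gcongr
    rw [inv_le_comm₀ (msym_pos hκ ξ) (by positivity)]
    have h3 : ((2 * Real.pi * |ξ| + κ)⁻¹) ^ 2 ≤ msym κ ξ ^ 2 := by
      rw [msym_sq hκ, inv_pow]
      apply inv_anti₀ (sym_pos hκ ξ)
      have : 0 ≤ 2 * Real.pi * |ξ| * κ := by positivity
      nlinarith [sq_abs ξ]
    exact (sq_le_sq₀ (by positivity) (msym_pos hκ ξ).le).1 h3
  refine ⟨𝓕⁻ (hm.toLp : L2), ?_⟩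
  have h2 : (𝓕 (sqrtR0 κ (𝓕⁻ (hm.toLp : L2))) : L2) = 𝓕 u := by
    apply Lp.ext
    refine (fourier_sqrtR0_ae hκ _).trans ?_
    filter_upwards [hm.coeFn_toLp] with ξ hξ
    rw [wsym, FourierTransform.fourier_fourierInv_eq, hξ, mul_inv_cancel_left₀]
    exact_mod_cast (msym_pos hκ ξ).ne'
  exact (Lp.fourierTransformₗᵢ ℝ ℂ).injective h2

/-- Under u = √R₀φ the form of −∂² + κ² becomes the inner product of L². -/
theorem inner_derivSqrtR0_add (hκ : 1 ≤ κ) (φ ψ : L2) :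
    ⟪derivSqrtR0 κ hκ φ, derivSqrtR0 κ hκ ψ⟫_ℂ +
      ((κ ^ 2 : ℝ) : ℂ) * ⟪sqrtR0 κ φ, sqrtR0 κ ψ⟫_ℂ = ⟪φ, ψ⟫_ℂ := by
  rw [derivSqrtR0, derivSqrtR0, inner_fourierInv_left, FourierTransform.fourier_fourierInv_eq,
    sqrtR0_eq hκ, sqrtR0_eq hκ, inner_fourierInv_left, FourierTransform.fourier_fourierInv_eq,
    inner_toLp_toLp, inner_toLp_toLp, ← integral_const_mul, ← integral_add
      (integrable_conj_mul (memLp_deriv_wsym hκ φ) (memLp_deriv_wsym hκ ψ))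
      ((integrable_conj_mul (memLp_wsym hκ φ) (memLp_wsym hκ ψ)).const_mul _),
    ← Lp.inner_fourier_eq φ ψ, inner_L2]
  refine integral_congr_ae (Eventually.of_forall fun ξ => ?_)
  simp only [wsym, map_mul, Complex.conj_ofReal, Complex.conj_I, Complex.conj_ofNat]
  have h : ((msym κ ξ : ℂ)) ^ 2 * (4 * Real.pi ^ 2 * ξ ^ 2 + κ ^ 2) = 1 := by
    have := inv_mul_cancel₀ (sym_pos hκ ξ).ne'
    rw [← msym_sq hκ] at this
    exact_mod_cast this
  push_cast
  linear_combination (conj ((𝓕 φ : L2) ξ) * (𝓕 ψ : L2) ξ) * h -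
    4 * Real.pi ^ 2 * ξ ^ 2 * (msym κ ξ : ℂ) ^ 2 * conj ((𝓕 φ : L2) ξ) * (𝓕 ψ : L2) ξ * Complex.I_sq

theorem memLp_translate (f : L2) (t : ℝ) : MemLp (fun x => f (x + t)) 2 (volume : Measure ℝ) :=
  (Lp.memLp f).comp_measurePreserving (measurePreserving_add_right volume t)

/-- The integral of a product in terms of the Fourier transform of one factor. -/
theorem integral_mul_fourier_L2 {h : ℝ → ℂ} (h1 : Integrable h) (h2 : MemLp h 2) (f : L2) :
    ∫ ξ, h ξ * (𝓕 f : L2) ξ = ∫ x, 𝓕 h x * f x := by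
  have g1 : Integrable fun x => conj (h x) :=
    (Complex.conjCLE : ℂ →L[ℝ] ℂ).integrable_comp h1
  have g2 : MemLp (fun x => conj (h x)) 2 (volume : Measure ℝ) := h2.star
  have e := inner_fourierInv_left (g2.toLp : L2) f
  rw [inner_toLp_left, inner_L2] at e
  simp only [Complex.conj_conj] at e
  rw [← e]
  refine integral_congr_ae ?_
  filter_upwards [coeFn_fourierInv_toLp g1 g2] with x hx
  rw [hx, fourierInv_eq_ec, fourier_eq_ec, ← integral_conj]
  congr 1
  refine integral_congr_ae (Eventually.of_forall fun ξ => ?_)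
  simp [conj_ec]

theorem fourier_translate (f : L2) (t : ℝ) :
    (𝓕 ((memLp_translate f t).toLp : L2) : L2) =ᵐ[volume] fun ξ => ec (t * ξ) * (𝓕 f : L2) ξ := by
  have hc := continuous_ec
  have hct : Continuous fun ξ => ec (t * ξ) := by fun_prop
  refine ae_eq_of_schwartz (locallyIntegrable_L2 _) ?_ fun g _ => ?_
  · have := (locallyIntegrable_L2 (𝓕 f)).continuous_smul hct
    simpa using this
  have g1 := g.integrable (μ := volume)
  have g2 : MemLp g 2 (volume : Measure ℝ) := g.memLp 2 volume
  have h1 : Integrable fun ξ => ec (t * ξ) * g ξ :=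
    g1.bdd_mul (c := 1) hct.aestronglyMeasurable (Eventually.of_forall fun ξ => (norm_ec _).le)
  have h2 : MemLp (fun ξ => ec (t * ξ) * g ξ) 2 (volume : Measure ℝ) :=
    g2.of_le (hct.aestronglyMeasurable.mul g2.1)
      (Eventually.of_forall fun ξ => by rw [norm_mul, norm_ec, one_mul])
  rw [integral_mul_fourier_L2 g1 g2]
  have e1 : ∀ ξ, g ξ * (ec (t * ξ) * (𝓕 f : L2) ξ) = (ec (t * ξ) * g ξ) * (𝓕 f : L2) ξ :=
    fun ξ => by ring
  simp_rw [e1]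
  rw [integral_mul_fourier_L2 h1 h2,
    ← integral_add_right_eq_self (fun x => 𝓕 (fun ξ => ec (t * ξ) * g ξ) x * f x) t]
  refine integral_congr_ae ?_
  filter_upwards [(memLp_translate f t).coeFn_toLp] with x hx
  rw [hx]
  congr 1
  rw [fourier_eq_ec, fourier_eq_ec]
  refine integral_congr_ae (Eventually.of_forall fun ξ => ?_)
  simp only
  rw [← mul_assoc, ← ec_add]
  ring_nf

/-- Square integrable functions with `L²`-Lipschitz translations belong to `H¹(ℝ)`. -/
theorem memH1_of_translate {f : ℝ → ℂ} (hf : MemLp f 2) {C : ℝ≥0∞} (hC : C ≠ ⊤)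
    (h : ∀ t : ℝ, ∫⁻ x, ‖f (x + t) - f x‖ₑ ^ 2 ≤ C * ‖t‖ₑ ^ 2) : MemH1 f := by
  set u : L2 := hf.toLp with hu
  have huf : u =ᵐ[volume] f := hf.coeFn_toLp
  have h1 : ∀ t : ℝ, ∫⁻ ξ, ‖(ec (t * ξ) - 1) * (𝓕 u : L2) ξ‖ₑ ^ 2 ≤ C * ‖t‖ₑ ^ 2 := by
    intro t
    refine le_trans (le_of_eq ?_) (h t)
    have e1 : ∀ᵐ ξ, (𝓕 ((memLp_translate u t).toLp - u) : L2) ξ =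
        (ec (t * ξ) - 1) * (𝓕 u : L2) ξ := by
      have : (𝓕 ((memLp_translate u t).toLp - u) : L2) =
          (𝓕 ((memLp_translate u t).toLp : L2) : L2) - 𝓕 u :=
        (Lp.fourierTransformₗᵢ ℝ ℂ).map_sub _ _
      rw [this]
      filter_upwards [Lp.coeFn_sub (𝓕 ((memLp_translate u t).toLp : L2) : L2) (𝓕 u : L2),
        fourier_translate u t] with ξ a b
      rw [a, Pi.sub_apply, b]; ring
    have e2 : ∀ᵐ x, ((memLp_translate u t).toLp - u : L2) x = f (x + t) - f x := by
      have hut : ∀ᵐ x, u (x + t) = f (x + t) :=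
        (measurePreserving_add_right volume t).quasiMeasurePreserving.ae huf
      filter_upwards [Lp.coeFn_sub ((memLp_translate u t).toLp : L2) u,
        (memLp_translate u t).coeFn_toLp, huf, hut] with x a b c d
      rw [a, Pi.sub_apply, b, c, d]
    calc ∫⁻ ξ, ‖(ec (t * ξ) - 1) * (𝓕 u : L2) ξ‖ₑ ^ 2
        = ∫⁻ ξ, ‖(𝓕 ((memLp_translate u t).toLp - u) : L2) ξ‖ₑ ^ 2 :=
          lintegral_congr_ae (by filter_upwards [e1] with ξ hξ; rw [hξ])
      _ = ∫⁻ x, ‖((memLp_translate u t).toLp - u : L2) x‖ₑ ^ 2 := by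
          rw [lintegral_enorm_sq, lintegral_enorm_sq, enorm_fourier_L2]
      _ = ∫⁻ x, ‖f (x + t) - f x‖ₑ ^ 2 :=
          lintegral_congr_ae (by filter_upwards [e2] with ξ hξ; rw [hξ])
  -- Difference quotients along t = 1/(n+1). Their squared norms are at most `C`, and Fatou's lemma
  -- passes the bound to the limit 2πiξ 𝓕u.
  let s : ℕ → ℝ := fun n => 1 / ((n : ℝ) + 1)
  have hs0 : ∀ n, s n ≠ 0 := fun n => by positivity
  have hs : Tendsto s atTop (𝓝[≠] 0) :=
    tendsto_nhdsWithin_iff.2 ⟨tendsto_one_div_add_atTop_nhds_zero_nat, Eventually.of_forall hs0⟩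
  have hlim : ∀ ξ : ℝ, Tendsto (fun n => ((s n : ℂ)⁻¹ * (ec (s n * ξ) - 1)) * (𝓕 u : L2) ξ) atTop
      (𝓝 ((2 * Real.pi * ξ * Complex.I : ℂ) * (𝓕 u : L2) ξ)) := by
    intro ξ
    have hd : HasDerivAt (fun t : ℝ => ec (t * ξ)) (2 * Real.pi * ξ * Complex.I : ℂ) 0 := by
      have h0 : HasDerivAt (fun t : ℝ => (((2 * Real.pi * (t * ξ) : ℝ) : ℂ)) * Complex.I)
          (((2 * Real.pi * (1 * ξ) : ℝ) : ℂ) * Complex.I) 0 :=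
        ((((hasDerivAt_id (0 : ℝ)).mul_const ξ).const_mul (2 * Real.pi)).ofReal_comp).mul_const _
      have := h0.cexp
      simpa [ec] using this
    have := (hd.tendsto_slope_zero.comp hs).mul_const ((𝓕 u : L2) ξ)
    refine this.congr fun n => ?_
    simp [ec_zero]
  have hfin : ∫⁻ ξ : ℝ, ‖(2 * Real.pi * ξ * Complex.I : ℂ) * (𝓕 u : L2) ξ‖ₑ ^ 2 ≤ C := by
    have hF : ∀ ξ : ℝ, ‖(2 * Real.pi * ξ * Complex.I : ℂ) * (𝓕 u : L2) ξ‖ₑ ^ 2 =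
        liminf (fun n => ‖((s n : ℂ)⁻¹ * (ec (s n * ξ) - 1)) * (𝓕 u : L2) ξ‖ₑ ^ 2) atTop := by
      intro ξ
      refine (Tendsto.liminf_eq ?_).symm
      exact ((ENNReal.continuous_pow 2).tendsto _).comp ((hlim ξ).enorm)
    simp_rw [hF]
    refine (lintegral_liminf_le' fun n => ?_).trans ?_
    · have hc := continuous_ec
      have : AEStronglyMeasurable
          (fun ξ => ((s n : ℂ)⁻¹ * (ec (s n * ξ) - 1)) * (𝓕 u : L2) ξ) volume :=
        (Continuous.aestronglyMeasurable (by fun_prop)).mul (Lp.memLp (𝓕 u : L2)).1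
      exact this.enorm.pow_const 2
    · refine liminf_le_of_le (by isBoundedDefault) fun b hb => ?_
      obtain ⟨n, hn⟩ := hb.exists
      refine hn.trans ?_
      have e : ∀ ξ, ‖((s n : ℂ)⁻¹ * (ec (s n * ξ) - 1)) * (𝓕 u : L2) ξ‖ₑ ^ 2 =
          ‖(s n : ℂ)⁻¹‖ₑ ^ 2 * ‖(ec (s n * ξ) - 1) * (𝓕 u : L2) ξ‖ₑ ^ 2 := fun ξ => by
        rw [mul_assoc, enorm_mul, mul_pow]
      simp_rw [e]
      rw [lintegral_const_mul' _ _ (by simp)]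
      refine (mul_le_mul_right (h1 (s n)) _).trans (le_of_eq ?_)
      have e3 : ‖(s n : ℂ)⁻¹‖ₑ * ‖s n‖ₑ = 1 := by
        rw [← ofReal_norm, ← ofReal_norm, ← ENNReal.ofReal_mul (norm_nonneg _), norm_inv,
          Complex.norm_real, inv_mul_cancel₀ (by simpa using hs0 n), ENNReal.ofReal_one]
      calc ‖(s n : ℂ)⁻¹‖ₑ ^ 2 * (C * ‖s n‖ₑ ^ 2) = C * (‖(s n : ℂ)⁻¹‖ₑ * ‖s n‖ₑ) ^ 2 := by ring
        _ = C := by rw [e3]; simp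
  have hvm : MemLp (fun ξ : ℝ => (2 * Real.pi * ξ * Complex.I : ℂ) * (𝓕 u : L2) ξ) 2 := by
    have hm : AEStronglyMeasurable
        (fun ξ : ℝ => (2 * Real.pi * ξ * Complex.I : ℂ) * (𝓕 u : L2) ξ) volume :=
      (Continuous.aestronglyMeasurable (by fun_prop)).mul (Lp.memLp (𝓕 u : L2)).1
    rw [memLp_two_iff hm]
    exact hfin.trans_lt hC.lt_top
  refine ⟨u, 𝓕⁻ (hvm.toLp : L2), huf, ?_⟩
  rw [hasWeakDeriv_iff, FourierTransform.fourier_fourierInv_eq]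
  exact hvm.coeFn_toLp

end Sobolev

/-! ### Integral operators with square integrable kernels -/

section Kernel

open scoped ENNReal InnerProductSpace ComplexConjugate ContDiff
open Filter Topology

/-- L² is separable and orthonormal vectors are √2 apart, so balls of radius 1/2 around them are
disjoint. Countability is needed to exchange sums over the basis with integrals. -/
theorem countable_of_hilbertBasis {ι : Type*} (b : HilbertBasis ι ℂ L2) : Countable ι := by
  have : Fact ((2 : ℝ≥0∞) ≠ ⊤) := ⟨by norm_num⟩
  refine Pairwise.countable_of_isOpen_disjoint (s := fun i => Metric.ball (b i) (1 / 2)) ?_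
    (fun i => Metric.isOpen_ball) (fun i => ⟨b i, Metric.mem_ball_self (by norm_num)⟩)
  intro i j hij
  refine Metric.ball_disjoint_ball ?_
  have h : ‖b i - b j‖ ^ 2 = 2 := by
    rw [@norm_sub_sq ℂ, b.orthonormal.1 i, b.orthonormal.1 j, b.orthonormal.2 hij]
    norm_num
  rw [dist_eq_norm]
  nlinarith [norm_nonneg (b i - b j)]

variable {a : ℝ × ℝ → ℂ}

theorem lintegral_kernel_lt_top (ha : MemLp a 2 (volume.prod volume)) :
    ∫⁻ x, ∫⁻ y, ‖a (x, y)‖ₑ ^ 2 < ⊤ := by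
  have h : ∫⁻ p, ‖a p‖ₑ ^ 2 ∂(volume.prod volume) < ⊤ := by
    have := (eLpNorm_lt_top_iff_lintegral_rpow_enorm_lt_top (by norm_num) (by norm_num)).1 ha.2
    simpa using this
  rwa [lintegral_prod _ (ha.1.enorm.pow_const 2)] at h

theorem ae_memLp_kernel (ha : MemLp a 2 (volume.prod volume)) :
    ∀ᵐ x, MemLp (fun y => a (x, y)) 2 (volume : Measure ℝ) := by
  have hm : AEMeasurable (fun x => ∫⁻ y, ‖a (x, y)‖ₑ ^ 2) volume :=
    (ha.1.enorm.pow_const 2).lintegral_prod_right'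
  filter_upwards [ha.1.prodMk_left, ae_lt_top' hm (lintegral_kernel_lt_top ha).ne] with x h1 h2
  exact (memLp_two_iff h1).2 h2

theorem enorm_kernel_apply_le {c : ℝ → ℂ} (hc : MemLp c 2) (f : L2) :
    ‖∫ y, c y * f y‖ₑ ^ 2 ≤ (∫⁻ y, ‖c y‖ₑ ^ 2) * ‖f‖ₑ ^ 2 := by
  have h2 : MemLp (fun y => conj (c y)) 2 (volume : Measure ℝ) := hc.star
  have e := inner_toLp_left h2 f
  simp only [Complex.conj_conj] at e
  have e2 : ∫⁻ y, ‖c y‖ₑ ^ 2 = ‖(h2.toLp : L2)‖ₑ ^ 2 := by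
    rw [lintegral_enorm_sq_toLp]
    simp [enorm_eq_nnnorm]
  rw [← e, e2, ← mul_pow]
  gcongr
  simp only [enorm_eq_nnnorm]
  exact_mod_cast nnnorm_inner_le_nnnorm (𝕜 := ℂ) _ _

theorem memLp_kernel_apply (ha : MemLp a 2 (volume.prod volume)) (f : L2) :
    MemLp (fun x => ∫ y, a (x, y) * f y) 2 (volume : Measure ℝ) := by
  have hm : AEStronglyMeasurable (fun x => ∫ y, a (x, y) * f y) volume :=
    (ha.1.mul (Lp.memLp f).1.comp_snd).integral_prod_right'
  rw [memLp_two_iff hm]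
  refine (lintegral_mono_ae (g := fun x => (∫⁻ y, ‖a (x, y)‖ₑ ^ 2) * ‖f‖ₑ ^ 2) ?_).trans_lt ?_
  · filter_upwards [ae_memLp_kernel ha] with x hx
    exact enorm_kernel_apply_le hx f
  · rw [lintegral_mul_const' _ _ (by simp)]
    exact ENNReal.mul_lt_top (lintegral_kernel_lt_top ha) (by simp)

theorem enorm_kernel_toLp_le (ha : MemLp a 2 (volume.prod volume)) (f : L2) :
    ‖((memLp_kernel_apply ha f).toLp : L2)‖ₑ ^ 2 ≤ (∫⁻ x, ∫⁻ y, ‖a (x, y)‖ₑ ^ 2) * ‖f‖ₑ ^ 2 := by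
  rw [lintegral_enorm_sq_toLp, ← lintegral_mul_const' _ _ (by simp)]
  refine lintegral_mono_ae ?_
  filter_upwards [ae_memLp_kernel ha] with x hx
  exact enorm_kernel_apply_le hx f

/-- The integral operator on `L²(ℝ)` with kernel `a`. -/
def kerOp (ha : MemLp a 2 (volume.prod volume)) : L2 →L[ℂ] L2 :=
  LinearMap.mkContinuous
    { toFun := fun f => (memLp_kernel_apply ha f).toLp
      map_add' := fun f g => by
        rw [← MemLp.toLp_add]
        apply MemLp.toLp_congr
        filter_upwards [ae_memLp_kernel ha] with x hx
        have h1 : Integrable fun y => a (x, y) * f y := hx.integrable_mul (Lp.memLp f)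
        have h2 : Integrable fun y => a (x, y) * g y := hx.integrable_mul (Lp.memLp g)
        rw [Pi.add_apply, ← integral_add h1 h2]
        refine integral_congr_ae ?_
        filter_upwards [Lp.coeFn_add f g] with y hy
        simp only [hy, Pi.add_apply, mul_add]
      map_smul' := fun c f => by
        rw [RingHom.id_apply, ← MemLp.toLp_const_smul]
        apply MemLp.toLp_congr
        refine Eventually.of_forall fun x => ?_
        rw [Pi.smul_apply, smul_eq_mul, ← integral_const_mul]
        refine integral_congr_ae ?_
        filter_upwards [Lp.coeFn_smul c f] with y hy
        simp only [hy, Pi.smul_apply, smul_eq_mul]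
        ring }
    (Real.sqrt (∫⁻ x, ∫⁻ y, ‖a (x, y)‖ₑ ^ 2).toReal) fun f => by
      have h := ENNReal.toReal_mono (ENNReal.mul_ne_top (lintegral_kernel_lt_top ha).ne (by simp))
        (enorm_kernel_toLp_le ha f)
      simp only [ENNReal.toReal_pow, ENNReal.toReal_mul, toReal_enorm] at h
      apply Real.le_sqrt_of_sq_le at h
      rwa [Real.sqrt_mul ENNReal.toReal_nonneg, Real.sqrt_sq (norm_nonneg _)] at h

theorem kerOp_apply (ha : MemLp a 2 (volume.prod volume)) (f : L2) :
    kerOp ha f = (memLp_kernel_apply ha f).toLp := rfl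

theorem kerOp_ae (ha : MemLp a 2 (volume.prod volume)) (f : L2) :
    kerOp ha f =ᵐ[volume] fun x => ∫ y, a (x, y) * f y :=
  (memLp_kernel_apply ha f).coeFn_toLp

/-- For fixed x, Parseval applied to the conjugate of a(x, ·) sums |∫ a(x,y) b_i(y) dy|² over i to
∫|a(x,y)|² dy. -/
theorem hsSq_kerOp (ha : MemLp a 2 (volume.prod volume)) {ι : Type*} (b : HilbertBasis ι ℂ L2) :
    hsSq b (kerOp ha) = ∫⁻ x, ∫⁻ y, ‖a (x, y)‖ₑ ^ 2 := by
  have := countable_of_hilbertBasis b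
  rw [hsSq]
  simp_rw [kerOp_apply, lintegral_enorm_sq_toLp]
  rw [← lintegral_tsum fun i => (memLp_kernel_apply ha (b i)).1.enorm.pow_const 2]
  refine lintegral_congr_ae ?_
  filter_upwards [ae_memLp_kernel ha] with x hx
  have h2 : MemLp (fun y => conj (a (x, y))) 2 (volume : Measure ℝ) := hx.star
  have e2 : ∫⁻ y, ‖a (x, y)‖ₑ ^ 2 = ‖(h2.toLp : L2)‖ₑ ^ 2 := by
    rw [lintegral_enorm_sq_toLp]
    simp [enorm_eq_nnnorm]
  rw [e2, ← tsum_enorm_inner_sq b]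
  refine tsum_congr fun i => ?_
  have e := inner_toLp_left h2 (b i)
  simp only [Complex.conj_conj] at e
  rw [← e, ← inner_conj_symm, enorm_eq_nnnorm, enorm_eq_nnnorm, RCLike.nnnorm_conj]

theorem integrable_kernel_form (ha : MemLp a 2 (volume.prod volume)) {φ ψ : ℝ → ℂ}
    (hφ : MemLp φ 2) (hψ : MemLp ψ 2) :
    Integrable (fun p : ℝ × ℝ => conj (φ p.1) * a p * ψ p.2) (volume.prod volume) := by
  have hm : AEStronglyMeasurable (fun p : ℝ × ℝ => φ p.1 * conj (ψ p.2)) (volume.prod volume) :=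
    hφ.1.comp_fst.mul hψ.star.1.comp_snd
  have h1 : MemLp (fun p : ℝ × ℝ => φ p.1 * conj (ψ p.2)) 2 (volume.prod volume) := by
    refine ⟨hm, (eLpNorm_lt_top_iff_lintegral_rpow_enorm_lt_top (by norm_num) (by norm_num)).2 ?_⟩
    simp only [ENNReal.toReal_ofNat, ENNReal.rpow_ofNat]
    rw [lintegral_prod _ (hm.enorm.pow_const 2)]
    have e : ∀ x y, ‖φ x * conj (ψ y)‖ₑ ^ 2 = ‖φ x‖ₑ ^ 2 * ‖ψ y‖ₑ ^ 2 := fun x y => by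
      rw [enorm_mul, mul_pow]; simp [enorm_eq_nnnorm]
    simp_rw [e]
    have h2 := (memLp_two_iff hψ.1).1 hψ
    have h3 : ∀ x, ∫⁻ y, ‖φ x‖ₑ ^ 2 * ‖ψ y‖ₑ ^ 2 = ‖φ x‖ₑ ^ 2 * ∫⁻ y, ‖ψ y‖ₑ ^ 2 := fun x =>
      lintegral_const_mul' _ _ (by simp)
    simp_rw [h3]
    rw [lintegral_mul_const' _ _ h2.ne]
    exact ENNReal.mul_lt_top ((memLp_two_iff hφ.1).1 hφ) h2
  have h2 : MemLp (fun p : ℝ × ℝ => conj (φ p.1 * conj (ψ p.2))) 2 (volume.prod volume) := h1.star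
  refine (h2.integrable_mul ha).congr (Eventually.of_forall fun p => ?_)
  simp only [Pi.mul_apply, map_mul, Complex.conj_conj]
  ring

end Kernel

/-! ### The operator `√R₀ q √R₀` -/

section Sandwich

open scoped ENNReal InnerProductSpace ComplexConjugate ContDiff
open Filter Topology

variable {κ : ℝ}

theorem stronglyMeasurable_fourierFn (q : HMinusOne) : StronglyMeasurable q.fourierFn := by
  unfold HMinusOne.fourierFn
  refine StronglyMeasurable.mul ?_ (Lp.stronglyMeasurable _)
  have : Measurable fun ξ : ℝ => (((1 + ξ ^ 2) ^ ((1 : ℝ) / 2) : ℝ) : ℂ) := by fun_prop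
  exact this.stronglyMeasurable

theorem locallyIntegrable_fourierFn (q : HMinusOne) : LocallyIntegrable q.fourierFn := by
  unfold HMinusOne.fourierFn
  have h1 : Continuous fun ξ : ℝ => (((1 + ξ ^ 2) ^ ((1 : ℝ) / 2) : ℝ) : ℂ) := by
    refine Complex.continuous_ofReal.comp (Continuous.rpow_const (by fun_prop) fun ξ => ?_)
    left; positivity
  exact (locallyIntegrable_L2 q.freq).continuous_smul h1

theorem fourierFn_add_ae (p q : HMinusOne) :
    (p + q).fourierFn =ᵐ[volume] fun ξ => p.fourierFn ξ + q.fourierFn ξ := by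
  filter_upwards [Lp.coeFn_add p.freq q.freq] with ξ h
  rw [HMinusOne.fourierFn, HMinusOne.freq_add, h, Pi.add_apply, mul_add]; rfl

theorem fourierFn_smul_ae (c : ℝ) (q : HMinusOne) :
    (c • q).fourierFn =ᵐ[volume] fun ξ => (c : ℂ) * q.fourierFn ξ := by
  filter_upwards [Lp.coeFn_smul c q.freq] with ξ h
  rw [HMinusOne.fourierFn, HMinusOne.freq_smul, h, Pi.smul_apply, HMinusOne.fourierFn,
    Complex.real_smul]
  ring

/-- The symbol whose square integral against `𝓕q` is the Hilbert–Schmidt norm. -/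
def hsSym (κ ξ : ℝ) : ℝ := (κ * (4 * Real.pi ^ 2 * ξ ^ 2 + 4 * κ ^ 2))⁻¹

theorem hsSym_pos (hκ : 1 ≤ κ) (ξ : ℝ) : 0 < hsSym κ ξ := by unfold hsSym; positivity

theorem integrable_msym_sq (hκ : 1 ≤ κ) : Integrable fun ξ => (((msym κ ξ) ^ 2 : ℝ) : ℂ) := by
  simp only [msym_sq hκ]
  exact (integrable_inv_sq_add (by linarith)).ofReal

theorem fourierInv_msym_sq (hκ : 1 ≤ κ) (x : ℝ) :
    𝓕⁻ (fun ξ => (((msym κ ξ) ^ 2 : ℝ) : ℂ)) x = ((Real.exp (-κ * |x|) / (2 * κ) : ℝ) : ℂ) := by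
  simp only [msym_sq hκ]
  exact fourierInv_inv_sq_add (by linarith) x

theorem integrable_ofReal_exp {k : ℝ} (hk : 0 < k) (c : ℝ) :
    Integrable fun x : ℝ => ((Real.exp (-k * |x|) / c : ℝ) : ℂ) :=
  ((integrable_exp_neg_abs hk).div_const c).ofReal

theorem fourierInv_exp_neg_abs {k : ℝ} (hk : 0 < k) (c ξ : ℝ) :
    𝓕⁻ (fun x : ℝ => ((Real.exp (-k * |x|) / c : ℝ) : ℂ)) ξ =
      ((2 * k / (4 * Real.pi ^ 2 * ξ ^ 2 + k ^ 2) / c : ℝ) : ℂ) := by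
  have h := fourier_exp_neg_abs hk (-ξ)
  rw [← Real.fourierInv_eq_fourier_neg, fourierInv_eq_ec] at h
  rw [fourierInv_eq_ec, show (fun v => ec (v * ξ) * ((Real.exp (-k * |v|) / c : ℝ) : ℂ)) =
    fun v => (c : ℂ)⁻¹ * (ec (v * ξ) * (Real.exp (-k * |v|) : ℂ)) by
      ext v; push_cast; ring, integral_const_mul, h]
  push_cast
  ring

/-- The convolution of the symbol of R₀ with itself corresponds to the square of e^{-κ|x|}/(2κ),
that is e^{-2κ|x|}/(4κ²). The doubled exponent is the source of 4κ² in the weight. -/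
theorem integral_msym_sq_mul (hκ : 1 ≤ κ) (ξ : ℝ) :
    ∫ η, (((msym κ η) ^ 2 : ℝ) : ℂ) * (((msym κ (η - ξ)) ^ 2 : ℝ) : ℂ) = (hsSym κ ξ : ℂ) := by
  have hκ0 : 0 < κ := by linarith
  have e1 : ∀ η, (((msym κ η) ^ 2 : ℝ) : ℂ) =
      𝓕⁻ (fun x : ℝ => ((Real.exp (-κ * |x|) / (2 * κ) : ℝ) : ℂ)) η := fun η => by
    rw [fourierInv_exp_neg_abs hκ0, msym_sq hκ]
    congr 1; field_simp
  have e2 : ∀ x, 𝓕⁻ (fun η => (((msym κ (η - ξ)) ^ 2 : ℝ) : ℂ)) x =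
      ec (x * ξ) * ((Real.exp (-κ * |x|) / (2 * κ) : ℝ) : ℂ) := fun x => by
    rw [← fourierInv_msym_sq hκ, fourierInv_eq_ec, fourierInv_eq_ec, ← integral_const_mul,
      ← integral_add_right_eq_self (fun v => ec (v * x) * (((msym κ (v - ξ)) ^ 2 : ℝ) : ℂ)) ξ]
    congr 1; ext v
    rw [← mul_assoc, ← ec_add, add_sub_cancel_right]
    congr 2; ring
  simp_rw [e1]
  simp_rw [← e1 (_ - ξ)]
  rw [integral_fourierInv_mul (integrable_ofReal_exp hκ0 _)
    ((integrable_msym_sq hκ).comp_sub_right ξ)]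
  simp_rw [e2]
  have e3 := fourierInv_exp_neg_abs (show 0 < 2 * κ by linarith) (4 * κ ^ 2) ξ
  rw [fourierInv_eq_ec] at e3
  rw [show (hsSym κ ξ : ℂ) =
    ((2 * (2 * κ) / (4 * Real.pi ^ 2 * ξ ^ 2 + (2 * κ) ^ 2) / (4 * κ ^ 2) : ℝ) : ℂ) by
      congr 1; unfold hsSym; field_simp; ring, ← e3]
  congr 1; ext x
  rw [show -(2 * κ) * |x| = -κ * |x| + -κ * |x| by ring, Real.exp_add]
  push_cast; field_simp; ring

theorem lintegral_msym_sq_mul (hκ : 1 ≤ κ) (ξ : ℝ) :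
    ∫⁻ η, ENNReal.ofReal (msym κ η ^ 2 * msym κ (η - ξ) ^ 2) = ENNReal.ofReal (hsSym κ ξ) := by
  have h := integral_msym_sq_mul hκ ξ
  have h1 : ∫ η, msym κ η ^ 2 * msym κ (η - ξ) ^ 2 = hsSym κ ξ := by
    have : ((∫ η, msym κ η ^ 2 * msym κ (η - ξ) ^ 2 : ℝ) : ℂ) = (hsSym κ ξ : ℂ) := by
      rw [← h, ← integral_complex_ofReal]; congr 1; ext η; push_cast; ring
    exact_mod_cast this
  rw [← h1, ofReal_integral_eq_lintegral_ofReal]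
  -- A non-integrable function would have integral 0 by convention, contradicting the positive value
  -- just found.
  · by_contra hn
    rw [integral_undef hn] at h1
    exact (hsSym_pos hκ ξ).ne h1
  · exact Eventually.of_forall fun η => by positivity

/-- The kernel of `√R₀ q √R₀` in frequency space. -/
def sandKer (κ : ℝ) (q : HMinusOne) (p : ℝ × ℝ) : ℂ :=
  (msym κ p.1 : ℂ) * q.fourierFn (p.1 - p.2) * (msym κ p.2 : ℂ)

theorem stronglyMeasurable_sandKer (hκ : 1 ≤ κ) (q : HMinusOne) :
    StronglyMeasurable (sandKer κ q) := by
  unfold sandKer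
  have h1 : Continuous fun ξ => (msym κ ξ : ℂ) :=
    Complex.continuous_ofReal.comp (continuous_msym hκ)
  exact ((h1.comp continuous_fst).stronglyMeasurable.mul
    ((stronglyMeasurable_fourierFn q).comp_measurable (measurable_fst.sub measurable_snd))).mul
    (h1.comp continuous_snd).stronglyMeasurable

theorem enorm_ofReal_sq {r : ℝ} : ‖(r : ℂ)‖ₑ ^ 2 = ENNReal.ofReal (r ^ 2) := by
  rw [← ofReal_norm, ← ENNReal.ofReal_pow (norm_nonneg _), Complex.norm_real,
    Real.norm_eq_abs, sq_abs]

theorem lintegral_sandKer (hκ : 1 ≤ κ) (q : HMinusOne) :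
    ∫⁻ η, ∫⁻ ζ, ‖sandKer κ q (η, ζ)‖ₑ ^ 2 =
      ∫⁻ ξ, ‖q.fourierFn ξ‖ₑ ^ 2 * ENNReal.ofReal (hsSym κ ξ) := by
  have e1 : ∀ η, ∫⁻ ζ, ‖sandKer κ q (η, ζ)‖ₑ ^ 2 =
      ∫⁻ ξ, ‖q.fourierFn ξ‖ₑ ^ 2 * ENNReal.ofReal (msym κ η ^ 2 * msym κ (η - ξ) ^ 2) := by
    intro η
    rw [← lintegral_sub_left_eq_self _ η]
    congr 1; ext ζ
    rw [sandKer, enorm_mul, enorm_mul, mul_pow, mul_pow, enorm_ofReal_sq, enorm_ofReal_sq,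
      ENNReal.ofReal_mul (by positivity), show η - (η - ζ) = ζ by ring]
    ring
  simp_rw [e1]
  rw [lintegral_lintegral_swap]
  · congr 1; ext ξ
    rw [lintegral_const_mul' _ _ (by simp), lintegral_msym_sq_mul hκ]
  · have h1 := (continuous_msym hκ).measurable
    have h2 := (stronglyMeasurable_fourierFn q).measurable
    refine Measurable.aemeasurable ?_
    unfold Function.uncurry
    exact ((h2.comp measurable_snd).enorm.pow_const 2).mul
      (ENNReal.measurable_ofReal.comp (((h1.comp measurable_fst).pow_const 2).mul
        ((h1.comp (measurable_fst.sub measurable_snd)).pow_const 2)))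

/-- The square of the Hilbert–Schmidt norm of `√R₀ q √R₀`. -/
def hsInt (κ : ℝ) (q : HMinusOne) : ℝ := 1 / κ * ∫ ξ : ℝ, ‖q.hat ξ‖ ^ 2 / (ξ ^ 2 + 4 * κ ^ 2)

theorem hsInt_eq (hκ : 1 ≤ κ) (q : HMinusOne) :
    hsInt κ q = ∫ ξ, ‖q.fourierFn ξ‖ ^ 2 * hsSym κ ξ := by
  have hpi := Real.pi_pos
  have h5 := Measure.integral_comp_div
    (fun ξ : ℝ => ‖q.fourierFn ξ‖ ^ 2 * hsSym κ ξ) (2 * Real.pi)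
  rw [smul_eq_mul, abs_of_pos (by positivity)] at h5
  have h6 : ∫ ξ, ‖q.fourierFn ξ‖ ^ 2 * hsSym κ ξ = (2 * Real.pi)⁻¹ *
      ∫ ξ : ℝ, ‖q.fourierFn (ξ / (2 * Real.pi))‖ ^ 2 * hsSym κ (ξ / (2 * Real.pi)) := by
    rw [h5, ← mul_assoc, inv_mul_cancel₀ (by positivity), one_mul]
  rw [h6, hsInt, ← integral_const_mul, ← integral_const_mul]
  congr 1; ext ξ
  have h7 : 4 * Real.pi ^ 2 * (ξ / (2 * Real.pi)) ^ 2 = ξ ^ 2 := by field_simp; ring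
  rw [hsSym, h7, HMinusOne.hat, norm_mul, Complex.norm_real, mul_pow, Real.norm_eq_abs, sq_abs,
    inv_pow, Real.sq_sqrt (by positivity)]
  field_simp

/-- The weight for κ ≥ 1 is dominated by the weight of the norm, so one ball in H⁻¹ serves every κ.
-/
theorem hsSym_le (hκ : 1 ≤ κ) (ξ : ℝ) : hsSym κ ξ ≤ (4 * Real.pi ^ 2 * ξ ^ 2 + 4)⁻¹ := by
  unfold hsSym
  apply inv_anti₀ (by positivity)
  have : 0 ≤ 4 * Real.pi ^ 2 * ξ ^ 2 := by positivity
  nlinarith [mul_self_nonneg (κ - 1), mul_nonneg this (by linarith : 0 ≤ κ - 1)]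

theorem lintegral_fourierFn_le (hκ : 1 ≤ κ) (q : HMinusOne) :
    ∫⁻ ξ, ‖q.fourierFn ξ‖ₑ ^ 2 * ENNReal.ofReal (hsSym κ ξ) ≤ ‖q‖ₑ ^ 2 := by
  have h1 : ‖q‖ₑ ^ 2 = ‖HMinusOne.toL2 q‖ₑ ^ 2 := rfl
  rw [h1, ← lintegral_enorm_sq]
  apply lintegral_mono_ae
  filter_upwards [(HMinusOne.memLp_ratio q).coeFn_toLp] with ξ hξ
  have h4 : HMinusOne.toL2 q ξ = (HMinusOne.ratio ξ : ℂ) * q.freq ξ := hξ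
  rw [h4, HMinusOne.fourierFn, enorm_mul, enorm_mul, mul_pow, mul_pow, enorm_ofReal_sq,
    enorm_ofReal_sq, mul_right_comm, ← ENNReal.ofReal_mul (by positivity)]
  gcongr
  rw [← Real.sqrt_eq_rpow, Real.sq_sqrt (by positivity), HMinusOne.ratio,
    Real.sq_sqrt (by positivity), div_eq_mul_inv]
  gcongr
  exact hsSym_le hκ ξ

theorem integrable_hsInt (hκ : 1 ≤ κ) (q : HMinusOne) :
    Integrable fun ξ => ‖q.fourierFn ξ‖ ^ 2 * hsSym κ ξ := by
  have hm : Measurable (hsSym κ) := by unfold hsSym; fun_prop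
  refine ⟨(((stronglyMeasurable_fourierFn q).norm.measurable.pow_const 2).mul
    hm).aestronglyMeasurable, ?_⟩
  refine lt_of_le_of_lt (le_of_eq ?_) (lt_of_le_of_lt (lintegral_fourierFn_le hκ q)
    (by simp : ‖q‖ₑ ^ 2 < ⊤))
  congr 1; ext ξ
  rw [enorm_mul, enorm_pow, Real.enorm_of_nonneg (hsSym_pos hκ ξ).le]
  simp

theorem lintegral_eq_hsInt (hκ : 1 ≤ κ) (q : HMinusOne) :
    ∫⁻ ξ, ‖q.fourierFn ξ‖ₑ ^ 2 * ENNReal.ofReal (hsSym κ ξ) = ENNReal.ofReal (hsInt κ q) := by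
  rw [hsInt_eq hκ, ofReal_integral_eq_lintegral_ofReal (integrable_hsInt hκ q)
    (Eventually.of_forall fun ξ => mul_nonneg (sq_nonneg _) (hsSym_pos hκ ξ).le)]
  congr 1; ext ξ
  rw [ENNReal.ofReal_mul (by positivity), ENNReal.ofReal_pow (norm_nonneg _), ofReal_norm]

theorem hsInt_nonneg (hκ : 1 ≤ κ) (q : HMinusOne) : 0 ≤ hsInt κ q := by
  rw [hsInt_eq hκ]
  exact integral_nonneg fun ξ => mul_nonneg (sq_nonneg _) (hsSym_pos hκ ξ).le

theorem hsInt_le (hκ : 1 ≤ κ) (q : HMinusOne) : hsInt κ q ≤ ‖q‖ ^ 2 := by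
  have h := lintegral_fourierFn_le hκ q
  rw [lintegral_eq_hsInt hκ, ← ofReal_norm, ← ENNReal.ofReal_pow (norm_nonneg _)] at h
  exact (ENNReal.ofReal_le_ofReal_iff (by positivity)).1 h

theorem eq_zero_of_hsInt (hκ : 1 ≤ κ) {q : HMinusOne} (h : hsInt κ q = 0) : q = 0 := by
  have h1 := lintegral_eq_hsInt hκ q
  have hm : Measurable (hsSym κ) := by unfold hsSym; fun_prop
  have hm' : Measurable fun ξ => ‖q.fourierFn ξ‖ₑ ^ 2 * ENNReal.ofReal (hsSym κ ξ) :=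
    ((stronglyMeasurable_fourierFn q).measurable.enorm.pow_const 2).mul hm.ennreal_ofReal
  rw [h, ENNReal.ofReal_zero, lintegral_eq_zero_iff hm'] at h1
  apply HMinusOne.eq_zero_of_freq
  rw [Lp.eq_zero_iff_ae_eq_zero]
  filter_upwards [h1] with ξ hξ
  have h2 : ENNReal.ofReal (hsSym κ ξ) ≠ 0 := by simpa using hsSym_pos hκ ξ
  have h3 : ((1 + ξ ^ 2) ^ ((1 : ℝ) / 2) : ℝ) ≠ 0 := by positivity
  have h4 : q.fourierFn ξ = 0 := by simpa [h2] using hξ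
  rw [HMinusOne.fourierFn, mul_eq_zero] at h4
  exact h4.resolve_left (by exact_mod_cast h3)

theorem memLp_sandKer (hκ : 1 ≤ κ) (q : HMinusOne) :
    MemLp (sandKer κ q) 2 (volume.prod volume) := by
  have hm := stronglyMeasurable_sandKer hκ q
  refine ⟨hm.aestronglyMeasurable,
    (eLpNorm_lt_top_iff_lintegral_rpow_enorm_lt_top (by norm_num) (by norm_num)).2 ?_⟩
  simp only [ENNReal.toReal_ofNat, ENNReal.rpow_ofNat]
  rw [lintegral_prod _ (hm.measurable.enorm.pow_const 2).aemeasurable, lintegral_sandKer hκ,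
    lintegral_eq_hsInt hκ]
  exact ENNReal.ofReal_lt_top

/-- The operator `√R₀ q √R₀`. -/
def sand (κ : ℝ) (hκ : 1 ≤ κ) (q : HMinusOne) : L2 →L[ℂ] L2 :=
  ((Lp.fourierTransformₗᵢ ℝ ℂ).symm.toContinuousLinearEquiv : L2 →L[ℂ] L2) ∘L
    kerOp (memLp_sandKer hκ q) ∘L
      ((Lp.fourierTransformₗᵢ ℝ ℂ).toContinuousLinearEquiv : L2 →L[ℂ] L2)

theorem sand_apply (hκ : 1 ≤ κ) (q : HMinusOne) (f : L2) :
    sand κ hκ q f = 𝓕⁻ (kerOp (memLp_sandKer hκ q) (𝓕 f)) := rfl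

theorem hsSq_sand (hκ : 1 ≤ κ) (q : HMinusOne) {ι : Type*} (b : HilbertBasis ι ℂ L2) :
    hsSq b (sand κ hκ q) = ENNReal.ofReal (hsInt κ q) := by
  let c : HilbertBasis ι ℂ L2 := HilbertBasis.ofRepr ((Lp.fourierTransformₗᵢ ℝ ℂ).symm.trans b.repr)
  have hc : ∀ i, c i = 𝓕 (b i) := fun i => by
    classical
    rw [← c.repr_symm_single, ← b.repr_symm_single]; rfl
  rw [← lintegral_eq_hsInt hκ, ← lintegral_sandKer hκ, ← hsSq_kerOp (memLp_sandKer hκ q) c]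
  unfold hsSq
  congr 1; ext i
  rw [sand_apply, enorm_fourierInv_L2, hc]

theorem sand_add (hκ : 1 ≤ κ) (p q : HMinusOne) :
    sand κ hκ (p + q) = sand κ hκ p + sand κ hκ q := by
  ext1 f
  rw [add_apply, sand_apply, sand_apply, sand_apply, ← FourierTransform.fourierInv_add]
  congr 1
  apply Lp.ext
  filter_upwards [kerOp_ae (memLp_sandKer hκ (p + q)) (𝓕 f), kerOp_ae (memLp_sandKer hκ p) (𝓕 f),
    kerOp_ae (memLp_sandKer hκ q) (𝓕 f), Lp.coeFn_add (kerOp (memLp_sandKer hκ p) (𝓕 f))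
      (kerOp (memLp_sandKer hκ q) (𝓕 f)), ae_memLp_kernel (memLp_sandKer hκ p),
    ae_memLp_kernel (memLp_sandKer hκ q)] with η h1 h2 h3 h4 h5 h6
  have i1 : Integrable fun ζ => sandKer κ p (η, ζ) * (𝓕 f : L2) ζ :=
    h5.integrable_mul (Lp.memLp _)
  have i2 : Integrable fun ζ => sandKer κ q (η, ζ) * (𝓕 f : L2) ζ :=
    h6.integrable_mul (Lp.memLp _)
  rw [h1, h4, Pi.add_apply, h2, h3, ← integral_add i1 i2]
  apply integral_congr_ae
  filter_upwards [(quasiMeasurePreserving_sub_left volume η).ae (fourierFn_add_ae p q)] with ζ h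
  simp only [sandKer, h]
  ring

theorem sand_smul (hκ : 1 ≤ κ) (c : ℝ) (q : HMinusOne) :
    sand κ hκ (c • q) = (c : ℂ) • sand κ hκ q := by
  ext1 f
  rw [smul_apply, sand_apply, sand_apply, ← FourierTransform.fourierInv_smul]
  congr 1
  apply Lp.ext
  filter_upwards [kerOp_ae (memLp_sandKer hκ (c • q)) (𝓕 f), kerOp_ae (memLp_sandKer hκ q) (𝓕 f),
    Lp.coeFn_smul (c : ℂ) (kerOp (memLp_sandKer hκ q) (𝓕 f))] with η h1 h2 h3
  rw [h1, h3, Pi.smul_apply, h2, smul_eq_mul, ← integral_const_mul]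
  apply integral_congr_ae
  filter_upwards [(quasiMeasurePreserving_sub_left volume η).ae (fourierFn_smul_ae c q)] with ζ h
  simp only [sandKer, h]
  ring

end Sandwich

/-! ### The form of √R₀ q √R₀, its symmetry and reality, and its action on the kernel vectors -/

section Pairing

open scoped ENNReal InnerProductSpace ComplexConjugate ContDiff
open Filter Topology

variable {κ : ℝ}

theorem HMinusOne.pairing_congr (q : HMinusOne) {h h' : ℝ → ℂ} (e : h =ᵐ[volume] h') :
    q.pairing h = q.pairing h' := by
  have : 𝓕⁻ h = 𝓕⁻ h' := by
    ext ξ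
    rw [fourierInv_eq_ec, fourierInv_eq_ec]
    exact integral_congr_ae (by filter_upwards [e] with x hx; rw [hx])
  rw [HMinusOne.pairing, HMinusOne.pairing, this]

theorem fourierInv_conj (h : ℝ → ℂ) (ξ : ℝ) : 𝓕⁻ (fun x => conj (h x)) ξ = conj (𝓕⁻ h (-ξ)) := by
  rw [fourierInv_eq_ec, fourierInv_eq_ec, ← integral_conj]
  congr 1; ext x
  rw [map_mul, conj_ec]; congr 2; ring

/-- For real g the functions 𝓕g + 𝓕⁻g and i(𝓕g − 𝓕⁻g) are real, because 𝓕⁻g is the conjugate of 𝓕g.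
Reality of q on both yields q(𝓕⁻g) = conj q(𝓕g), which is the Hermitian symmetry of 𝓕q tested
against g. -/
theorem conj_fourierFn_ae (q : HMinusOne) :
    (fun ξ => q.fourierFn (-ξ)) =ᵐ[volume] fun ξ => conj (q.fourierFn ξ) := by
  have hl := locallyIntegrable_fourierFn q
  have hm := (Measure.measurePreserving_neg (volume : Measure ℝ))
  refine ae_eq_of_schwartz ?_ ?_ fun g hg => ?_
  · intro x
    obtain ⟨s, hs, h⟩ := hl (-x)
    refine ⟨Neg.neg ⁻¹' s, ?_, ?_⟩
    · exact continuous_neg.continuousAt.preimage_mem_nhds hs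
    · exact (hm.integrableOn_comp_preimage (Homeomorph.neg ℝ).measurableEmbedding).2 h
  · intro x
    obtain ⟨s, hs, h⟩ := hl x
    refine ⟨s, hs, ?_⟩
    exact (LinearIsometryEquiv.integrable_comp_iff
      (μ := volume.restrict s) (φ := q.fourierFn) Complex.conjLIE).2 h
  have hgc : ∀ x, conj (g x) = g x := fun x => Complex.conj_eq_iff_im.2 (hg x)
  have hF : ∀ x, (𝓕⁻ g : 𝓢(ℝ, ℂ)) x = conj ((𝓕 g : 𝓢(ℝ, ℂ)) x) := by
    intro x
    rw [SchwartzMap.fourierInv_coe, SchwartzMap.fourier_coe]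
    have := fourierInv_conj g x
    simp only [hgc] at this
    rw [this, Real.fourierInv_eq_fourier_neg, neg_neg]
  have h1 : (q.toDistribution (𝓕 g + 𝓕⁻ g)).im = 0 := by
    refine q.2.2 _ fun x => ?_
    rw [add_apply, hF, Complex.add_im, Complex.conj_im]; ring
  have h2 : (q.toDistribution (Complex.I • (𝓕 g - 𝓕⁻ g))).im = 0 := by
    refine q.2.2 _ fun x => ?_
    rw [smul_apply, sub_apply, hF]
    simp
  have h3 : q.toDistribution (𝓕 g) = ∫ ξ, q.fourierFn ξ * g ξ := by
    rw [← HMinusOne.pairing_schwartz, HMinusOne.pairing, ← SchwartzMap.fourierInv_coe,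
      FourierTransform.fourierInv_fourier_eq]
  have h4 : q.toDistribution (𝓕⁻ g) = ∫ ξ, q.fourierFn ξ * g (-ξ) := by
    rw [← HMinusOne.pairing_schwartz, HMinusOne.pairing]
    congr 1; ext ξ
    rw [Real.fourierInv_eq_fourier_neg, ← SchwartzMap.fourier_coe,
      FourierTransform.fourier_fourierInv_eq]
  have h5 : q.toDistribution (𝓕⁻ g) = conj (q.toDistribution (𝓕 g)) := by
    rw [map_add, Complex.add_im] at h1
    rw [map_smul, map_sub] at h2
    simp at h2
    apply Complex.ext
    · rw [Complex.conj_re]; linarith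
    · rw [Complex.conj_im]; linarith
  rw [← integral_neg_eq_self]
  simp only [neg_neg]
  rw [h3, h4, ← integral_conj] at h5
  simp only [map_mul, hgc] at h5
  simp only [mul_comm (g _)]
  exact h5

theorem HMinusOne.pairing_conj (q : HMinusOne) (h : ℝ → ℂ) :
    q.pairing (fun x => conj (h x)) = conj (q.pairing h) := by
  rw [HMinusOne.pairing, HMinusOne.pairing, ← integral_conj, ← integral_neg_eq_self]
  apply integral_congr_ae
  filter_upwards [conj_fourierFn_ae q] with ξ hξ
  rw [hξ, fourierInv_conj, neg_neg, map_mul]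

theorem memLp_wsym_sub (hκ : 1 ≤ κ) (ψ : L2) (ξ : ℝ) : MemLp (fun η => wsym κ ψ (η - ξ)) 2 :=
  (memLp_wsym hκ ψ).comp_measurePreserving (measurePreserving_sub_right volume ξ)

theorem fourierInv_conj_sqrtR0_mul (hκ : 1 ≤ κ) (φ ψ : L2) (ξ : ℝ) :
    𝓕⁻ (fun x => conj (sqrtR0 κ φ x) * sqrtR0 κ ψ x) ξ =
      ∫ η, conj (wsym κ φ η) * wsym κ ψ (η - ξ) := by
  have hi : Integrable fun η => wsym κ ψ (η - ξ) := (integrable_wsym hκ ψ).comp_sub_right ξ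
  have hm := memLp_wsym_sub hκ ψ ξ
  rw [← inner_toLp_toLp (memLp_wsym hκ φ) hm,
    ← FourierTransform.fourier_fourierInv_eq (E := L2) (F := L2) (hm.toLp : L2),
    ← inner_fourierInv_left, ← sqrtR0_eq hκ, inner_L2, fourierInv_eq_ec]
  apply integral_congr_ae
  filter_upwards [coeFn_fourierInv_toLp hi hm, sqrtR0_ae hκ ψ] with x h1 h2
  rw [h1, h2, fourierInv_eq_ec, fourierInv_eq_ec,
    ← integral_add_right_eq_self (fun v => ec (v * x) * wsym κ ψ (v - ξ)) ξ]
  simp only [add_sub_cancel_right, add_mul, ec_add]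
  rw [show (fun v => ec (v * x) * ec (ξ * x) * wsym κ ψ v) =
    fun v => ec (ξ * x) * (ec (v * x) * wsym κ ψ v) by ext v; ring, integral_const_mul,
    mul_comm ξ x]
  ring

theorem measurePreserving_shear :
    MeasurePreserving (fun p : ℝ × ℝ => (p.1, p.1 - p.2)) (volume.prod volume)
      (volume.prod volume) :=
  (MeasurePreserving.id volume).skew_product (g := fun x y => x - y)
    (measurable_fst.sub measurable_snd)
    (Eventually.of_forall fun x => (Measure.measurePreserving_sub_left volume x).map_eq)

theorem integrable_sandKer_form (hκ : 1 ≤ κ) (q : HMinusOne) (φ ψ : L2) :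
    Integrable (fun p : ℝ × ℝ => conj (wsym κ φ p.1) * q.fourierFn p.2 * wsym κ ψ (p.1 - p.2))
      (volume.prod volume) := by
  have h := integrable_kernel_form (memLp_sandKer hκ q) (Lp.memLp (𝓕 φ : L2)) (Lp.memLp (𝓕 ψ : L2))
  have h2 := measurePreserving_shear.integrable_comp_of_integrable h
  refine h2.congr (Eventually.of_forall fun p => ?_)
  simp only [Function.comp, sandKer, wsym, map_mul, Complex.conj_ofReal, sub_sub_cancel]
  ring

/-- The inverse transform of conj(√R₀φ)·√R₀ψ is a correlation of the two transforms. Fubini and the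
substitution ζ = η − ξ turn its pairing with 𝓕q into the form of the kernel `sandKer`. -/
theorem inner_sand (hκ : 1 ≤ κ) (q : HMinusOne) (φ ψ : L2) : ⟪φ, sand κ hκ q ψ⟫_ℂ =
    q.pairing fun x => conj (sqrtR0 κ φ x) * sqrtR0 κ ψ x := by
  rw [sand_apply, inner_fourierInv_right, inner_L2, HMinusOne.pairing]
  simp_rw [fourierInv_conj_sqrtR0_mul hκ, ← integral_const_mul]
  have h := integral_integral_swap (f := fun η ξ => conj (wsym κ φ η) * q.fourierFn ξ *
    wsym κ ψ (η - ξ)) (integrable_sandKer_form hκ q φ ψ)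
  have e : ∀ ξ η : ℝ, q.fourierFn ξ * (conj (wsym κ φ η) * wsym κ ψ (η - ξ)) =
    conj (wsym κ φ η) * q.fourierFn ξ * wsym κ ψ (η - ξ) := fun ξ η => by ring
  simp_rw [e]
  rw [← h]
  apply integral_congr_ae
  filter_upwards [kerOp_ae (memLp_sandKer hκ q) (𝓕 ψ)] with η h1
  rw [h1, ← integral_const_mul, ← integral_sub_left_eq_self _ _ η]
  congr 1; ext ζ
  simp only [sandKer, wsym, map_mul, Complex.conj_ofReal, sub_sub_cancel]
  ring

theorem isSandwich_sand (hκ : 1 ≤ κ) (q : HMinusOne) : IsSandwich κ q (sand κ hκ q) :=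
  inner_sand hκ q

theorem inner_sand_left (hκ : 1 ≤ κ) (q : HMinusOne) (φ ψ : L2) :
    ⟪sand κ hκ q φ, ψ⟫_ℂ = ⟪φ, sand κ hκ q ψ⟫_ℂ := by
  rw [← inner_conj_symm, inner_sand, inner_sand, ← HMinusOne.pairing_conj]
  congr 1; ext x
  rw [map_mul, Complex.conj_conj, mul_comm]

theorem sand_star (hκ : 1 ≤ κ) (q : HMinusOne) (ψ : L2) :
    sand κ hκ q (star ψ) = star (sand κ hκ q ψ) := by
  refine ext_inner_left ℂ fun φ => ?_
  have h : ⟪φ, star (sand κ hκ q ψ)⟫_ℂ = conj ⟪star φ, sand κ hκ q ψ⟫_ℂ := by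
    rw [← inner_star_star, star_star]
  rw [h, inner_sand, inner_sand, ← HMinusOne.pairing_conj, sqrtR0_star hκ, sqrtR0_star hκ]
  apply HMinusOne.pairing_congr
  filter_upwards [Lp.coeFn_star (sqrtR0 κ ψ), Lp.coeFn_star (sqrtR0 κ φ)] with x h1 h2
  rw [h1, h2]
  simp

/-- √R₀E_x is e^{-κ|x−y|}/(2κ), whose square is e^{-2κ|x−y|}/(4κ²). The linear term of ρ is thus a
diagonal matrix element of A. -/
theorem expConv_eq (hκ : 1 ≤ κ) (q : HMinusOne) (x : ℝ) :
    expConv κ q x = 4 * κ ^ 2 * (⟪kerE κ hκ x, sand κ hκ q (kerE κ hκ x)⟫_ℂ).re := by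
  rw [inner_sand, expConv, ← Complex.re_ofReal_mul]
  congr 1
  have hκ0 : 0 < κ := by linarith
  rw [q.pairing_congr (h := fun y => conj (sqrtR0 κ (kerE κ hκ x) y) * sqrtR0 κ (kerE κ hκ x) y)
    (h' := fun y => ((4 * κ ^ 2 : ℝ) : ℂ)⁻¹ * (Real.exp (-2 * κ * |x - y|) : ℂ))]
  · rw [HMinusOne.pairing, HMinusOne.pairing, ← integral_const_mul]
    congr 1; ext ξ
    rw [fourierInv_eq_ec, fourierInv_eq_ec]
    rw [show (fun v => ec (v * ξ) * (((4 * κ ^ 2 : ℝ) : ℂ)⁻¹ * (Real.exp (-2 * κ * |x - v|) : ℂ))) =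
      fun v => ((4 * κ ^ 2 : ℝ) : ℂ)⁻¹ * (ec (v * ξ) * (Real.exp (-2 * κ * |x - v|) : ℂ)) by
        ext v; ring, integral_const_mul]
    have : ((4 * κ ^ 2 : ℝ) : ℂ) ≠ 0 := by
      rw [Ne, Complex.ofReal_eq_zero]; positivity
    rw [mul_left_comm (q.fourierFn ξ), mul_inv_cancel_left₀ this]
  · filter_upwards [sqrtR0_kerE_ae hκ x] with y hy
    rw [hy, Complex.conj_ofReal, ← Complex.ofReal_mul, ← Complex.ofReal_inv, ← Complex.ofReal_mul]
    congr 1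
    rw [show -2 * κ * |x - y| = -κ * |x - y| + -κ * |x - y| by ring, Real.exp_add]
    field_simp; norm_num

theorem eq_of_sand_eq (hκ : 1 ≤ κ) {p q : HMinusOne} (h : sand κ hκ p = sand κ hκ q) : p = q := by
  have h1 : sand κ hκ (p - q) = 0 := by
    have := sand_add hκ (p - q) q
    rw [sub_add_cancel, h] at this
    exact right_eq_add.1 this
  obtain ⟨w, b, -⟩ := exists_hilbertBasis ℂ L2
  have h2 := hsSq_sand hκ (p - q) b
  rw [h1] at h2
  have h3 : hsSq b (0 : L2 →L[ℂ] L2) = 0 := by simp [hsSq]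
  rw [h3] at h2
  have h4 := ENNReal.ofReal_eq_zero.1 h2.symm
  exact sub_eq_zero.1 (eq_zero_of_hsInt hκ (le_antisymm h4 (hsInt_nonneg hκ _)))

theorem norm_sand_le (hκ : 1 ≤ κ) (q : HMinusOne) : ‖sand κ hκ q‖ ≤ ‖q‖ := by
  obtain ⟨w, b, -⟩ := exists_hilbertBasis ℂ L2
  have h := enorm_sq_le_hsSq b (sand κ hκ q) (by rw [hsSq_sand]; exact ENNReal.ofReal_ne_top)
  rw [hsSq_sand, ENNReal.toReal_ofReal (hsInt_nonneg hκ q)] at h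
  exact h.trans (Real.sqrt_le_iff.2 ⟨norm_nonneg _, hsInt_le hκ q⟩)

/-- Expanding in the basis, ‖B E_x‖² = Σ|⟨E_x, B*b_i⟩|², and each term integrates to at most
‖B*b_i‖². This converts Hilbert–Schmidt bounds into integrability in x. -/
theorem lintegral_apply_kerE (hκ : 1 ≤ κ) (B : L2 →L[ℂ] L2) {ι : Type*} (b : HilbertBasis ι ℂ L2) :
    ∫⁻ x, ‖B (kerE κ hκ x)‖ₑ ^ 2 ≤ hsSq b B := by
  have := countable_of_hilbertBasis b
  have e : ∀ x, ‖B (kerE κ hκ x)‖ₑ ^ 2 = ∑' i, ‖⟪kerE κ hκ x, B.adjoint (b i)⟫_ℂ‖ₑ ^ 2 := by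
    intro x
    rw [← tsum_enorm_inner_sq b]
    congr 1; ext i
    rw [ContinuousLinearMap.adjoint_inner_right, ← inner_conj_symm (𝕜 := ℂ) (B _)]
    rw [enorm_eq_nnnorm, enorm_eq_nnnorm, RCLike.nnnorm_conj]
  simp_rw [e]
  rw [lintegral_tsum, hsSq_eq_adjoint b b]
  · exact ENNReal.tsum_le_tsum fun i => lintegral_inner_kerE hκ _
  · intro i
    exact ((continuous_kerE hκ).inner (𝕜 := ℂ) continuous_const).enorm.measurable.pow_const 2 |>.aemeasurable

theorem lintegral_apply_kerE_sub (hκ : 1 ≤ κ) (t : ℝ) (B : L2 →L[ℂ] L2) {ι : Type*}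
    (b : HilbertBasis ι ℂ L2) :
    ∫⁻ x, ‖B (kerE κ hκ (x + t) - kerE κ hκ x)‖ₑ ^ 2 ≤ ‖t‖ₑ ^ 2 * hsSq b B := by
  have := countable_of_hilbertBasis b
  have e : ∀ x, ‖B (kerE κ hκ (x + t) - kerE κ hκ x)‖ₑ ^ 2 =
      ∑' i, ‖⟪kerE κ hκ (x + t) - kerE κ hκ x, B.adjoint (b i)⟫_ℂ‖ₑ ^ 2 := by
    intro x
    rw [← tsum_enorm_inner_sq b]
    congr 1; ext i
    rw [ContinuousLinearMap.adjoint_inner_right, ← inner_conj_symm (𝕜 := ℂ) (B _)]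
    rw [enorm_eq_nnnorm, enorm_eq_nnnorm, RCLike.nnnorm_conj]
  simp_rw [e]
  rw [lintegral_tsum, hsSq_eq_adjoint b b, hsSq, ← ENNReal.tsum_mul_left]
  · exact ENNReal.tsum_le_tsum fun i => lintegral_inner_kerE_sub hκ t _
  · intro i
    exact ((((continuous_kerE hκ).comp (continuous_add_const t)).sub
      (continuous_kerE hκ)).inner (𝕜 := ℂ) continuous_const).enorm.measurable.pow_const 2 |>.aemeasurable

end Pairing

/-! ### Inverting `1 + A` -/

section OneAddInverse

open scoped ENNReal InnerProductSpace ComplexConjugate ContDiff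
open Filter Topology

variable {H : Type*} [NormedAddCommGroup H] [InnerProductSpace ℂ H] [CompleteSpace H]

/-- `(1 + A)⁻¹`. -/
def opInv (A : H →L[ℂ] H) : H →L[ℂ] H := Ring.inverse (1 + A)

variable {A B : H →L[ℂ] H}

theorem isUnit_one_add (hA : ‖A‖ ≤ 1 / 2) : IsUnit (1 + A) := by
  have := isUnit_one_sub_of_norm_lt_one (x := -A) (by rw [norm_neg]; linarith)
  rwa [sub_neg_eq_add] at this

theorem apply_opInv (hA : ‖A‖ ≤ 1 / 2) (v : H) : opInv A v + A (opInv A v) = v := by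
  have h := Ring.mul_inverse_cancel _ (isUnit_one_add hA)
  have := DFunLike.congr_fun h v
  simpa [opInv] using this

theorem opInv_apply (hA : ‖A‖ ≤ 1 / 2) (v : H) : opInv A (v + A v) = v := by
  have h := Ring.inverse_mul_cancel _ (isUnit_one_add hA)
  have := DFunLike.congr_fun h v
  simpa [opInv] using this

theorem eq_opInv (hA : ‖A‖ ≤ 1 / 2) {u v : H} : u + A u = v ↔ u = opInv A v := by
  constructor
  · rintro rfl; rw [opInv_apply hA]
  · rintro rfl; exact apply_opInv hA v

theorem inner_opInv_left (hA : ‖A‖ ≤ 1 / 2) (hs : ∀ u v, ⟪A u, v⟫_ℂ = ⟪u, A v⟫_ℂ) (u v : H) :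
    ⟪opInv A u, v⟫_ℂ = ⟪u, opInv A v⟫_ℂ := by
  conv_lhs => rw [← apply_opInv hA v]
  conv_rhs => rw [← apply_opInv hA u]
  rw [inner_add_right, inner_add_left, hs]

theorem norm_apply_le (hA : ‖A‖ ≤ 1 / 2) (v : H) : ‖A v‖ ≤ 1 / 2 * ‖v‖ :=
  (A.le_opNorm v).trans (mul_le_mul_of_nonneg_right hA (norm_nonneg _))

theorem norm_opInv_apply_le (hA : ‖A‖ ≤ 1 / 2) (v : H) : ‖opInv A v‖ ≤ 2 * ‖v‖ := by
  have h1 := apply_opInv hA v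
  have h2 := norm_apply_le hA (opInv A v)
  have h3 : opInv A v = v - A (opInv A v) := by rw [eq_sub_iff_add_eq, h1]
  have h4 : ‖opInv A v‖ ≤ ‖v‖ + ‖A (opInv A v)‖ := by
    conv_lhs => rw [h3]
    exact norm_sub_le _ _
  linarith

theorem le_norm_opInv_apply (hA : ‖A‖ ≤ 1 / 2) (v : H) : 2 / 3 * ‖v‖ ≤ ‖opInv A v‖ := by
  have h1 := apply_opInv hA v
  have h2 := norm_apply_le hA (opInv A v)
  have h4 : ‖v‖ ≤ ‖opInv A v‖ + ‖A (opInv A v)‖ := by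
    conv_lhs => rw [← h1]
    exact norm_add_le _ _
  linarith

theorem re_inner_apply_ge (hA : ‖A‖ ≤ 1 / 2) (v : H) :
    1 / 2 * ‖v‖ ^ 2 ≤ (⟪v, v + A v⟫_ℂ).re := by
  rw [inner_add_right, Complex.add_re]
  have h1 : (⟪v, v⟫_ℂ).re = ‖v‖ ^ 2 := inner_self_eq_norm_sq (𝕜 := ℂ) v
  have h2 : |(⟪v, A v⟫_ℂ).re| ≤ ‖v‖ * ‖A v‖ :=
    (Complex.abs_re_le_norm _).trans (norm_inner_le_norm _ _)
  have h3 := norm_apply_le hA v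
  have h4 := abs_le.1 h2
  nlinarith [norm_nonneg v]

/-- Coercivity of 1 + A at the vector (1+A)⁻¹v, whose norm is at least (2/3)‖v‖; the constant is
(1/2)(2/3)². -/
theorem re_inner_opInv_ge (hA : ‖A‖ ≤ 1 / 2) (v : H) :
    2 / 9 * ‖v‖ ^ 2 ≤ (⟪v, opInv A v⟫_ℂ).re := by
  have h1 := re_inner_apply_ge hA (opInv A v)
  rw [apply_opInv hA, ← inner_conj_symm, Complex.conj_re] at h1
  have h2 := le_norm_opInv_apply hA v
  nlinarith [norm_nonneg v, norm_nonneg (opInv A v)]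

/-- The quadratic form of `1 + A` is minimized, among the vectors with a prescribed scalar product
with `e`, along `(1 + A)⁻¹ e`. -/
theorem inner_sq_le_form (hA : ‖A‖ ≤ 1 / 2) (hs : ∀ u v, ⟪A u, v⟫_ℂ = ⟪u, A v⟫_ℂ) {e v : H}
    (he : e ≠ 0) {c : ℝ} (hv : ⟪e, v⟫_ℂ = c) :
    c ^ 2 / (⟪e, opInv A e⟫_ℂ).re +
      1 / 2 * ‖v - ((c / (⟪e, opInv A e⟫_ℂ).re : ℝ) : ℂ) • opInv A e‖ ^ 2 ≤
        (⟪v, v + A v⟫_ℂ).re := by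
  set γ := (⟪e, opInv A e⟫_ℂ).re with hγ
  have hγ0 : 0 < γ := lt_of_lt_of_le (by positivity) (re_inner_opInv_ge hA e)
  have hγc : ⟪e, opInv A e⟫_ℂ = (γ : ℂ) := by
    have : (⟪e, opInv A e⟫_ℂ).im = 0 := by
      rw [← Complex.conj_eq_iff_im, inner_conj_symm, inner_opInv_left hA hs]
    apply Complex.ext <;> simp [hγ, this]
  set w := ((c / γ : ℝ) : ℂ) • opInv A e with hw
  have hTw : w + A w = ((c / γ : ℝ) : ℂ) • e := by
    rw [hw, map_smul, ← smul_add, apply_opInv hA]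
  -- Completing the square: (1+A)w is a multiple of e, so the cross terms are determined by ⟨e, v⟩ =
  -- c, and the form at v − w is its value at v minus c²/γ.
  have h1 := re_inner_apply_ge hA (v - w)
  have h2 : ⟪v - w, (v - w) + A (v - w)⟫_ℂ = ⟪v, v + A v⟫_ℂ - ((c ^ 2 / γ : ℝ) : ℂ) := by
    have e1 : (v - w) + A (v - w) = (v + A v) - ((c / γ : ℝ) : ℂ) • e := by
      rw [← hTw, map_sub]; abel
    have e2 : ⟪w, v + A v⟫_ℂ = ((c ^ 2 / γ : ℝ) : ℂ) := by
      have : ⟪w, v + A v⟫_ℂ = ⟪w + A w, v⟫_ℂ := by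
        rw [inner_add_right, inner_add_left, hs]
      rw [this, hTw, inner_smul_left, hv, Complex.conj_ofReal]; push_cast; ring
    have e3 : ⟪v, e⟫_ℂ = (c : ℂ) := by rw [← inner_conj_symm, hv, Complex.conj_ofReal]
    have e4 : ⟪w, e⟫_ℂ = (c : ℂ) := by
      rw [hw, inner_smul_left, inner_opInv_left hA hs, hγc, Complex.conj_ofReal,
        ← Complex.ofReal_mul, div_mul_cancel₀ _ hγ0.ne']
    rw [e1, inner_sub_left, inner_sub_right, inner_sub_right, inner_smul_right, inner_smul_right,
      e2, e3, e4]
    push_cast; ring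
  rw [h2, Complex.sub_re, Complex.ofReal_re] at h1
  linarith

end OneAddInverse

/-! ### The Green's function -/

section Green

open scoped ENNReal InnerProductSpace ComplexConjugate ContDiff
open Filter Topology

variable {κ : ℝ}

theorem norm_sand_le_half (hκ : 1 ≤ κ) {q : HMinusOne} (hq : ‖q‖ ≤ 1 / 2) :
    ‖sand κ hκ q‖ ≤ 1 / 2 := (norm_sand_le hκ q).trans hq

theorem star_L2_add (f g : L2) : star (f + g) = star f + star g := by
  apply Lp.ext
  filter_upwards [Lp.coeFn_star (f + g), Lp.coeFn_add f g, Lp.coeFn_add (star f) (star g),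
    Lp.coeFn_star f, Lp.coeFn_star g] with x h1 h2 h3 h4 h5
  simp only [h1, h2, h3, h4, h5, Pi.star_apply, Pi.add_apply, star_add]

theorem star_opInv (hκ : 1 ≤ κ) {q : HMinusOne} (hq : ‖q‖ ≤ 1 / 2) (f : L2) :
    opInv (sand κ hκ q) (star f) = star (opInv (sand κ hκ q) f) := by
  have hA := norm_sand_le_half hκ hq
  symm
  rw [← eq_opInv hA, sand_star, ← star_L2_add, apply_opInv hA]

/-- The integral kernel of the resolvent. -/
def greenKer (κ : ℝ) (hκ : 1 ≤ κ) (q : HMinusOne) (x y : ℝ) : ℝ :=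
  (⟪kerE κ hκ x, opInv (sand κ hκ q) (kerE κ hκ y)⟫_ℂ).re

theorem inner_kerE_opInv (hκ : 1 ≤ κ) {q : HMinusOne} (hq : ‖q‖ ≤ 1 / 2) (x y : ℝ) :
    ⟪kerE κ hκ x, opInv (sand κ hκ q) (kerE κ hκ y)⟫_ℂ = (greenKer κ hκ q x y : ℂ) := by
  have h : (⟪kerE κ hκ x, opInv (sand κ hκ q) (kerE κ hκ y)⟫_ℂ).im = 0 := by
    rw [← Complex.conj_eq_iff_im, ← inner_star_star, ← star_opInv hκ hq, star_kerE, star_kerE]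
  apply Complex.ext <;> simp [greenKer, h]

theorem greenKer_symm (hκ : 1 ≤ κ) {q : HMinusOne} (hq : ‖q‖ ≤ 1 / 2) (x y : ℝ) :
    greenKer κ hκ q x y = greenKer κ hκ q y x := by
  rw [greenKer, ← inner_conj_symm, Complex.conj_re,
    inner_opInv_left (norm_sand_le_half hκ hq) (inner_sand_left hκ q)]
  rfl

theorem continuous_greenKer (hκ : 1 ≤ κ) (q : HMinusOne) :
    Continuous fun p : ℝ × ℝ => greenKer κ hκ q p.1 p.2 := by
  unfold greenKer
  exact Complex.continuous_re.comp (((continuous_kerE hκ).comp continuous_fst).inner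
    ((opInv (sand κ hκ q)).continuous.comp ((continuous_kerE hκ).comp continuous_snd)))

theorem kerE_ne_zero (hκ : 1 ≤ κ) (x : ℝ) : kerE κ hκ x ≠ 0 := by
  have h := norm_kerE_sq hκ x
  intro h0
  rw [h0, norm_zero] at h
  have : 0 < 1 / (2 * κ) := by positivity
  simp at h; linarith

theorem greenKer_self_ge (hκ : 1 ≤ κ) {q : HMinusOne} (hq : ‖q‖ ≤ 1 / 2) (x : ℝ) :
    1 / (9 * κ) ≤ greenKer κ hκ q x x := by
  have h := re_inner_opInv_ge (norm_sand_le_half hκ hq) (kerE κ hκ x)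
  rw [norm_kerE_sq] at h
  refine le_trans (le_of_eq ?_) h
  field_simp

theorem greenKer_self_pos (hκ : 1 ≤ κ) {q : HMinusOne} (hq : ‖q‖ ≤ 1 / 2) (x : ℝ) :
    0 < greenKer κ hκ q x x :=
  lt_of_lt_of_le (by positivity) (greenKer_self_ge hκ hq x)

/-- Every test function in H¹ is √R₀ψ, so with u = √R₀φ the weak equation (L+κ²)u = f reads ⟨ψ,
(1+A)φ⟩ = ⟨ψ, √R₀f⟩ for all ψ. Hence the resolvent is √R₀(1+A)⁻¹√R₀. -/
theorem isSchrodinger_sqrtR0 (hκ : 1 ≤ κ) (q : HMinusOne) (f φ : L2) :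
    IsSchrodinger q (sqrtR0 κ φ) (f - ((κ ^ 2 : ℝ) : ℂ) • sqrtR0 κ φ) ↔
      φ + sand κ hκ q φ = sqrtR0 κ f := by
  have key : ∀ ψ : L2, ⟪derivSqrtR0 κ hκ ψ, derivSqrtR0 κ hκ φ⟫_ℂ +
      q.pairing (fun x => starRingEnd ℂ (sqrtR0 κ ψ x) * sqrtR0 κ φ x) =
      ⟪sqrtR0 κ ψ, f - ((κ ^ 2 : ℝ) : ℂ) • sqrtR0 κ φ⟫_ℂ ↔
      ⟪ψ, φ + sand κ hκ q φ⟫_ℂ = ⟪ψ, sqrtR0 κ f⟫_ℂ := by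
    intro ψ
    rw [← inner_sand hκ, inner_sub_right, inner_smul_right, inner_add_right,
      ← inner_derivSqrtR0_add hκ ψ φ, inner_sqrtR0 hκ ψ f, eq_sub_iff_add_eq]
    constructor <;> intro h <;> rw [← h] <;> ring
  constructor
  · rintro ⟨u', hu', h⟩
    obtain rfl := hu'.unique (hasWeakDeriv_sqrtR0 hκ φ)
    exact ext_inner_left ℂ fun ψ => (key ψ).1 (h _ _ (hasWeakDeriv_sqrtR0 hκ ψ))
  · intro h
    refine ⟨_, hasWeakDeriv_sqrtR0 hκ φ, fun v v' hv => ?_⟩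
    obtain ⟨ψ, rfl⟩ := exists_sqrtR0_eq hκ hv
    obtain rfl := hv.unique (hasWeakDeriv_sqrtR0 hκ ψ)
    exact (key ψ).2 (by rw [h])

theorem isResolvent_sqrtR0 (hκ : 1 ≤ κ) {q : HMinusOne} (hq : ‖q‖ ≤ 1 / 2) (f : L2) :
    IsResolvent κ q f (sqrtR0 κ (opInv (sand κ hκ q) (sqrtR0 κ f))) := by
  have hA := norm_sand_le_half hκ hq
  intro v
  constructor
  · intro h
    obtain ⟨v', hv', -⟩ := id h
    obtain ⟨φ, rfl⟩ := exists_sqrtR0_eq hκ hv'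
    rw [isSchrodinger_sqrtR0 hκ, eq_opInv hA] at h
    rw [h]
  · rintro rfl
    rw [isSchrodinger_sqrtR0 hκ, eq_opInv hA]

theorem greenKer_ae (hκ : 1 ≤ κ) {q : HMinusOne} (hq : ‖q‖ ≤ 1 / 2) (x : ℝ) :
    sqrtR0 κ (opInv (sand κ hκ q) (kerE κ hκ x)) =ᵐ[volume]
      fun y => (greenKer κ hκ q x y : ℂ) := by
  filter_upwards [sqrtR0_ae_inner hκ (opInv (sand κ hκ q) (kerE κ hκ x))] with y hy
  rw [hy, inner_kerE_opInv hκ hq, greenKer_symm hκ hq]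

theorem memLp_greenKer (hκ : 1 ≤ κ) {q : HMinusOne} (hq : ‖q‖ ≤ 1 / 2) (x : ℝ) :
    MemLp (fun y => (greenKer κ hκ q x y : ℂ)) 2 :=
  (memLp_congr_ae (greenKer_ae hκ hq x)).1 (Lp.memLp _)

theorem isGreen_greenKer (hκ : 1 ≤ κ) {q : HMinusOne} (hq : ‖q‖ ≤ 1 / 2) :
    IsGreen κ q (greenKer κ hκ q) := by
  refine ⟨continuous_greenKer hκ q, fun f => ⟨_, isResolvent_sqrtR0 hκ hq f, ?_⟩⟩
  filter_upwards [sqrtR0_ae_inner hκ (opInv (sand κ hκ q) (sqrtR0 κ f))] with x hx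
  refine ⟨(memLp_greenKer hκ hq x).integrable_mul (Lp.memLp f), ?_⟩
  rw [hx, ← inner_opInv_left (norm_sand_le_half hκ hq) (inner_sand_left hκ q), inner_sqrtR0 hκ,
    inner_L2]
  apply integral_congr_ae
  filter_upwards [greenKer_ae hκ hq x] with y hy
  rw [hy, Complex.conj_ofReal]

theorem eq_zero_of_intervalIntegral {f : ℝ → ℝ} (hf : Continuous f)
    (h : ∀ a b, a < b → ∫ x in a..b, f x = 0) (x : ℝ) : f x = 0 := by
  have h1 : HasDerivAt (fun b => ∫ t in (x - 1)..b, f t) (f x) x :=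
    intervalIntegral.integral_hasDerivAt_right (hf.intervalIntegrable _ _)
      hf.stronglyMeasurable.stronglyMeasurableAtFilter hf.continuousAt
  have h2 : (fun b => ∫ t in (x - 1)..b, f t) =ᶠ[𝓝 x] fun _ => 0 := by
    filter_upwards [lt_mem_nhds (show x - 1 < x by linarith)] with b hb
    exact h _ _ hb
  exact h1.unique ((hasDerivAt_const x (0 : ℝ)).congr_of_eventuallyEq h2)

/-- Both kernels give the same resolvent on indicators of intervals. The resulting a.e. identities
in x hold everywhere by continuity, and differentiation in the endpoint recovers the kernels
pointwise. -/
theorem IsGreen.unique {q : HMinusOne} {G G' : ℝ → ℝ → ℝ} (h : IsGreen κ q G)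
    (h' : IsGreen κ q G') : G = G' := by
  have hc : Continuous fun p : ℝ × ℝ => G p.1 p.2 - G' p.1 p.2 := h.continuous.sub h'.continuous
  have key : ∀ a b : ℝ, a < b → ∀ x, ∫ y in a..b, (G x y - G' x y) = 0 := by
    intro a b hab
    have hc1 : Continuous fun x => ∫ y in a..b, (G x y - G' x y) :=
      intervalIntegral.continuous_parametric_intervalIntegral_of_continuous' (by exact hc) a b
    suffices H : (fun x => ∫ y in a..b, (G x y - G' x y)) =ᵐ[volume] fun _ => 0 from
      fun x => congrFun ((hc1.ae_eq_iff_eq volume continuous_const).1 H) x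
    let f : L2 := indicatorConstLp 2 (measurableSet_Ioc (a := a) (b := b))
      (by simp) (1 : ℂ)
    have hf : f =ᵐ[volume] (Set.Ioc a b).indicator fun _ => (1 : ℂ) := indicatorConstLp_coeFn
    obtain ⟨u, hu, hk⟩ := h.kernel f
    obtain ⟨u', hu', hk'⟩ := h'.kernel f
    have huu : u = u' := (hu' u).1 ((hu u).2 rfl)
    subst huu
    filter_upwards [hk, hk'] with x hx hx'
    have h1 : ∫ y, ((G x y : ℂ) * f y - (G' x y : ℂ) * f y) = 0 := by
      rw [integral_sub hx.1 hx'.1, ← hx.2, ← hx'.2, sub_self]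
    have h2 : ∫ y, ((G x y : ℂ) * f y - (G' x y : ℂ) * f y) =
        ((∫ y in a..b, (G x y - G' x y) : ℝ) : ℂ) := by
      rw [intervalIntegral.integral_of_le hab.le, ← integral_indicator measurableSet_Ioc,
        ← integral_complex_ofReal]
      apply integral_congr_ae
      filter_upwards [hf] with y hy
      rw [hy]
      by_cases hm : y ∈ Set.Ioc a b <;> simp [hm]
    rw [h1] at h2
    exact_mod_cast h2.symm
  funext x y
  have hcx : Continuous fun y => G x y - G' x y := hc.comp (by fun_prop : Continuous fun y => (x, y))
  exact sub_eq_zero.1 (eq_zero_of_intervalIntegral hcx (fun a b hab => key a b hab x) y)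

theorem existsUnique_isGreen (hκ : 1 ≤ κ) {q : HMinusOne} (hq : ‖q‖ ≤ 1 / 2) :
    ∃! G : ℝ → ℝ → ℝ, IsGreen κ q G :=
  ⟨_, isGreen_greenKer hκ hq, fun _ h => h.unique (isGreen_greenKer hκ hq)⟩

theorem g_eq (hκ : 1 ≤ κ) {q : HMinusOne} (hq : ‖q‖ ≤ 1 / 2) (x : ℝ) :
    g κ q x = greenKer κ hκ q x x := by
  have h : ∃ G, IsGreen κ q G := ⟨_, isGreen_greenKer hκ hq⟩
  have : green κ q = greenKer κ hκ q := by
    rw [green, dif_pos h]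
    exact h.choose_spec.unique (isGreen_greenKer hκ hq)
  rw [g, this]

theorem rho_eq (hκ : 1 ≤ κ) {q : HMinusOne} (hq : ‖q‖ ≤ 1 / 2) (x : ℝ) :
    rho κ q x = κ - 1 / (2 * greenKer κ hκ q x x) +
      2 * κ ^ 2 * (⟪kerE κ hκ x, sand κ hκ q (kerE κ hκ x)⟫_ℂ).re := by
  rw [rho, g_eq hκ hq, expConv_eq hκ]; ring

end Green

/-! ### The density `ρ` -/

section Density

open scoped ENNReal InnerProductSpace ComplexConjugate ContDiff
open Filter Topology

variable {κ : ℝ}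

/-- The minimizer `(1 + A)⁻¹ E_x / ⟪E_x, (1 + A)⁻¹ E_x⟫`. -/
def minVec (κ : ℝ) (hκ : 1 ≤ κ) (q : HMinusOne) (x : ℝ) : L2 :=
  (((1 / greenKer κ hκ q x x : ℝ)) : ℂ) • opInv (sand κ hκ q) (kerE κ hκ x)

/-- The subgradient of `q ↦ ρ(x; κ, q)` at `p`, applied to `h`. -/
def subgrad (κ : ℝ) (hκ : 1 ≤ κ) (p h : HMinusOne) (x : ℝ) : ℝ :=
  2 * κ ^ 2 * (⟪kerE κ hκ x, sand κ hκ h (kerE κ hκ x)⟫_ℂ).re -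
    1 / 2 * (⟪minVec κ hκ p x, sand κ hκ h (minVec κ hκ p x)⟫_ℂ).re

theorem subgrad_add (hκ : 1 ≤ κ) (p h h' : HMinusOne) (x : ℝ) :
    subgrad κ hκ p (h + h') x = subgrad κ hκ p h x + subgrad κ hκ p h' x := by
  simp only [subgrad, sand_add, add_apply, inner_add_right, Complex.add_re]; ring

theorem subgrad_smul (hκ : 1 ≤ κ) (p h : HMinusOne) (c x : ℝ) :
    subgrad κ hκ p (c • h) x = c * subgrad κ hκ p h x := by
  simp only [subgrad, sand_smul, smul_apply, inner_smul_right, Complex.re_ofReal_mul]; ring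

theorem inner_kerE_minVec (hκ : 1 ≤ κ) {q : HMinusOne} (hq : ‖q‖ ≤ 1 / 2) (x : ℝ) :
    ⟪kerE κ hκ x, minVec κ hκ q x⟫_ℂ = (1 : ℝ) := by
  have := (greenKer_self_pos hκ hq x).ne'
  rw [minVec, inner_smul_right, inner_kerE_opInv hκ hq, ← Complex.ofReal_mul,
    one_div_mul_cancel this]

theorem minVec_form (hκ : 1 ≤ κ) {q : HMinusOne} (hq : ‖q‖ ≤ 1 / 2) (x : ℝ) :
    (⟪minVec κ hκ q x, minVec κ hκ q x + sand κ hκ q (minVec κ hκ q x)⟫_ℂ).re =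
      1 / greenKer κ hκ q x x := by
  have h : minVec κ hκ q x + sand κ hκ q (minVec κ hκ q x) =
      (((1 / greenKer κ hκ q x x : ℝ)) : ℂ) • kerE κ hκ x := by
    rw [minVec, map_smul, ← smul_add, apply_opInv (norm_sand_le_half hκ hq)]
  rw [h, inner_smul_right, ← inner_conj_symm, inner_kerE_minVec hκ hq, Complex.re_ofReal_mul]
  simp

/-- The minimizer for p is a competitor in the variational problem for q, where the form differs by
the linear term ⟨v, A_{q−p}v⟩. Coercivity contributes the remainder (1/2)‖·‖², halved because ρ
contains −1/(2g). -/
theorem rho_subgrad (hκ : 1 ≤ κ) {p q : HMinusOne} (hp : ‖p‖ ≤ 1 / 2) (hq : ‖q‖ ≤ 1 / 2) (x : ℝ) :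
    rho κ p x + subgrad κ hκ p (q - p) x + 1 / 4 * ‖minVec κ hκ p x - minVec κ hκ q x‖ ^ 2 ≤
      rho κ q x := by
  have h := inner_sq_le_form (norm_sand_le_half hκ hq) (inner_sand_left hκ q) (kerE_ne_zero hκ x)
    (inner_kerE_minVec hκ hp x)
  have h1 := minVec_form hκ hp x
  have hs : sand κ hκ q = sand κ hκ p + sand κ hκ (q - p) := by
    rw [← sand_add, add_sub_cancel]
  have e : ⟪kerE κ hκ x, sand κ hκ q (kerE κ hκ x)⟫_ℂ = ⟪kerE κ hκ x, sand κ hκ p (kerE κ hκ x)⟫_ℂ +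
      ⟪kerE κ hκ x, sand κ hκ (q - p) (kerE κ hκ x)⟫_ℂ := by
    rw [hs, add_apply, inner_add_right]
  have e2 : ⟪minVec κ hκ p x, minVec κ hκ p x + sand κ hκ q (minVec κ hκ p x)⟫_ℂ =
      ⟪minVec κ hκ p x, minVec κ hκ p x + sand κ hκ p (minVec κ hκ p x)⟫_ℂ +
      ⟪minVec κ hκ p x, sand κ hκ (q - p) (minVec κ hκ p x)⟫_ℂ := by
    rw [hs, add_apply, ← add_assoc, inner_add_right _ (_ + _)]
  have hg : (⟪kerE κ hκ x, opInv (sand κ hκ q) (kerE κ hκ x)⟫_ℂ).re = greenKer κ hκ q x x := rfl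
  have hm : (((1 / greenKer κ hκ q x x : ℝ)) : ℂ) • opInv (sand κ hκ q) (kerE κ hκ x) =
    minVec κ hκ q x := rfl
  rw [e2, Complex.add_re, h1, hg, hm, one_pow] at h
  rw [rho_eq hκ hp, rho_eq hκ hq, subgrad, e, Complex.add_re]
  have h2 : ∀ r : ℝ, 1 / (2 * r) = 1 / 2 * (1 / r) := fun r => by rw [one_div_mul_one_div]
  rw [h2, h2]
  nlinarith

theorem opInv_zero {H : Type*} [NormedAddCommGroup H] [InnerProductSpace ℂ H] [CompleteSpace H] :
    opInv (0 : H →L[ℂ] H) = 1 := by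
  rw [opInv, add_zero, Ring.inverse_one]

theorem sand_zero (hκ : 1 ≤ κ) : sand κ hκ 0 = 0 := by
  have := sand_smul hκ 0 0
  simpa using this

theorem greenKer_zero (hκ : 1 ≤ κ) (x : ℝ) : greenKer κ hκ 0 x x = 1 / (2 * κ) := by
  rw [greenKer, sand_zero, opInv_zero, one_apply_eq_self, inner_kerE_kerE]
  simp

theorem minVec_zero (hκ : 1 ≤ κ) (x : ℝ) :
    minVec κ hκ 0 x = ((2 * κ : ℝ) : ℂ) • kerE κ hκ x := by
  rw [minVec, greenKer_zero, sand_zero, opInv_zero, one_apply_eq_self, one_div_one_div]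

theorem rho_zero (hκ : 1 ≤ κ) (x : ℝ) : rho κ 0 x = 0 := by
  rw [rho_eq hκ (by simp), greenKer_zero, sand_zero]
  simp; field_simp; ring

/-- The minimizer at 0 is 2κE_x, so the two quadratic expressions cancel. The linear term in the
definition of ρ is there for this cancellation, and nonnegativity of ρ follows from it. -/
theorem subgrad_zero (hκ : 1 ≤ κ) (h : HMinusOne) (x : ℝ) : subgrad κ hκ 0 h x = 0 := by
  rw [subgrad, minVec_zero, map_smul, inner_smul_left, inner_smul_right, ← mul_assoc,
    Complex.conj_ofReal, ← Complex.ofReal_mul, Complex.re_ofReal_mul]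
  ring

theorem rho_nonneg (hκ : 1 ≤ κ) {q : HMinusOne} (hq : ‖q‖ ≤ 1 / 2) (x : ℝ) : 0 ≤ rho κ q x := by
  have h := rho_subgrad hκ (p := 0) (by simp) hq x
  rw [rho_zero hκ, subgrad_zero] at h
  have : 0 ≤ ‖minVec κ hκ 0 x - minVec κ hκ q x‖ ^ 2 := by positivity
  linarith

theorem norm_convex_comb {p q : HMinusOne} {r : ℝ} (hp : ‖p‖ ≤ r) (hq : ‖q‖ ≤ r) {a b : ℝ}
    (ha : 0 ≤ a) (hb : 0 ≤ b) (hab : a + b = 1) : ‖a • p + b • q‖ ≤ r := by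
  have := (convex_closedBall (0 : HMinusOne) r) (mem_closedBall_zero_iff.2 hp)
    (mem_closedBall_zero_iff.2 hq) ha hb hab
  exact mem_closedBall_zero_iff.1 this

/-- The subgradient inequality at the convex combination, averaged over p and q. The quadratic
remainders are kept because strict convexity of α depends on them. -/
theorem rho_convex_gap (hκ : 1 ≤ κ) {p q : HMinusOne} (hp : ‖p‖ ≤ 1 / 2) (hq : ‖q‖ ≤ 1 / 2)
    {a b : ℝ} (ha : 0 ≤ a) (hb : 0 ≤ b) (hab : a + b = 1) (x : ℝ) :
    rho κ (a • p + b • q) x +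
      (a * (1 / 4 * ‖minVec κ hκ (a • p + b • q) x - minVec κ hκ p x‖ ^ 2) +
        b * (1 / 4 * ‖minVec κ hκ (a • p + b • q) x - minVec κ hκ q x‖ ^ 2)) ≤
      a * rho κ p x + b * rho κ q x := by
  have hr := norm_convex_comb hp hq ha hb hab
  set r := a • p + b • q with hrdef
  have h1 := mul_le_mul_of_nonneg_left (rho_subgrad hκ hr hp x) ha
  have h2 := mul_le_mul_of_nonneg_left (rho_subgrad hκ hr hq x) hb
  have h3 : a * subgrad κ hκ r (p - r) x + b * subgrad κ hκ r (q - r) x = 0 := by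
    rw [← subgrad_smul, ← subgrad_smul, ← subgrad_add]
    have : a • (p - r) + b • (q - r) = (0 : ℝ) • (0 : HMinusOne) := by
      rw [zero_smul, smul_sub, smul_sub, sub_add_sub_comm, ← add_smul, hab, one_smul, hrdef,
        sub_self]
    rw [this, subgrad_smul, zero_mul]
  have h4 : a * rho κ r x + b * rho κ r x = rho κ r x := by rw [← add_mul, hab, one_mul]
  linarith

theorem convexOn_rho (hκ : 1 ≤ κ) {δ : ℝ} (hδ : δ ≤ 1 / 2) (x : ℝ) :
    ConvexOn ℝ (Metric.closedBall (0 : HMinusOne) δ) fun q => rho κ q x := by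
  refine ⟨convex_closedBall _ _, fun p hp q hq a b ha hb hab => ?_⟩
  have h := rho_convex_gap hκ ((mem_closedBall_zero_iff.1 hp).trans hδ)
    ((mem_closedBall_zero_iff.1 hq).trans hδ) ha hb hab x
  simp only [smul_eq_mul]
  refine le_trans (le_add_of_nonneg_right ?_) h
  positivity

theorem continuous_greenKer_self (hκ : 1 ≤ κ) (q : HMinusOne) :
    Continuous fun x => greenKer κ hκ q x x := by
  unfold greenKer
  exact Complex.continuous_re.comp ((continuous_kerE hκ).inner
    ((opInv (sand κ hκ q)).continuous.comp (continuous_kerE hκ)))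

theorem continuous_rho (hκ : 1 ≤ κ) {q : HMinusOne} (hq : ‖q‖ ≤ 1 / 2) :
    Continuous (rho κ q) := by
  have h1 : Continuous fun x => 1 / (2 * greenKer κ hκ q x x) :=
    continuous_const.div (continuous_const.mul (continuous_greenKer_self hκ q))
      fun x => (mul_pos two_pos (greenKer_self_pos hκ hq x)).ne'
  have h2 : Continuous fun x => (⟪kerE κ hκ x, sand κ hκ q (kerE κ hκ x)⟫_ℂ).re :=
    Complex.continuous_re.comp ((continuous_kerE hκ).inner
      ((sand κ hκ q).continuous.comp (continuous_kerE hκ)))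
  have e : rho κ q = fun x => κ - 1 / (2 * greenKer κ hκ q x x) +
      2 * κ ^ 2 * (⟪kerE κ hκ x, sand κ hκ q (kerE κ hκ x)⟫_ℂ).re := funext (rho_eq hκ hq)
  rw [e]
  exact (continuous_const.sub h1).add (continuous_const.mul h2)

theorem opInv_sub_self (hκ : 1 ≤ κ) {q : HMinusOne} (hq : ‖q‖ ≤ 1 / 2) (f : L2) :
    opInv (sand κ hκ q) f - f = -opInv (sand κ hκ q) (sand κ hκ q f) := by
  have hA := norm_sand_le_half hκ hq
  have := opInv_apply hA f
  rw [map_add] at this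
  nth_rewrite 2 [← this]
  abel

theorem norm_opInv_sub_self_le (hκ : 1 ≤ κ) {q : HMinusOne} (hq : ‖q‖ ≤ 1 / 2) (f : L2) :
    ‖opInv (sand κ hκ q) f - f‖ ≤ 2 * ‖sand κ hκ q f‖ := by
  rw [opInv_sub_self hκ hq, norm_neg]
  exact norm_opInv_apply_le (norm_sand_le_half hκ hq) _

theorem norm_minVec_sub_le (hκ : 1 ≤ κ) {q : HMinusOne} (hq : ‖q‖ ≤ 1 / 2) (x : ℝ) :
    ‖minVec κ hκ q x - ((2 * κ : ℝ) : ℂ) • kerE κ hκ x‖ ≤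
      54 * κ ^ 2 * ‖sand κ hκ q (kerE κ hκ x)‖ := by
  have hκ0 : 0 < κ := by linarith
  set γ := greenKer κ hκ q x x with hγ
  set e := kerE κ hκ x with he
  have hγ0 : 0 < γ := greenKer_self_pos hκ hq x
  have hγ1 : 1 / γ ≤ 9 * κ := by
    have := greenKer_self_ge hκ hq x
    rw [one_div_le hγ0 (by positivity)]; exact this
  have h1 := norm_opInv_sub_self_le hκ hq e
  have he1 : ‖e‖ ≤ 1 := norm_kerE_le_one hκ x
  have h2 : |2 * κ * γ - 1| ≤ 4 * κ * ‖sand κ hκ q e‖ := by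
    have e1 : 2 * κ * γ - 1 = 2 * κ * (⟪e, opInv (sand κ hκ q) e - e⟫_ℂ).re := by
      have e2 : (⟪e, e⟫_ℂ).re = 1 / (2 * κ) := by
        rw [← norm_kerE_sq hκ x]; exact inner_self_eq_norm_sq (𝕜 := ℂ) e
      rw [inner_sub_right, Complex.sub_re, e2]
      have : (⟪e, opInv (sand κ hκ q) e⟫_ℂ).re = γ := rfl
      rw [this]; field_simp
    rw [e1, abs_mul, abs_of_pos (by positivity : 0 < 2 * κ)]
    have h3 : |(⟪e, opInv (sand κ hκ q) e - e⟫_ℂ).re| ≤ 1 * (2 * ‖sand κ hκ q e‖) :=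
      (Complex.abs_re_le_norm _).trans ((norm_inner_le_norm _ _).trans
        (mul_le_mul he1 h1 (norm_nonneg _) zero_le_one))
    nlinarith
  have h4 : minVec κ hκ q x - ((2 * κ : ℝ) : ℂ) • e =
      ((1 / γ : ℝ) : ℂ) • ((opInv (sand κ hκ q) e - e) - ((2 * κ * γ - 1 : ℝ) : ℂ) • e) := by
    have e1 : ((2 * κ : ℝ) : ℂ) • e = ((1 / γ : ℝ) : ℂ) • (e + ((2 * κ * γ - 1 : ℝ) : ℂ) • e) := by
      rw [smul_add, smul_smul, ← add_smul, ← Complex.ofReal_mul, ← Complex.ofReal_add]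
      congr 2; field_simp; ring
    rw [e1, minVec, ← smul_sub]
    congr 1; abel
  rw [h4, norm_smul, Complex.norm_real, Real.norm_of_nonneg (by positivity)]
  -- The two terms contribute 2 and 4κ, and 2 + 4κ ≤ 6κ because κ ≥ 1.
  have h5 : ‖(opInv (sand κ hκ q) e - e) - ((2 * κ * γ - 1 : ℝ) : ℂ) • e‖ ≤
      6 * κ * ‖sand κ hκ q e‖ := by
    refine (norm_sub_le _ _).trans ?_
    rw [norm_smul, Complex.norm_real, Real.norm_eq_abs]
    have h6 : |2 * κ * γ - 1| * ‖e‖ ≤ 4 * κ * ‖sand κ hκ q e‖ :=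
      (mul_le_of_le_one_right (abs_nonneg _) he1).trans h2
    nlinarith [norm_nonneg (sand κ hκ q e)]
  calc 1 / γ * _ ≤ 9 * κ * (6 * κ * ‖sand κ hκ q e‖) := by gcongr
    _ = _ := by ring

theorem re_inner_form_sub_le {H : Type*} [NormedAddCommGroup H] [InnerProductSpace ℂ H]
    {A : H →L[ℂ] H} (hs : ∀ u v, ⟪A u, v⟫_ℂ = ⟪u, A v⟫_ℂ) (u v : H) :
    |(⟪u, A u⟫_ℂ).re - (⟪v, A v⟫_ℂ).re| ≤ (‖u‖ + ‖v‖) * ‖A (u - v)‖ := by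
  have e : ⟪u, A u⟫_ℂ - ⟪v, A v⟫_ℂ = ⟪A (u - v), u⟫_ℂ + ⟪v, A (u - v)⟫_ℂ := by
    rw [hs, map_sub, inner_sub_left, inner_sub_right]; ring
  rw [← Complex.sub_re, e]
  refine (Complex.abs_re_le_norm _).trans ((norm_add_le _ _).trans ?_)
  have h1 := norm_inner_le_norm (𝕜 := ℂ) (A (u - v)) u
  have h2 := norm_inner_le_norm (𝕜 := ℂ) v (A (u - v))
  linarith

theorem re_inner_form_sub_le' {H : Type*} [NormedAddCommGroup H] [InnerProductSpace ℂ H]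
    {A : H →L[ℂ] H} (hs : ∀ u v, ⟪A u, v⟫_ℂ = ⟪u, A v⟫_ℂ) (u v : H) :
    |(⟪u, A u⟫_ℂ).re - (⟪v, A v⟫_ℂ).re| ≤ ‖u - v‖ * (‖A u‖ + ‖A v‖) := by
  have e : ⟪u, A u⟫_ℂ - ⟪v, A v⟫_ℂ = ⟪u - v, A u⟫_ℂ + ⟪A v, u - v⟫_ℂ := by
    rw [hs, map_sub, inner_sub_left, inner_sub_right]; ring
  rw [← Complex.sub_re, e]
  refine (Complex.abs_re_le_norm _).trans ((norm_add_le _ _).trans ?_)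
  have h1 := norm_inner_le_norm (𝕜 := ℂ) (u - v) (A u)
  have h2 := norm_inner_le_norm (𝕜 := ℂ) (A v) (u - v)
  linarith

/-- The subgradient inequality from q to 0 bounds ρ(q) by half the difference of the form of A at u
= 2κE_x and at the minimizer v. That difference is at most ‖u−v‖(‖Au‖+‖Av‖), and both factors are
O(‖A E_x‖), so the bound is quadratic. -/
theorem exists_rho_le (hκ : 1 ≤ κ) : ∃ C : ℝ, 0 ≤ C ∧ ∀ q : HMinusOne, ‖q‖ ≤ 1 / 2 →
    ∀ x, rho κ q x ≤ C * ‖sand κ hκ q (kerE κ hκ x)‖ ^ 2 := by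
  have hκ0 : 0 < κ := by linarith
  refine ⟨27 * κ ^ 2 * (4 * κ + 27 * κ ^ 2), by positivity, fun q hq x => ?_⟩
  have h := rho_subgrad hκ hq (q := 0) (by simp) x
  rw [rho_zero hκ, zero_sub, show -q = (-1 : ℝ) • q by simp, subgrad_smul] at h
  have h0 : 0 ≤ ‖minVec κ hκ q x - minVec κ hκ 0 x‖ ^ 2 := by positivity
  have h1 := norm_minVec_sub_le hκ hq x
  set e := kerE κ hκ x
  set A := sand κ hκ q
  set v := minVec κ hκ q x
  set u := ((2 * κ : ℝ) : ℂ) • e with hu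
  have h2 : subgrad κ hκ q q x = 1 / 2 * ((⟪u, A u⟫_ℂ).re - (⟪v, A v⟫_ℂ).re) := by
    have : (⟪u, A u⟫_ℂ).re = 4 * κ ^ 2 * (⟪e, A e⟫_ℂ).re := by
      rw [hu, map_smul, inner_smul_left, inner_smul_right, ← mul_assoc,
        Complex.conj_ofReal, ← Complex.ofReal_mul, Complex.re_ofReal_mul]
      ring
    rw [this, subgrad]; ring
  have h3 := (abs_le.1 (re_inner_form_sub_le' (inner_sand_left hκ q) u v)).2
  have h4 : ‖A u‖ = 2 * κ * ‖A e‖ := by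
    rw [hu, map_smul, norm_smul, Complex.norm_real, Real.norm_of_nonneg (by positivity)]
  have h5 : ‖A v‖ ≤ ‖A u‖ + 1 / 2 * ‖v - u‖ := by
    have e1 : A v = A u + A (v - u) := by rw [map_sub]; abel
    have := norm_apply_le (norm_sand_le_half hκ hq) (v - u)
    rw [e1]
    exact (norm_add_le _ _).trans (by linarith)
  rw [norm_sub_rev] at h3
  have h6 : ‖A u‖ + ‖A v‖ ≤ (4 * κ + 27 * κ ^ 2) * ‖A e‖ := by linarith
  have h7 : ‖v - u‖ * (‖A u‖ + ‖A v‖) ≤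
      (54 * κ ^ 2 * ‖A e‖) * ((4 * κ + 27 * κ ^ 2) * ‖A e‖) := by gcongr
  nlinarith

theorem lintegral_sand_kerE (hκ : 1 ≤ κ) (q : HMinusOne) :
    ∫⁻ x, ‖sand κ hκ q (kerE κ hκ x)‖ₑ ^ 2 < ⊤ := by
  obtain ⟨w, b, -⟩ := exists_hilbertBasis ℂ L2
  refine lt_of_le_of_lt (lintegral_apply_kerE hκ (sand κ hκ q) b) ?_
  rw [hsSq_sand]; exact ENNReal.ofReal_lt_top

theorem integrable_sq_sand_kerE (hκ : 1 ≤ κ) (q : HMinusOne) :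
    Integrable fun x => ‖sand κ hκ q (kerE κ hκ x)‖ ^ 2 := by
  refine ⟨(((sand κ hκ q).continuous.comp (continuous_kerE hκ)).norm.pow 2).aestronglyMeasurable,
    lt_of_le_of_lt (le_of_eq ?_) (lintegral_sand_kerE hκ q)⟩
  congr 1; ext x
  rw [enorm_pow, enorm_norm]

theorem integrable_rho (hκ : 1 ≤ κ) {q : HMinusOne} (hq : ‖q‖ ≤ 1 / 2) :
    Integrable (rho κ q) := by
  obtain ⟨C, -, h⟩ := exists_rho_le hκ
  refine ((integrable_sq_sand_kerE hκ q).const_mul C).mono'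
    (continuous_rho hκ hq).aestronglyMeasurable (Eventually.of_forall fun x => ?_)
  rw [Real.norm_of_nonneg (rho_nonneg hκ hq x)]
  exact h q hq x

/-- As ‖E_x‖ does not depend on x, differences of g involve only (1+A)⁻¹ − 1, which is bounded by
2‖A·‖ vector by vector. Every difference is therefore controlled by A(E_x − E_y), to which the
translation estimate applies. -/
theorem exists_rho_sub_le (hκ : 1 ≤ κ) {q : HMinusOne} (hq : ‖q‖ ≤ 1 / 2) :
    ∃ C : ℝ, 0 ≤ C ∧ ∀ x y, |rho κ q x - rho κ q y| ≤
      C * ‖sand κ hκ q (kerE κ hκ x - kerE κ hκ y)‖ := by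
  have hκ0 : 0 < κ := by linarith
  refine ⟨162 * κ ^ 2 + 4 * κ ^ 2, by positivity, fun x y => ?_⟩
  set u := kerE κ hκ x
  set v := kerE κ hκ y
  set A := sand κ hκ q
  have hA : ‖A‖ ≤ 1 / 2 := norm_sand_le_half hκ hq
  have hu : ‖u‖ ≤ 1 := norm_kerE_le_one hκ x
  have hv : ‖v‖ ≤ 1 := norm_kerE_le_one hκ y
  have h1 := re_inner_form_sub_le (inner_sand_left hκ q) u v
  have h1' : |(⟪u, A u⟫_ℂ).re - (⟪v, A v⟫_ℂ).re| ≤ 2 * ‖A (u - v)‖ :=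
    h1.trans (by gcongr; linarith)
  have hB : ∀ a b, ⟪(opInv A - 1) a, b⟫_ℂ = ⟪a, (opInv A - 1) b⟫_ℂ := fun a b => by
    rw [sub_apply, sub_apply, inner_sub_left, inner_sub_right,
      inner_opInv_left hA (inner_sand_left hκ q)]; rfl
  have h2 := re_inner_form_sub_le hB u v
  have h3 : ‖(opInv A - 1) (u - v)‖ ≤ 2 * ‖A (u - v)‖ := norm_opInv_sub_self_le hκ hq (u - v)
  have huv : (⟪u, u⟫_ℂ).re = (⟪v, v⟫_ℂ).re := by
    have e1 : (⟪u, u⟫_ℂ).re = ‖u‖ ^ 2 := inner_self_eq_norm_sq (𝕜 := ℂ) u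
    have e2 : (⟪v, v⟫_ℂ).re = ‖v‖ ^ 2 := inner_self_eq_norm_sq (𝕜 := ℂ) v
    rw [e1, e2, norm_kerE_sq, norm_kerE_sq]
  have h4 : (⟪u, (opInv A - 1) u⟫_ℂ).re - (⟪v, (opInv A - 1) v⟫_ℂ).re =
      greenKer κ hκ q x x - greenKer κ hκ q y y := by
    rw [sub_apply, sub_apply, inner_sub_right, inner_sub_right, Complex.sub_re, Complex.sub_re,
      one_apply_eq_self, one_apply_eq_self, huv]
    unfold greenKer; ring
  rw [h4] at h2
  have h2' : |greenKer κ hκ q x x - greenKer κ hκ q y y| ≤ 4 * ‖A (u - v)‖ :=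
    h2.trans (by nlinarith [norm_nonneg ((opInv A - 1) (u - v)), norm_nonneg u, norm_nonneg v])
  have hx0 := greenKer_self_pos hκ hq x
  have hy0 := greenKer_self_pos hκ hq y
  have hx1 := greenKer_self_ge hκ hq x
  have hy1 := greenKer_self_ge hκ hq y
  set γ := greenKer κ hκ q x x
  set γ' := greenKer κ hκ q y y
  have h5 : |1 / (2 * γ') - 1 / (2 * γ)| ≤ 162 * κ ^ 2 * ‖A (u - v)‖ := by
    have e1 : 1 / (2 * γ') - 1 / (2 * γ) = (γ - γ') * (1 / 2 * ((1 / γ) * (1 / γ'))) := by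
      field_simp
    have e2 : 1 / γ ≤ 9 * κ := by rwa [one_div_le hx0 (by positivity)]
    have e3 : 1 / γ' ≤ 9 * κ := by rwa [one_div_le hy0 (by positivity)]
    rw [e1, abs_mul, abs_of_pos (show 0 < 1 / 2 * ((1 / γ) * (1 / γ')) by positivity)]
    calc _ ≤ (4 * ‖A (u - v)‖) * (1 / 2 * ((9 * κ) * (9 * κ))) := by gcongr
      _ = _ := by ring
  rw [rho_eq hκ hq, rho_eq hκ hq]
  have e : κ - 1 / (2 * γ) + 2 * κ ^ 2 * (⟪u, A u⟫_ℂ).re -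
      (κ - 1 / (2 * γ') + 2 * κ ^ 2 * (⟪v, A v⟫_ℂ).re) = (1 / (2 * γ') - 1 / (2 * γ)) +
      2 * κ ^ 2 * ((⟪u, A u⟫_ℂ).re - (⟪v, A v⟫_ℂ).re) := by ring
  rw [e]
  refine (abs_add_le _ _).trans ?_
  rw [abs_mul, abs_of_pos (show 0 < 2 * κ ^ 2 by positivity)]
  have : 2 * κ ^ 2 * |(⟪u, A u⟫_ℂ).re - (⟪v, A v⟫_ℂ).re| ≤ 2 * κ ^ 2 * (2 * ‖A (u - v)‖) := by
    gcongr
  linarith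

theorem memLp_rho (hκ : 1 ≤ κ) {q : HMinusOne} (hq : ‖q‖ ≤ 1 / 2) :
    MemLp (fun x => (rho κ q x : ℂ)) 2 := by
  obtain ⟨C, hC, h⟩ := exists_rho_le hκ
  have hm : MemLp (fun x => sand κ hκ q (kerE κ hκ x)) 2 := by
    refine ⟨((sand κ hκ q).continuous.comp (continuous_kerE hκ)).aestronglyMeasurable,
      (eLpNorm_lt_top_iff_lintegral_rpow_enorm_lt_top (by norm_num) (by norm_num)).2 ?_⟩
    simp only [ENNReal.toReal_ofNat, ENNReal.rpow_ofNat]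
    exact lintegral_sand_kerE hκ q
  refine hm.of_le_mul (c := C) (Complex.continuous_ofReal.comp
    (continuous_rho hκ hq)).aestronglyMeasurable (Eventually.of_forall fun x => ?_)
  rw [Complex.norm_real, Real.norm_of_nonneg (rho_nonneg hκ hq x)]
  refine (h q hq x).trans (mul_le_mul_of_nonneg_left ?_ hC)
  have h1 := norm_apply_le (norm_sand_le_half hκ hq) (kerE κ hκ x)
  have h2 := norm_kerE_le_one hκ x
  have h3 : ‖sand κ hκ q (kerE κ hκ x)‖ ≤ 1 := by linarith
  nlinarith [norm_nonneg (sand κ hκ q (kerE κ hκ x))]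

theorem memH1_rho (hκ : 1 ≤ κ) {q : HMinusOne} (hq : ‖q‖ ≤ 1 / 2) :
    MemH1 (fun x => (rho κ q x : ℂ)) := by
  obtain ⟨C, hC, h⟩ := exists_rho_sub_le hκ hq
  obtain ⟨w, b, -⟩ := exists_hilbertBasis ℂ L2
  have hfin : hsSq b (sand κ hκ q) ≠ ⊤ := by rw [hsSq_sand]; exact ENNReal.ofReal_ne_top
  refine memH1_of_translate (memLp_rho hκ hq)
    (C := ENNReal.ofReal C ^ 2 * hsSq b (sand κ hκ q)) ?_ fun t => ?_
  · exact ENNReal.mul_ne_top (by simp) hfin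
  · have h1 : ∀ x, ‖((rho κ q (x + t) : ℝ) : ℂ) - (rho κ q x : ℂ)‖ₑ ^ 2 ≤
        ENNReal.ofReal C ^ 2 * ‖sand κ hκ q (kerE κ hκ (x + t) - kerE κ hκ x)‖ₑ ^ 2 := by
      intro x
      rw [← mul_pow]
      gcongr
      rw [← Complex.ofReal_sub, ← ofReal_norm, ← ofReal_norm, ← ENNReal.ofReal_mul hC,
        Complex.norm_real]
      exact ENNReal.ofReal_le_ofReal (h _ _)
    calc _ ≤ ∫⁻ x, ENNReal.ofReal C ^ 2 *
          ‖sand κ hκ q (kerE κ hκ (x + t) - kerE κ hκ x)‖ₑ ^ 2 := lintegral_mono h1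
      _ = ENNReal.ofReal C ^ 2 *
          ∫⁻ x, ‖sand κ hκ q (kerE κ hκ (x + t) - kerE κ hκ x)‖ₑ ^ 2 :=
        lintegral_const_mul' _ _ (by simp)
      _ ≤ ENNReal.ofReal C ^ 2 * (‖t‖ₑ ^ 2 * hsSq b (sand κ hκ q)) := by
        gcongr; exact lintegral_apply_kerE_sub hκ t _ b
      _ = _ := by ring

theorem alpha_nonneg (hκ : 1 ≤ κ) {q : HMinusOne} (hq : ‖q‖ ≤ 1 / 2) : 0 ≤ alpha κ q :=
  integral_nonneg (rho_nonneg hκ hq)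

theorem exists_alpha_le (hκ : 1 ≤ κ) :
    ∃ C : ℝ, ∀ q : HMinusOne, ‖q‖ ≤ 1 / 2 → alpha κ q ≤ C := by
  obtain ⟨C, hC, h⟩ := exists_rho_le hκ
  refine ⟨C * 1, fun q hq => ?_⟩
  have hi := integrable_sq_sand_kerE hκ q
  refine (integral_mono (integrable_rho hκ hq) (hi.const_mul C) (h q hq)).trans ?_
  rw [integral_const_mul]
  refine mul_le_mul_of_nonneg_left ?_ hC
  obtain ⟨w, b, -⟩ := exists_hilbertBasis ℂ L2
  have h1 := lintegral_apply_kerE hκ (sand κ hκ q) b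
  rw [hsSq_sand] at h1
  have h2 : ∫⁻ x, ‖sand κ hκ q (kerE κ hκ x)‖ₑ ^ 2 =
      ENNReal.ofReal (∫ x, ‖sand κ hκ q (kerE κ hκ x)‖ ^ 2) := by
    rw [ofReal_integral_eq_lintegral_ofReal hi (Eventually.of_forall fun x => sq_nonneg _)]
    congr 1; ext x
    rw [ENNReal.ofReal_pow (norm_nonneg _), ofReal_norm]
  rw [h2, ENNReal.ofReal_le_ofReal_iff (hsInt_nonneg hκ q)] at h1
  nlinarith [hsInt_le hκ q, norm_nonneg q]

theorem convexOn_alpha (hκ : 1 ≤ κ) {δ : ℝ} (hδ : δ ≤ 1 / 2) :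
    ConvexOn ℝ (Metric.closedBall (0 : HMinusOne) δ) (alpha κ) := by
  refine ⟨convex_closedBall _ _, fun p hp q hq a b ha hb hab => ?_⟩
  have hp' := (mem_closedBall_zero_iff.1 hp).trans hδ
  have hq' := (mem_closedBall_zero_iff.1 hq).trans hδ
  simp only [smul_eq_mul, alpha]
  rw [← integral_const_mul, ← integral_const_mul, ← integral_add
    ((integrable_rho hκ hp').const_mul a) ((integrable_rho hκ hq').const_mul b)]
  refine integral_mono (integrable_rho hκ (norm_convex_comb hp' hq' ha hb hab))
    (((integrable_rho hκ hp').const_mul a).add ((integrable_rho hκ hq').const_mul b)) fun x => ?_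
  exact (convexOn_rho hκ hδ x).2 hp hq ha hb hab

end Density

/-! ### Strict convexity -/

section StrictConvexity

open scoped ENNReal InnerProductSpace ComplexConjugate ContDiff
open Filter Topology

variable {κ : ℝ}

/-- Equal minimizers make (1+A_p)⁻¹E_x and (1+A_q)⁻¹E_x proportional with a factor c(x). Symmetry of
G gives c(x) = c(y) wherever G(x,y) ≠ 0, in particular near the diagonal, so c is locally constant
and hence constant. It remains to show c = 1. -/
theorem eq_of_minVec_eq (hκ : 1 ≤ κ) {p q : HMinusOne} (hp : ‖p‖ ≤ 1 / 2) (hq : ‖q‖ ≤ 1 / 2)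
    (h : ∀ x, minVec κ hκ p x = minVec κ hκ q x) : p = q := by
  have hAp := norm_sand_le_half hκ hp
  have hAq := norm_sand_le_half hκ hq
  set c : ℝ → ℝ := fun x => greenKer κ hκ p x x / greenKer κ hκ q x x with hc
  have hR : ∀ x, opInv (sand κ hκ p) (kerE κ hκ x) =
      ((c x : ℝ) : ℂ) • opInv (sand κ hκ q) (kerE κ hκ x) := fun x => by
    have h1 := congrArg (fun f => ((greenKer κ hκ p x x : ℝ) : ℂ) • f) (h x)
    have h2 := (greenKer_self_pos hκ hp x).ne'
    simp only [minVec, smul_smul, ← Complex.ofReal_mul] at h1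
    rw [mul_one_div_cancel h2, Complex.ofReal_one, one_smul] at h1
    rw [h1, mul_one_div]
  have hG : ∀ x y, greenKer κ hκ p x y = c y * greenKer κ hκ q x y := fun x y => by
    rw [greenKer, hR, inner_smul_right, Complex.re_ofReal_mul]; rfl
  have hcc : ∀ x y, greenKer κ hκ q x y ≠ 0 → c x = c y := fun x y hxy => by
    have h1 := hG x y
    rw [greenKer_symm hκ hp, hG y x, greenKer_symm hκ hq y x] at h1
    exact mul_right_cancel₀ hxy h1
  have hloc : IsLocallyConstant c := by
    rw [IsLocallyConstant.iff_eventually_eq]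
    intro x
    have h1 : Continuous fun y => greenKer κ hκ q y x := by
      unfold greenKer
      exact Complex.continuous_re.comp ((continuous_kerE hκ).inner continuous_const)
    filter_upwards [h1.continuousAt.eventually_ne (greenKer_self_pos hκ hq x).ne'] with y hy
    exact hcc y x hy
  have hconst : ∀ x, c x = c 0 := fun x => hloc.apply_eq_of_preconnectedSpace x 0
  have hE : ∀ x, kerE κ hκ x + sand κ hκ q (kerE κ hκ x) =
      ((c 0 : ℝ) : ℂ) • (kerE κ hκ x + sand κ hκ p (kerE κ hκ x)) := by
    have hT : ∀ f : L2, opInv (sand κ hκ p) f = ((c 0 : ℝ) : ℂ) • opInv (sand κ hκ q) f := by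
      intro f
      rw [← sub_eq_zero]
      refine eq_zero_of_inner_kerE hκ fun x => ?_
      rw [inner_sub_right, inner_smul_right, ← inner_opInv_left hAp (inner_sand_left hκ p),
        ← inner_opInv_left hAq (inner_sand_left hκ q), hR, hconst, inner_smul_left,
        Complex.conj_ofReal, sub_self]
    intro x
    have h1 := hT (kerE κ hκ x + sand κ hκ p (kerE κ hκ x))
    rw [opInv_apply hAp, ← map_smul] at h1
    exact (eq_opInv hAq).2 h1
  -- Otherwise the Hilbert–Schmidt operator cA_p − A_q acts on every E_x as the nonzero scalar 1 −
  -- c. Then ‖B E_x‖² would be a positive constant, which is not integrable over ℝ.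
  have hc1 : c 0 = 1 := by
    by_contra hne
    have hne' : 1 - c 0 ≠ 0 := fun h0 => hne (by linarith)
    set B := ((c 0 : ℝ) : ℂ) • sand κ hκ p - sand κ hκ q with hB
    have hBE : ∀ x, B (kerE κ hκ x) = ((1 - c 0 : ℝ) : ℂ) • kerE κ hκ x := fun x => by
      have h1 := hE x
      rw [smul_add] at h1
      rw [hB, sub_apply, smul_apply, Complex.ofReal_sub, sub_smul, Complex.ofReal_one, one_smul,
        sub_eq_sub_iff_add_eq_add, add_comm, ← h1]
    have hBs : B = sand κ hκ (c 0 • p + (-1 : ℝ) • q) := by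
      rw [hB, sand_add, sand_smul, sand_smul]; simp [sub_eq_add_neg]
    have h2 := lintegral_sand_kerE hκ (c 0 • p + (-1 : ℝ) • q)
    rw [← hBs] at h2
    have h3 : ∀ x, ‖B (kerE κ hκ x)‖ₑ ^ 2 = ENNReal.ofReal ((1 - c 0) ^ 2 * (1 / (2 * κ))) := by
      intro x
      rw [hBE, enorm_smul, mul_pow, enorm_ofReal_sq, ← ofReal_norm (kerE κ hκ x),
        ← ENNReal.ofReal_pow (norm_nonneg _), norm_kerE_sq, ENNReal.ofReal_mul (by positivity)]
    simp_rw [h3] at h2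
    have h4 : (0 : ℝ) < (1 - c 0) ^ 2 * (1 / (2 * κ)) := by positivity
    rw [lintegral_const, Real.volume_univ, ENNReal.mul_top (by simpa using h4)] at h2
    exact lt_irrefl _ h2
  refine (eq_of_sand_eq hκ ?_).symm
  ext1 f
  rw [← sub_eq_zero]
  refine eq_zero_of_inner_kerE hκ fun x => ?_
  have h1 := hE x
  rw [hc1, Complex.ofReal_one, one_smul] at h1
  rw [inner_sub_right, ← inner_sand_left hκ q, ← inner_sand_left hκ p, add_left_cancel h1, sub_self]

theorem eq_zero_of_integral_eq_zero {f : ℝ → ℝ} (hc : Continuous f) (hi : Integrable f)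
    (h0 : ∀ x, 0 ≤ f x) (h : ∫ x, f x = 0) (x : ℝ) : f x = 0 := by
  have hz : f =ᵐ[volume] fun _ => 0 := (integral_eq_zero_iff_of_nonneg h0 hi).1 h
  exact congrFun ((hc.ae_eq_iff_eq volume continuous_const).1 hz) x

theorem strictConvexOn_alpha (hκ : 1 ≤ κ) {δ : ℝ} (hδ : δ ≤ 1 / 2) :
    StrictConvexOn ℝ (Metric.closedBall (0 : HMinusOne) δ) (alpha κ) := by
  refine ⟨convex_closedBall _ _, fun p hp q hq hpq a b ha hb hab => ?_⟩
  refine lt_of_le_of_ne ((convexOn_alpha hκ hδ).2 hp hq ha.le hb.le hab) fun heq => hpq ?_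
  have hp' := (mem_closedBall_zero_iff.1 hp).trans hδ
  have hq' := (mem_closedBall_zero_iff.1 hq).trans hδ
  have hr' := norm_convex_comb hp' hq' ha.le hb.le hab
  set r := a • p + b • q with hr
  have hi1 : Integrable fun x => a * rho κ p x + b * rho κ q x :=
    ((integrable_rho hκ hp').const_mul a).add ((integrable_rho hκ hq').const_mul b)
  -- Equality in the convexity of α makes the convexity defect of ρ integrate to 0. It is continuous
  -- and nonnegative, hence vanishes at every x, and so do the quadratic remainders.
  have hint : ∫ x, ((a * rho κ p x + b * rho κ q x) - rho κ r x) = 0 := by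
    rw [integral_sub hi1 (integrable_rho hκ hr'), integral_add
      ((integrable_rho hκ hp').const_mul a) ((integrable_rho hκ hq').const_mul b),
      integral_const_mul, integral_const_mul, sub_eq_zero]
    exact heq.symm
  have hgap := rho_convex_gap hκ hp' hq' ha.le hb.le hab
  have hnn : ∀ x, 0 ≤ (a * rho κ p x + b * rho κ q x) - rho κ r x := fun x => by
    have h1 := hgap x
    have h3 := mul_nonneg ha.le (sq_nonneg ‖minVec κ hκ r x - minVec κ hκ p x‖)
    have h4 := mul_nonneg hb.le (sq_nonneg ‖minVec κ hκ r x - minVec κ hκ q x‖)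
    linarith
  have hcont : Continuous fun x => (a * rho κ p x + b * rho κ q x) - rho κ r x :=
    ((continuous_const.mul (continuous_rho hκ hp')).add
      (continuous_const.mul (continuous_rho hκ hq'))).sub (continuous_rho hκ hr')
  have hz := eq_zero_of_integral_eq_zero hcont (hi1.sub (integrable_rho hκ hr')) hnn hint
  rw [← hr] at hgap
  clear_value r
  have key : ∀ x, minVec κ hκ r x = minVec κ hκ p x ∧ minVec κ hκ r x = minVec κ hκ q x := by
    intro x
    have h1 := hgap x
    have h2 : (a * rho κ p x + b * rho κ q x) - rho κ r x = 0 := hz x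
    have h3 := sq_nonneg ‖minVec κ hκ r x - minVec κ hκ p x‖
    have h4 := sq_nonneg ‖minVec κ hκ r x - minVec κ hκ q x‖
    have h5 := mul_nonneg ha.le h3
    have h6 := mul_nonneg hb.le h4
    have h7 : a * ‖minVec κ hκ r x - minVec κ hκ p x‖ ^ 2 = 0 := by linarith
    have h8 : b * ‖minVec κ hκ r x - minVec κ hκ q x‖ ^ 2 = 0 := by linarith
    rw [mul_eq_zero_iff_left ha.ne', sq_eq_zero_iff, norm_eq_zero, sub_eq_zero] at h7
    rw [mul_eq_zero_iff_left hb.ne', sq_eq_zero_iff, norm_eq_zero, sub_eq_zero] at h8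
    exact ⟨h7, h8⟩
  exact eq_of_minVec_eq hκ hp' hq' fun x => (key x).1.symm.trans (key x).2

end StrictConvexity

/-! ### The logarithm of the renormalized determinant -/

section LogSeries

open scoped ENNReal InnerProductSpace ComplexConjugate ContDiff
open Filter Topology

variable {H : Type*} [NormedAddCommGroup H] [InnerProductSpace ℂ H] [CompleteSpace H]

/-- The Taylor coefficients of `(t - log (1 + t)) / t²`. -/
def logCoeff (k : ℕ) : ℂ := (-1) ^ k / (k + 2)

theorem norm_logCoeff_le (k : ℕ) : ‖logCoeff k‖ ≤ 1 := by
  have : ‖((k : ℂ) + 2)‖ = (k : ℝ) + 2 := by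
    rw [show ((k : ℂ) + 2) = (((k : ℝ) + 2 : ℝ) : ℂ) by push_cast; rfl, Complex.norm_real,
      Real.norm_of_nonneg (by positivity)]
  rw [logCoeff, norm_div, this, norm_pow, norm_neg, norm_one, one_pow,
    div_le_one (by positivity)]
  have : (0 : ℝ) ≤ k := k.cast_nonneg
  linarith

theorem hasSum_logCoeff {t : ℝ} (ht : |t| < 1) :
    HasSum (fun k => (t : ℂ) ^ 2 * (logCoeff k * (t : ℂ) ^ k)) (logFactor t : ℂ) := by
  have h := Real.hasSum_pow_div_log_of_abs_lt_one (x := -t) (by rwa [abs_neg])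
  rw [← hasSum_nat_add_iff' 1] at h
  have h2 : HasSum (fun k : ℕ => t ^ 2 * ((-1) ^ k / (k + 2) * t ^ k)) (logFactor t) := by
    have e1 : (fun k : ℕ => t ^ 2 * ((-1) ^ k / (k + 2) * t ^ k)) =
        fun k : ℕ => (-t) ^ (k + 1 + 1) / (((k + 1 : ℕ) : ℝ) + 1) := by
      funext k
      rw [neg_pow t (k + 1 + 1), pow_add t, pow_add t, pow_add (-1 : ℝ), pow_add (-1 : ℝ)]
      push_cast
      rw [show (k : ℝ) + 1 + 1 = k + 2 by ring]; ring
    have e2 : logFactor t =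
        -Real.log (1 - -t) - ∑ i ∈ Finset.range 1, (-t) ^ (i + 1) / ((i : ℝ) + 1) := by
      simp [logFactor]; ring
    rw [e1, e2]
    exact h
  have h3 := Complex.hasSum_ofReal.2 h2
  convert h3 using 2 with k
  simp [logCoeff]

/-- The power series of `(t - log (1 + t)) / t²`, applied to an operator. -/
def logSeries (A : H →L[ℂ] H) : H →L[ℂ] H := ∑' k, logCoeff k • A ^ k

theorem analyticAt_logSeries {A : H →L[ℂ] H} (hA : ‖A‖ < 1) :
    AnalyticAt ℂ (logSeries : (H →L[ℂ] H) → (H →L[ℂ] H)) A := by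
  let p := FormalMultilinearSeries.ofScalars (H →L[ℂ] H) logCoeff
  have hr : (1 : ℝ≥0∞) ≤ p.radius := by
    have h1 : ((1 : NNReal) : ℝ≥0∞) ≤ p.radius := by
      -- The norm bound for the terms of a scalar series needs n > 0; the maximum with ‖p 0‖ covers
      -- n = 0.
      refine p.le_radius_of_bound (max 1 ‖p 0‖) fun n => ?_
      rw [NNReal.coe_one, one_pow, mul_one]
      rcases Nat.eq_zero_or_pos n with rfl | hn
      · exact le_max_right _ _
      · exact (FormalMultilinearSeries.ofScalars_norm_le _ _ n hn).trans
          ((norm_logCoeff_le n).trans (le_max_left _ _))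
    simpa using h1
  have h2 := p.hasFPowerSeriesOnBall (lt_of_lt_of_le one_pos hr)
  have h3 : p.sum = logSeries := by
    have := FormalMultilinearSeries.ofScalarsSum_eq_tsum (E := H →L[ℂ] H) logCoeff
    exact this
  rw [h3] at h2
  refine h2.analyticAt_of_mem (Metric.mem_eball.2 ?_)
  rw [edist_zero_right]
  refine lt_of_lt_of_le ?_ hr
  rw [← ofReal_norm]
  exact ENNReal.ofReal_lt_one.2 hA

theorem summable_logSeries {A : H →L[ℂ] H} (hA : ‖A‖ ≤ 1 / 2) :
    Summable fun k => logCoeff k • A ^ k := by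
  refine Summable.of_norm_bounded_eventually
    (summable_geometric_of_lt_one (norm_nonneg A) (by linarith)) ?_
  rw [Nat.cofinite_eq_atTop]
  filter_upwards [eventually_gt_atTop 0] with k hk
  rw [norm_smul]
  calc _ ≤ 1 * ‖A‖ ^ k :=
        mul_le_mul (norm_logCoeff_le k) (norm_pow_le' A hk) (norm_nonneg _) zero_le_one
    _ = _ := one_mul _

theorem pow_apply_eigen {A : H →L[ℂ] H} {v : H} {t : ℝ} (h : A v = (t : ℂ) • v) (k : ℕ) :
    (A ^ k) v = (t : ℂ) ^ k • v := by
  induction k with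
  | zero => simp
  | succ k ih => rw [pow_succ, mul_apply_eq_comp, h, map_smul, ih, smul_smul, pow_succ,
      mul_comm]

/-- The two factors of A in A²φ(A) are placed one on each side of the inner product, so that the
trace is that of a product of two Hilbert–Schmidt operators. -/
theorem inner_logSeries_eigen {A : H →L[ℂ] H} (hA : ‖A‖ ≤ 1 / 2) {v : H} {t : ℝ}
    (h : A v = (t : ℂ) • v) (ht : |t| ≤ 1 / 2) (hv : ‖v‖ = 1) :
    ⟪A v, (logSeries A ∘L A) v⟫_ℂ = (logFactor t : ℂ) := by
  have h1 : HasSum (fun k => (logCoeff k • A ^ k) v) (logSeries A v) :=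
    (summable_logSeries hA).hasSum.mapL (ContinuousLinearMap.apply ℂ H v)
  have h2 : HasSum (fun k => ⟪v, (logCoeff k • A ^ k) v⟫_ℂ) ⟪v, logSeries A v⟫_ℂ :=
    h1.mapL (innerSL ℂ v)
  have h3 : ∀ k, ⟪v, (logCoeff k • A ^ k) v⟫_ℂ = logCoeff k * (t : ℂ) ^ k := fun k => by
    rw [smul_apply, pow_apply_eigen h, inner_smul_right, inner_smul_right,
      inner_self_eq_norm_sq_to_K, hv]
    simp
  simp_rw [h3] at h2
  have h4 := (h2.mul_left ((t : ℂ) ^ 2)).unique (hasSum_logCoeff (by linarith))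
  rw [ContinuousLinearMap.comp_apply, h, map_smul, inner_smul_left, inner_smul_right,
    Complex.conj_ofReal, ← h4]
  ring

theorem abs_eigenvalue_le {A : H →L[ℂ] H} {v : H} {t : ℝ} (h : A v = (t : ℂ) • v) (hv : ‖v‖ = 1) :
    |t| ≤ ‖A‖ := by
  have := A.le_opNorm v
  rwa [h, norm_smul, hv, mul_one, mul_one, Complex.norm_real] at this

theorem hsSq_eigen {ι : Type*} {b : HilbertBasis ι ℂ H} {A : H →L[ℂ] H} {μ : ι → ℝ}
    (h : ∀ i, A (b i) = (μ i : ℂ) • b i) : hsSq b A = ∑' i, ENNReal.ofReal (μ i ^ 2) := by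
  unfold hsSq
  congr 1; ext i
  rw [h, enorm_smul, mul_pow, enorm_ofReal_sq, ← ofReal_norm, b.orthonormal.1 i]
  simp

theorem hasSum_eigen_sq {ι : Type*} {b : HilbertBasis ι ℂ H} {A : H →L[ℂ] H} {μ : ι → ℝ}
    (h : ∀ i, A (b i) = (μ i : ℂ) • b i) {r : ℝ} (hr : 0 ≤ r) (hA : hsSq b A = ENNReal.ofReal r) :
    HasSum (fun i => μ i ^ 2) r := by
  rw [hsSq_eigen h] at hA
  have h1 : Summable fun i => μ i ^ 2 := by
    have h2 : ∑' i, ENNReal.ofReal (μ i ^ 2) ≠ ⊤ := by rw [hA]; exact ENNReal.ofReal_ne_top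
    refine (ENNReal.summable_toReal h2).congr fun i => ?_
    rw [ENNReal.toReal_ofReal (sq_nonneg _)]
  rw [← ENNReal.ofReal_tsum_of_nonneg (fun i => sq_nonneg _) h1] at hA
  have h3 : ∑' i, μ i ^ 2 = r :=
    (ENNReal.ofReal_eq_ofReal_iff (tsum_nonneg fun i => sq_nonneg _) hr).1 hA
  rw [← h3]
  exact h1.hasSum

end LogSeries

/-! ### −log det₂ as a Hilbert–Schmidt inner product: eigenvalue formula, bounds and analyticity -/

section LogDet

open scoped ENNReal InnerProductSpace ComplexConjugate ContDiff
open Filter Topology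

variable {κ : ℝ}

/-- The index set of a Hilbert basis of `L²`. -/
def l2Index : Set L2 := (exists_hilbertBasis ℂ L2).choose

/-- A Hilbert basis of `L²`. -/
def l2Basis : HilbertBasis l2Index ℂ L2 := (exists_hilbertBasis ℂ L2).choose_spec.choose

/-- The series for `- log det₂(1 + √R₀ q √R₀)`. -/
def logDet (κ : ℝ) (hκ : 1 ≤ κ) (q : HMinusOne) : ℝ :=
  (∑' i, ⟪sand κ hκ q (l2Basis i), (logSeries (sand κ hκ q) ∘L sand κ hκ q) (l2Basis i)⟫_ℂ).re

theorem hsSq_sand_ne_top (hκ : 1 ≤ κ) (q : HMinusOne) {ι : Type*} (b : HilbertBasis ι ℂ L2) :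
    hsSq b (sand κ hκ q) ≠ ⊤ := by rw [hsSq_sand]; exact ENNReal.ofReal_ne_top

/-- The trace does not depend on the basis, so the fixed basis `l2Basis` may be replaced by an
eigenbasis of A. The fixed one is needed to vary q. -/
theorem logDet_eq (hκ : 1 ≤ κ) {q : HMinusOne} (hq : ‖q‖ ≤ 1 / 2) {ι : Type*}
    (b : HilbertBasis ι ℂ L2) {μ : ι → ℝ} (h : ∀ i, sand κ hκ q (b i) = (μ i : ℂ) • b i) :
    logDet κ hκ q = ∑' i, logFactor (μ i) := by
  have hA := norm_sand_le_half hκ hq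
  have hfin : hsSq l2Basis (logSeries (sand κ hκ q) ∘L sand κ hκ q) ≠ ⊤ :=
    ((hsSq_comp_le l2Basis _ _).trans_lt
      (ENNReal.mul_lt_top (by simp) (hsSq_sand_ne_top hκ q _).lt_top)).ne
  rw [logDet, tsum_inner_eq l2Basis b _ _ (hsSq_sand_ne_top hκ q _) hfin]
  have e : ∀ i, ⟪sand κ hκ q (b i), (logSeries (sand κ hκ q) ∘L sand κ hκ q) (b i)⟫_ℂ =
      (logFactor (μ i) : ℂ) := fun i =>
    inner_logSeries_eigen hA (h i) ((abs_eigenvalue_le (h i) (b.orthonormal.1 i)).trans hA)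
      (b.orthonormal.1 i)
  simp_rw [e]
  rw [← Complex.ofReal_tsum, Complex.ofReal_re]

theorem exists_eigenbasis_sand (hκ : 1 ≤ κ) (q : HMinusOne) :
    ∃ (w : Set L2) (b : HilbertBasis w ℂ L2) (μ : w → ℝ),
      ∀ i, sand κ hκ q (b i) = (μ i : ℂ) • b i :=
  exists_eigenbasis _ (isCompactOperator_of_hsSq l2Basis _ (hsSq_sand_ne_top hκ q _))
    (inner_sand_left hκ q)

/-- The squared eigenvalues sum to the Hilbert–Schmidt integral exactly, and t²/8 ≤ t − log(1+t) ≤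
2t² for |t| ≤ 1/2. -/
theorem logDet_bounds (hκ : 1 ≤ κ) {q : HMinusOne} (hq : ‖q‖ ≤ 1 / 2) :
    8⁻¹ * hsInt κ q ≤ logDet κ hκ q ∧ logDet κ hκ q ≤ 8 * hsInt κ q := by
  obtain ⟨w, b, μ, h⟩ := exists_eigenbasis_sand hκ q
  have hA := norm_sand_le_half hκ hq
  have hs := hasSum_eigen_sq h (hsInt_nonneg hκ q) (hsSq_sand hκ q b)
  have hμ : ∀ i, |μ i| ≤ 1 / 2 := fun i =>
    (abs_eigenvalue_le (h i) (b.orthonormal.1 i)).trans hA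
  have hl := (summable_logFactor hs.summable hμ).hasSum
  rw [logDet_eq hκ hq b h]
  constructor
  · refine hasSum_le (fun i => ?_) (hs.mul_left 8⁻¹) hl
    have := le_logFactor (hμ i)
    linarith
  · refine hasSum_le (fun i => ?_) hl (hs.mul_left 8)
    have := logFactor_le (hμ i)
    nlinarith [sq_nonneg (μ i)]

theorem hasDet2_sand (hκ : 1 ≤ κ) {q : HMinusOne} (hq : ‖q‖ ≤ 1 / 2) :
    HasDet2 (sand κ hκ q) ((Real.exp (-logDet κ hκ q) : ℝ) : ℂ) := by
  obtain ⟨w, b, μ, h⟩ := exists_eigenbasis_sand hκ q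
  have hs := hasSum_eigen_sq h (hsInt_nonneg hκ q) (hsSq_sand hκ q b)
  have hμ : ∀ i, |μ i| ≤ 1 / 2 := fun i =>
    (abs_eigenvalue_le (h i) (b.orthonormal.1 i)).trans (norm_sand_le_half hκ hq)
  rw [logDet_eq hκ hq b h]
  exact hasProd_det2 (inner_sand_left hκ q) b h hs.summable hμ

theorem isHilbertSchmidt_sand (hκ : 1 ≤ κ) (q : HMinusOne) : IsHilbertSchmidt (sand κ hκ q) :=
  ⟨l2Index, l2Basis, (hsSq_ne_top_iff _ _).1 (hsSq_sand_ne_top hκ q _)⟩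

/-- The map `q ↦ √R₀ q √R₀`. -/
def sandL (κ : ℝ) (hκ : 1 ≤ κ) : HMinusOne →L[ℝ] (L2 →L[ℂ] L2) :=
  LinearMap.mkContinuous
    { toFun := sand κ hκ
      map_add' := sand_add hκ
      map_smul' := fun c q => by rw [sand_smul]; rfl } 1 fun q => by
    rw [one_mul]; exact norm_sand_le hκ q

/-- The space of Hilbert–Schmidt operators on `L²`, as square-summable families of vectors. -/
abbrev HSSpace : Type := lp (fun _ : l2Index => L2) 2

theorem memlp_sand (hκ : 1 ≤ κ) (q : HMinusOne) :
    Memℓp (fun i : l2Index => sand κ hκ q (l2Basis i)) 2 := by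
  rw [memℓp_gen_iff (by norm_num)]
  simpa using (hsSq_ne_top_iff _ _).1 (hsSq_sand_ne_top hκ q l2Basis)

/-- The map `q ↦ √R₀ q √R₀` into the Hilbert–Schmidt operators. -/
def sandHS (κ : ℝ) (hκ : 1 ≤ κ) : HMinusOne →L[ℝ] HSSpace :=
  LinearMap.mkContinuous
    { toFun := fun q => ⟨fun i => sand κ hκ q (l2Basis i), memlp_sand hκ q⟩
      map_add' := fun p q => by
        ext1; funext i
        simp only [sand_add]; rfl
      map_smul' := fun c q => by
        ext1; funext i
        simp only [sand_smul]; rfl } 1 fun q => by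
    rw [one_mul]
    refine lp.norm_le_of_forall_sum_le (by norm_num) (norm_nonneg q) fun s => ?_
    simp only [ENNReal.toReal_ofNat, Real.rpow_ofNat]
    have h1 := (hsSq_ne_top_iff _ _).1 (hsSq_sand_ne_top hκ q l2Basis)
    have h2 := toReal_hsSq l2Basis (sand κ hκ q)
    rw [hsSq_sand, ENNReal.toReal_ofReal (hsInt_nonneg hκ q)] at h2
    refine (h1.sum_le_tsum s fun i _ => sq_nonneg _).trans ?_
    rw [← h2]
    exact hsInt_le hκ q

/-- Composition of a bounded operator with a Hilbert–Schmidt operator. -/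
def compHS (B : L2 →L[ℂ] L2) : HSSpace →L[ℂ] HSSpace :=
  lp.mapCLM 2 (fun _ => B) (norm_nonneg B) fun _ => le_rfl

theorem isBoundedBilinearMap_compHS :
    IsBoundedBilinearMap ℝ fun p : (L2 →L[ℂ] L2) × HSSpace => compHS p.1 p.2 where
  add_left B B' V := by ext1; rfl
  smul_left c B V := by ext1; rfl
  add_right B V V' := map_add _ _ _
  smul_right c B V := (compHS B).map_smul_of_tower c V
  bound := ⟨1, one_pos, fun B V => by
    rw [one_mul]
    exact (ContinuousLinearMap.le_opNorm _ _).trans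
      (mul_le_mul_of_nonneg_right (lp.norm_mapCLM_le ..) (norm_nonneg _))⟩

theorem logDet_eq_inner (hκ : 1 ≤ κ) (q : HMinusOne) :
    logDet κ hκ q =
      (⟪sandHS κ hκ q, compHS (logSeries (sandL κ hκ q)) (sandHS κ hκ q)⟫_ℂ).re := by
  rw [logDet, lp.inner_eq_tsum]; rfl

/-- A depends linearly and continuously on q, both in operator norm and in Hilbert–Schmidt norm.
What remains is a power series in A, composition of operators, and the inner product, the last two
being bounded and real-bilinear. -/
theorem analyticAt_logDet (hκ : 1 ≤ κ) {q : HMinusOne} (hq : ‖q‖ < 1) :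
    AnalyticAt ℝ (logDet κ hκ) q := by
  have h1 : AnalyticAt ℝ (sandL κ hκ) q := (sandL κ hκ).analyticAt q
  have h2 : AnalyticAt ℝ (sandHS κ hκ) q := (sandHS κ hκ).analyticAt q
  have h3 : AnalyticAt ℝ (fun q => logSeries (sandL κ hκ q)) q := by
    refine AnalyticAt.fun_comp (g := logSeries) ?_ h1
    exact (analyticAt_logSeries ((norm_sand_le hκ q).trans_lt hq)).restrictScalars
  have h4 : AnalyticAt ℝ (fun q => compHS (logSeries (sandL κ hκ q)) (sandHS κ hκ q)) q :=
    (isBoundedBilinearMap_compHS.toContinuousLinearMap.analyticAt_bilinear _).fun_comp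
      (f := fun q => (logSeries (sandL κ hκ q), sandHS κ hκ q)) (h3.prod h2)
  have h5 : AnalyticAt ℝ (fun q => ⟪sandHS κ hκ q,
      compHS (logSeries (sandL κ hκ q)) (sandHS κ hκ q)⟫_ℂ) q :=
    ((isBoundedBilinearMap_inner (𝕜 := ℂ)).toContinuousLinearMap.analyticAt_bilinear _).fun_comp
      (f := fun q => (sandHS κ hκ q, compHS (logSeries (sandL κ hκ q)) (sandHS κ hκ q))) (h2.prod h4)
  have h6 := (Complex.reCLM.analyticAt _).fun_comp h5
  rw [show logDet κ hκ = _ from funext (logDet_eq_inner hκ)]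
  exact h6

end LogDet

/-! ### Schwartz potentials -/

section SchwartzPotential

open scoped ENNReal InnerProductSpace ComplexConjugate ContDiff
open Filter Topology

variable {κ : ℝ}

/-- A real-valued Schwartz function as an element of `H⁻¹`. -/
def ofSchwartz (f : 𝓢(ℝ, ℂ)) (hf : ∀ x, (f x).im = 0) : HMinusOne :=
  ⟨SchwartzMap.toTemperedDistributionCLM ℝ ℂ volume f, f.memSobolev, fun φ hφ => by
    refine (congrArg Complex.im
      (SchwartzMap.toTemperedDistributionCLM_apply_apply volume f φ)).trans ?_
    have : ∀ x, φ x • f x = (((φ x).re * (f x).re : ℝ) : ℂ) := fun x => by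
      apply Complex.ext <;> simp [hφ x, hf x]
    simp_rw [this]
    rw [integral_complex_ofReal, Complex.ofReal_im]⟩

theorem ofSchwartz_apply (f φ : 𝓢(ℝ, ℂ)) (hf : ∀ x, (f x).im = 0) :
    (ofSchwartz f hf).toDistribution φ = ∫ x, φ x * f x :=
  SchwartzMap.toTemperedDistributionCLM_apply_apply volume f φ

theorem fourierFn_ofSchwartz (f : 𝓢(ℝ, ℂ)) (hf : ∀ x, (f x).im = 0) :
    (ofSchwartz f hf).fourierFn =ᵐ[volume] fun ξ => (𝓕 f : 𝓢(ℝ, ℂ)) ξ := by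
  refine ae_eq_of_schwartz (locallyIntegrable_fourierFn _)
    (𝓕 f : 𝓢(ℝ, ℂ)).continuous.locallyIntegrable fun g _ => ?_
  have h1 := HMinusOne.pairing_schwartz (ofSchwartz f hf) (𝓕 g)
  rw [ofSchwartz_apply, HMinusOne.pairing, ← SchwartzMap.fourierInv_coe,
    FourierTransform.fourierInv_fourier_eq, SchwartzMap.fourier_coe,
    integral_fourier_mul (g.integrable (μ := volume)) (f.integrable (μ := volume)),
    ← SchwartzMap.fourier_coe] at h1
  rw [← h1]
  congr 1; ext ξ; ring

theorem pairing_ofSchwartz (f : 𝓢(ℝ, ℂ)) (hf : ∀ x, (f x).im = 0) {h : ℝ → ℂ}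
    (hh : Integrable h) : (ofSchwartz f hf).pairing h = ∫ x, f x * h x := by
  have h1 : (ofSchwartz f hf).pairing h = ∫ ξ, 𝓕⁻ h ξ * (𝓕 f : 𝓢(ℝ, ℂ)) ξ := by
    refine integral_congr_ae ?_
    filter_upwards [fourierFn_ofSchwartz f hf] with ξ hξ
    rw [hξ, mul_comm]
  rw [h1, integral_fourierInv_mul hh ((𝓕 f : 𝓢(ℝ, ℂ)).integrable (μ := volume)),
    ← SchwartzMap.fourierInv_coe, FourierTransform.fourierInv_fourier_eq]
  congr 1; ext x; ring

theorem memLp_inner_kerE (hκ : 1 ≤ κ) (φ : L2) : MemLp (fun x => ⟪kerE κ hκ x, φ⟫_ℂ) 2 :=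
  (memLp_congr_ae (sqrtR0_ae_inner hκ φ)).1 (Lp.memLp _)

theorem inner_sand_ofSchwartz (hκ : 1 ≤ κ) (f : 𝓢(ℝ, ℂ)) (hf : ∀ x, (f x).im = 0) (φ ψ : L2) :
    ⟪φ, sand κ hκ (ofSchwartz f hf) ψ⟫_ℂ =
      ∫ x, f x * (conj ⟪kerE κ hκ x, φ⟫_ℂ * ⟪kerE κ hκ x, ψ⟫_ℂ) := by
  rw [inner_sand, ← pairing_ofSchwartz f hf
    (integrable_conj_mul (memLp_inner_kerE hκ φ) (memLp_inner_kerE hκ ψ))]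
  apply HMinusOne.pairing_congr
  filter_upwards [sqrtR0_ae_inner hκ φ, sqrtR0_ae_inner hκ ψ] with x h1 h2
  rw [h1, h2]

theorem norm_le_norm_freq (q : HMinusOne) : ‖q‖ ≤ ‖q.freq‖ := by
  have h1 : ‖q‖ = ‖HMinusOne.toL2 q‖ := rfl
  rw [h1]
  refine Lp.norm_le_norm_of_ae_le ?_
  filter_upwards [(HMinusOne.memLp_ratio q).coeFn_toLp] with ξ hξ
  have h4 : HMinusOne.toL2 q ξ = (HMinusOne.ratio ξ : ℂ) * q.freq ξ := hξ
  rw [h4, norm_mul, Complex.norm_real, Real.norm_of_nonneg (HMinusOne.ratio_pos ξ).le]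
  exact mul_le_of_le_one_left (norm_nonneg _) (HMinusOne.ratio_le_one ξ)

theorem freq_sub (p q : HMinusOne) : (p - q).freq = p.freq - q.freq := by
  rw [sub_eq_add_neg, ← neg_one_smul ℝ q, HMinusOne.freq_add, HMinusOne.freq_smul, neg_one_smul,
    sub_eq_add_neg]

theorem conj_freq_ae (q : HMinusOne) :
    (fun ξ => q.freq (-ξ)) =ᵐ[volume] fun ξ => conj (q.freq ξ) := by
  filter_upwards [conj_fourierFn_ae q] with ξ hξ
  rw [HMinusOne.fourierFn, HMinusOne.fourierFn, map_mul, Complex.conj_ofReal, neg_sq] at hξ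
  refine mul_left_cancel₀ ?_ hξ
  rw [Ne, Complex.ofReal_eq_zero]; positivity

/-- The pointwise real part of a Schwartz function. -/
def realPart (f : 𝓢(ℝ, ℂ)) : 𝓢(ℝ, ℂ) :=
  SchwartzMap.postcompCLM (Complex.ofRealCLM ∘L Complex.reCLM : ℂ →L[ℝ] ℂ) f

theorem realPart_apply (f : 𝓢(ℝ, ℂ)) (x : ℝ) : realPart f x = ((f x).re : ℂ) := rfl

theorem fourier_realPart (f : 𝓢(ℝ, ℂ)) (ξ : ℝ) :
    (𝓕 (realPart f) : 𝓢(ℝ, ℂ)) ξ =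
      ((𝓕 f : 𝓢(ℝ, ℂ)) ξ + conj ((𝓕 f : 𝓢(ℝ, ℂ)) (-ξ))) / 2 := by
  have hi : Integrable (fun x => f x) := f.integrable (μ := volume)
  rw [SchwartzMap.fourier_coe, SchwartzMap.fourier_coe, fourier_eq_ec, fourier_eq_ec,
    fourier_eq_ec, ← integral_conj, ← integral_add, ← integral_div]
  · congr 1; ext x
    rw [map_mul, conj_ec, realPart_apply, Complex.re_eq_add_conj,
      show -(-(x * -ξ)) = -(x * ξ) by ring]
    ring
  · refine hi.bdd_mul (c := 1) (continuous_ec.comp (by fun_prop)).aestronglyMeasurable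
      (Eventually.of_forall fun x => (norm_ec _).le)
  · refine (LinearIsometryEquiv.integrable_comp_iff Complex.conjLIE).2 ?_
    exact hi.bdd_mul (c := 1) (continuous_ec.comp (by fun_prop)).aestronglyMeasurable
      (Eventually.of_forall fun x => (norm_ec _).le)

/-- The L² function `freq q` is approximated by a Schwartz function and transformed back. Taking the
real part symmetrizes the approximant in frequency, and this does not increase the error because
`freq q` is itself Hermitian. -/
theorem exists_ofSchwartz_near (q : HMinusOne) {ε : ℝ} (hε : 0 < ε) :
    ∃ (f : 𝓢(ℝ, ℂ)) (hf : ∀ x, (f x).im = 0), ‖q - ofSchwartz f hf‖ < ε := by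
  obtain ⟨h, hh⟩ := Metric.denseRange_iff.1
    (SchwartzMap.denseRange_toLpCLM (F := ℂ) (μ := (volume : Measure ℝ)) (p := 2)
      ENNReal.ofNat_ne_top) q.freq ε hε
  let w : ℝ → ℂ := fun x => (((1 + ‖x‖ ^ 2) ^ ((1 : ℝ) / 2) : ℝ) : ℂ)
  have hw : Function.HasTemperateGrowth w := by fun_prop
  let F : 𝓢(ℝ, ℂ) := SchwartzMap.smulLeftCLM ℂ w h
  have hF : ∀ ξ, F ξ = w ξ * h ξ := fun ξ => SchwartzMap.smulLeftCLM_apply_apply hw h ξ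
  let f := realPart (𝓕⁻ F)
  have hf : ∀ x, (f x).im = 0 := fun x => by rw [realPart_apply]; exact Complex.ofReal_im _
  refine ⟨f, hf, lt_of_le_of_lt (norm_le_norm_freq _) (lt_of_le_of_lt ?_ hh)⟩
  rw [freq_sub, dist_eq_norm]
  set p := ofSchwartz f hf with hp
  set u : L2 := q.freq - SchwartzMap.toLpCLM ℝ ℂ 2 volume h with hu
  have hua : u =ᵐ[volume] fun ξ => q.freq ξ - h ξ := by
    filter_upwards [Lp.coeFn_sub q.freq (SchwartzMap.toLpCLM ℝ ℂ 2 volume h),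
      SchwartzMap.coeFn_toLp h 2 volume] with ξ h1 h2
    rw [h1, Pi.sub_apply]
    exact congrArg (q.freq ξ - ·) h2
  have hneg := (Measure.measurePreserving_neg (volume : Measure ℝ))
  have hpf : ∀ᵐ ξ, p.freq ξ = (h ξ + conj (h (-ξ))) / 2 := by
    filter_upwards [fourierFn_ofSchwartz f hf] with ξ hξ
    have e1 : (𝓕 f : 𝓢(ℝ, ℂ)) ξ = w ξ * ((h ξ + conj (h (-ξ))) / 2) := by
      have e2 : (𝓕 (realPart (𝓕⁻ F)) : 𝓢(ℝ, ℂ)) ξ = _ := fourier_realPart (𝓕⁻ F) ξ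
      rw [FourierTransform.fourier_fourierInv_eq, hF, hF] at e2
      rw [e2, map_mul]
      have : conj (w (-ξ)) = w ξ := by simp only [w, Complex.conj_ofReal, norm_neg]
      rw [this]; ring
    rw [e1, HMinusOne.fourierFn] at hξ
    have e3 : w ξ = (((1 + ξ ^ 2) ^ ((1 : ℝ) / 2) : ℝ) : ℂ) := by
      simp only [w, Real.norm_eq_abs, sq_abs]
    rw [e3] at hξ
    refine mul_left_cancel₀ ?_ hξ
    rw [Ne, Complex.ofReal_eq_zero]; positivity
  -- The new error is the average of the old one and its conjugate reflection, which have the same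
  -- norm.
  have hdiff : (q.freq - p.freq : L2) =ᵐ[volume]
      fun ξ => (2⁻¹ : ℂ) * u ξ + (2⁻¹ : ℂ) * conj (u (-ξ)) := by
    filter_upwards [Lp.coeFn_sub q.freq p.freq, hpf, hua, hneg.quasiMeasurePreserving.ae hua,
      conj_freq_ae q] with ξ h1 h2 h3 h4 h5
    rw [h1, Pi.sub_apply, h2, h3, h4, map_sub, h5, Complex.conj_conj]
    ring
  have hum := Lp.memLp u
  have hum' : MemLp (fun ξ => conj (u (-ξ))) 2 (volume : Measure ℝ) :=
    (hum.comp_measurePreserving hneg).star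
  have hn : eLpNorm (fun ξ => conj (u (-ξ))) 2 volume = eLpNorm u 2 volume := by
    rw [← eLpNorm_comp_measurePreserving hum.1 hneg]
    exact eLpNorm_congr_norm_ae (Eventually.of_forall fun ξ => RCLike.norm_conj _)
  have hle : ‖q.freq - p.freq‖ₑ ≤ ‖u‖ₑ := by
    rw [Lp.enorm_def, Lp.enorm_def, eLpNorm_congr_ae hdiff]
    refine (eLpNorm_add_le (hum.1.const_mul _) (hum'.1.const_mul _) (by norm_num)).trans ?_
    have e1 := eLpNorm_const_smul (2⁻¹ : ℂ) (u : ℝ → ℂ) 2 volume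
    have e2 := eLpNorm_const_smul (2⁻¹ : ℂ) (fun ξ => conj (u (-ξ))) 2 volume
    have e3 : ‖(2⁻¹ : ℂ)‖ₑ = 2⁻¹ := by
      rw [enorm_inv (by norm_num)]; congr 1; rw [← ofReal_norm]; norm_num
    rw [hn, e3] at e2
    rw [e3] at e1
    refine (add_le_add e1.le e2.le).trans (le_of_eq ?_)
    rw [← add_mul, ENNReal.inv_two_add_inv_two, one_mul]
  rw [← ofReal_norm, ← ofReal_norm] at hle
  exact (ENNReal.ofReal_le_ofReal_iff (norm_nonneg _)).1 hle

end SchwartzPotential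

/-! ### Green's functions of integrable potentials -/

section ExponentialIntegral

open scoped ENNReal ContDiff
open Filter Topology Set

variable {κ : ℝ} {F : ℝ → ℝ}

/-- The one-sided convolution `∫_{z > x} exp (-κ (z - x)) F z dz`. -/
def rightInt (κ : ℝ) (F : ℝ → ℝ) (x : ℝ) : ℝ := ∫ z in Ioi x, Real.exp (-κ * (z - x)) * F z

/-- The one-sided convolution `∫_{z ≤ x} exp (-κ (x - z)) F z dz`. -/
def leftInt (κ : ℝ) (F : ℝ → ℝ) (x : ℝ) : ℝ := ∫ z in Iic x, Real.exp (-κ * (x - z)) * F z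

theorem leftInt_eq (κ : ℝ) (F : ℝ → ℝ) (x : ℝ) :
    leftInt κ F x = rightInt κ (fun z => F (-z)) (-x) := by
  rw [leftInt, rightInt, ← integral_comp_neg_Iic]
  simp only [neg_neg]
  congr 1; ext z
  congr 3; ring

theorem integrable_indicator_exp (hκ : 0 < κ) (hF : Integrable F) (x : ℝ) :
    Integrable ((Ioi x).indicator fun z => Real.exp (-κ * (z - x)) * F z) := by
  refine hF.mono ?_ (Eventually.of_forall fun z => ?_)
  · exact ((by fun_prop : Continuous fun z => Real.exp (-κ * (z - x))).aestronglyMeasurable.mul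
      hF.1).indicator measurableSet_Ioi
  · by_cases h : z ∈ Ioi x
    · rw [indicator_of_mem h, norm_mul]
      refine mul_le_of_le_one_left (norm_nonneg _) ?_
      rw [Real.norm_eq_abs, Real.abs_exp, Real.exp_le_one_iff]
      have : 0 < z - x := sub_pos.2 h
      nlinarith
    · rw [indicator_of_notMem h]; simp

theorem norm_indicator_exp_le (hκ : 0 < κ) (x z c : ℝ) :
    ‖(Ioi x).indicator (fun z => Real.exp (-κ * (z - x)) * c) z‖ ≤ |c| := by
  by_cases h : z ∈ Ioi x
  · rw [indicator_of_mem h, norm_mul]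
    refine mul_le_of_le_one_left (norm_nonneg _) ?_
    rw [Real.norm_eq_abs, Real.abs_exp, Real.exp_le_one_iff]
    have : 0 < z - x := sub_pos.2 h
    nlinarith
  · rw [indicator_of_notMem h]; simp

theorem rightInt_eq_indicator (κ : ℝ) (F : ℝ → ℝ) (x : ℝ) :
    rightInt κ F x = ∫ z, (Ioi x).indicator (fun z => Real.exp (-κ * (z - x)) * F z) z :=
  (integral_indicator measurableSet_Ioi).symm

theorem integrableOn_exp_mul (hκ : 0 < κ) (hF : Integrable F) (x : ℝ) :
    IntegrableOn (fun z => Real.exp (-κ * (z - x)) * F z) (Ioi x) :=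
  (integrable_indicator_iff measurableSet_Ioi).1 (integrable_indicator_exp hκ hF x)

theorem abs_rightInt_le (hκ : 0 < κ) (hF : Integrable F) (x : ℝ) :
    |rightInt κ F x| ≤ ∫ z, |F z| := by
  rw [rightInt_eq_indicator, ← Real.norm_eq_abs]
  refine norm_integral_le_of_norm_le hF.abs (Eventually.of_forall fun z => ?_)
  by_cases h : z ∈ Ioi x
  · have := norm_indicator_exp_le hκ x z (F z)
    rw [indicator_of_mem h] at this ⊢
    exact this
  · rw [indicator_of_notMem h]; simp

theorem tendsto_rightInt (hκ : 0 < κ) (hF : Integrable F) :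
    Tendsto (rightInt κ F) atTop (𝓝 0) := by
  have h : Tendsto (fun x => ∫ z, (Ioi x).indicator (fun z => Real.exp (-κ * (z - x)) * F z) z)
      atTop (𝓝 (∫ _ : ℝ, (0 : ℝ))) := by
    refine tendsto_integral_filter_of_dominated_convergence (fun z => |F z|)
      (Eventually.of_forall fun x => (integrable_indicator_exp hκ hF x).1)
      (Eventually.of_forall fun x => Eventually.of_forall fun z => ?_) hF.abs
      (Eventually.of_forall fun z => ?_)
    · by_cases h : z ∈ Ioi x
      · have := norm_indicator_exp_le hκ x z (F z)
        rw [indicator_of_mem h] at this ⊢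
        exact this
      · rw [indicator_of_notMem h]; simp
    · refine tendsto_const_nhds.congr' ?_
      filter_upwards [eventually_ge_atTop z] with x hx
      rw [indicator_of_notMem (notMem_Ioi.2 hx)]
  rw [integral_zero] at h
  exact h.congr fun x => (rightInt_eq_indicator κ F x).symm

theorem hasDerivAt_rightInt (hκ : 0 < κ) (hF : Integrable F) (hc : Continuous F) (x : ℝ) :
    HasDerivAt (rightInt κ F) (κ * rightInt κ F x - F x) x := by
  have hi : ∀ a, IntegrableOn (fun z => Real.exp (-κ * z) * F z) (Ioi a) := fun a => by
    have h1 : IntegrableOn (fun z => Real.exp (-κ * a) * (Real.exp (-κ * (z - a)) * F z)) (Ioi a) :=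
      (integrableOn_exp_mul hκ hF a).const_mul _
    refine h1.congr_fun (fun z _ => ?_) measurableSet_Ioi
    change Real.exp (-κ * a) * (Real.exp (-κ * (z - a)) * F z) = Real.exp (-κ * z) * F z
    rw [← mul_assoc, ← Real.exp_add]; congr 2; ring
  have hcont : Continuous fun z => Real.exp (-κ * z) * F z := by fun_prop
  -- Factoring out e^{κw} and subtracting an interval integral from a constant leaves x only in an
  -- endpoint, where the fundamental theorem of calculus applies.
  have e : rightInt κ F = fun w => Real.exp (κ * w) * ((∫ z in Ioi 0, Real.exp (-κ * z) * F z) -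
      ∫ z in (0 : ℝ)..w, Real.exp (-κ * z) * F z) := by
    funext w
    rw [← intervalIntegral.integral_interval_add_Ioi (hi 0) (hi w), add_sub_cancel_left,
      ← integral_const_mul, rightInt]
    congr 1; ext z
    rw [← mul_assoc, ← Real.exp_add]; congr 2; ring
  have h1 : HasDerivAt (fun w => ∫ z in (0 : ℝ)..w, Real.exp (-κ * z) * F z)
      (Real.exp (-κ * x) * F x) x :=
    intervalIntegral.integral_hasDerivAt_right (hcont.intervalIntegrable _ _)
      hcont.stronglyMeasurable.stronglyMeasurableAtFilter hcont.continuousAt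
  have h2 : HasDerivAt (fun w => Real.exp (κ * w)) (Real.exp (κ * x) * (κ * 1)) x :=
    ((hasDerivAt_id x).const_mul κ).exp
  have h3 := h2.mul (h1.const_sub (∫ z in Ioi 0, Real.exp (-κ * z) * F z))
  rw [e]
  refine h3.congr_deriv ?_
  have : Real.exp (κ * x) * Real.exp (-κ * x) = 1 := by rw [← Real.exp_add]; simp
  linear_combination (-F x) * this

theorem tendsto_leftInt (hκ : 0 < κ) (hF : Integrable F) :
    Tendsto (leftInt κ F) atBot (𝓝 0) := by
  rw [show leftInt κ F = _ from funext (leftInt_eq κ F)]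
  exact (tendsto_rightInt hκ hF.comp_neg).comp tendsto_neg_atBot_atTop

theorem hasDerivAt_leftInt (hκ : 0 < κ) (hF : Integrable F) (hc : Continuous F) (x : ℝ) :
    HasDerivAt (leftInt κ F) (-κ * leftInt κ F x + F x) x := by
  have h := (hasDerivAt_rightInt hκ hF.comp_neg (hc.comp continuous_neg) (-x)).comp x
    (hasDerivAt_neg x)
  rw [show leftInt κ F = (rightInt κ fun z => F (-z)) ∘ Neg.neg from funext (leftInt_eq κ F)]
  refine h.congr_deriv ?_
  simp only [Function.comp, neg_neg]
  ring

theorem integral_exp_abs_mul (hκ : 0 < κ) (hF : Integrable F) (x : ℝ) :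
    ∫ z, Real.exp (-κ * |x - z|) * F z = rightInt κ F x + leftInt κ F x := by
  have hi : Integrable fun z => Real.exp (-κ * |x - z|) * F z := by
    refine hF.bdd_mul (c := 1) (by fun_prop) (Eventually.of_forall fun z => ?_)
    rw [Real.norm_eq_abs, Real.abs_exp, Real.exp_le_one_iff]
    nlinarith [abs_nonneg (x - z)]
  rw [← intervalIntegral.integral_Iic_add_Ioi (b := x) hi.integrableOn hi.integrableOn, add_comm,
    rightInt, leftInt]
  congr 1
  · refine setIntegral_congr_fun measurableSet_Ioi fun z hz => ?_
    have : |x - z| = z - x := by rw [abs_sub_comm, abs_of_pos (sub_pos.2 hz)]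
    simp only [this]
  · refine setIntegral_congr_fun measurableSet_Iic fun z hz => ?_
    have : |x - z| = x - z := abs_of_nonneg (sub_nonneg.2 hz)
    simp only [this]

theorem continuous_rightInt_diag (hκ : 0 < κ) {f : ℝ → ℝ} {G : ℝ → ℝ → ℝ} (hf : Integrable f)
    (hG : Continuous fun p : ℝ × ℝ => G p.1 p.2) {C : ℝ} (hC : ∀ x y, |G x y| ≤ C) :
    Continuous fun x => rightInt κ (fun z => f z * G z x) x := by
  have hGx : ∀ x, Continuous fun z => G z x := fun x =>
    hG.comp (by fun_prop : Continuous fun z : ℝ => (z, x))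
  have hi : ∀ x, Integrable fun z => f z * G z x := fun x =>
    hf.mul_bdd (c := C) (hGx x).aestronglyMeasurable (Eventually.of_forall fun z => hC z x)
  simp only [rightInt_eq_indicator]
  rw [continuous_iff_continuousAt]
  intro x₀
  refine continuousAt_of_dominated (bound := fun z => |f z| * C)
    (Eventually.of_forall fun x => (integrable_indicator_exp hκ (hi x) x).1)
    (Eventually.of_forall fun x => Eventually.of_forall fun z => ?_) (hf.abs.mul_const C) ?_
  · by_cases h : z ∈ Ioi x
    · have := norm_indicator_exp_le hκ x z (f z * G z x)
      rw [indicator_of_mem h] at this ⊢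
      refine this.trans ?_
      rw [abs_mul]
      exact mul_le_mul_of_nonneg_left (hC z x) (abs_nonneg _)
    · rw [indicator_of_notMem h, norm_zero]
      exact mul_nonneg (abs_nonneg _) ((abs_nonneg _).trans (hC z x))
  · have hne : ∀ᵐ z : ℝ, z ≠ x₀ := by
      rw [ae_iff]; simp
    filter_upwards [hne] with z hz
    have hGz : Continuous fun x => G z x := hG.comp (by fun_prop : Continuous fun x : ℝ => (z, x))
    rcases lt_or_gt_of_ne hz with h | h
    · refine (continuousAt_const (y := (0 : ℝ))).congr ?_
      filter_upwards [lt_mem_nhds h] with x hx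
      rw [indicator_of_notMem (notMem_Ioi.2 hx.le)]
    · have hc : Continuous fun x => Real.exp (-κ * (z - x)) * (f z * G z x) := by fun_prop
      refine hc.continuousAt.congr ?_
      filter_upwards [gt_mem_nhds h] with x hx
      rw [indicator_of_mem (mem_Ioi.2 hx)]

end ExponentialIntegral

/-! ### Factorization of the Green's function and the integral of G(x,y)²/g(x)² -/

section GreenODE

open scoped ENNReal ContDiff
open Filter Topology Set

/-- `G` solves the integral equation of the Green's function of `-∂² + f + κ²`. -/
structure IsGreenFn (κ : ℝ) (f : ℝ → ℝ) (G : ℝ → ℝ → ℝ) : Prop where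
  kappa_pos : 0 < κ
  continuous_pot : Continuous f
  integrable_pot : Integrable f
  continuous : Continuous fun p : ℝ × ℝ => G p.1 p.2
  bounded : ∃ C, ∀ x y, |G x y| ≤ C
  symm : ∀ x y, G x y = G y x
  diag_ge : ∃ c > 0, ∀ x, c ≤ G x x
  eqn : ∀ x y, 2 * κ * G x y =
    Real.exp (-κ * |x - y|) - ∫ z, Real.exp (-κ * |x - z|) * (f z * G z y)
  integrable_sq : ∀ y, Integrable fun x => G x y ^ 2
  tendsto_zero : ∀ y, Tendsto (fun x => G x y) (cocompact ℝ) (𝓝 0)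

variable {κ : ℝ} {f : ℝ → ℝ} {G : ℝ → ℝ → ℝ}

theorem IsGreenFn.reflect (h : IsGreenFn κ f G) :
    IsGreenFn κ (fun x => f (-x)) fun x y => G (-x) (-y) where
  kappa_pos := h.kappa_pos
  continuous_pot := h.continuous_pot.comp continuous_neg
  integrable_pot := h.integrable_pot.comp_neg
  continuous := h.continuous.comp (by fun_prop : Continuous fun p : ℝ × ℝ => (-p.1, -p.2))
  bounded := h.bounded.imp fun _ hC x y => hC (-x) (-y)
  symm x y := h.symm _ _
  diag_ge := h.diag_ge.imp fun _ hc => ⟨hc.1, fun x => hc.2 (-x)⟩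
  eqn x y := by
    rw [h.eqn, ← integral_neg_eq_self]
    have e1 : |-x - -y| = |x - y| := by rw [← abs_neg]; congr 1; ring
    have e2 : ∀ z, |-x - -z| = |x - z| := fun z => by rw [← abs_neg]; congr 1; ring
    simp only [e1, e2]
  integrable_sq y := (h.integrable_sq (-y)).comp_neg
  tendsto_zero y := (h.tendsto_zero (-y)).comp (Homeomorph.neg ℝ).isClosedEmbedding.tendsto_cocompact

/-- The logarithmic derivative of the decaying solution at `-∞`. -/
def logSlope (κ : ℝ) (f : ℝ → ℝ) (G : ℝ → ℝ → ℝ) (x : ℝ) : ℝ :=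
  (1 - rightInt κ (fun z => f z * G z x) x + leftInt κ (fun z => f z * G z x) x) / (2 * G x x)

namespace IsGreenFn

theorem continuous_left (h : IsGreenFn κ f G) (y : ℝ) : Continuous fun x => G x y :=
  h.continuous.comp (by fun_prop : Continuous fun z : ℝ => (z, y))

theorem continuous_diag (h : IsGreenFn κ f G) : Continuous fun x => G x x :=
  h.continuous.comp (by fun_prop : Continuous fun z : ℝ => (z, z))

theorem diag_pos (h : IsGreenFn κ f G) (x : ℝ) : 0 < G x x := by
  obtain ⟨c, hc, h1⟩ := h.diag_ge
  exact hc.trans_le (h1 x)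

theorem integrable_mul (h : IsGreenFn κ f G) (y : ℝ) : Integrable fun z => f z * G z y := by
  obtain ⟨C, hC⟩ := h.bounded
  exact h.integrable_pot.mul_bdd (c := C) (h.continuous_left y).aestronglyMeasurable
    (Eventually.of_forall fun z => hC z y)

theorem continuous_mul (h : IsGreenFn κ f G) (y : ℝ) : Continuous fun z => f z * G z y :=
  h.continuous_pot.mul (h.continuous_left y)

theorem continuous_logSlope (h : IsGreenFn κ f G) : Continuous (logSlope κ f G) := by
  obtain ⟨C, hC⟩ := h.bounded
  have h1 := continuous_rightInt_diag h.kappa_pos h.integrable_pot h.continuous hC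
  have h2 : Continuous fun x => leftInt κ (fun z => f z * G z x) x := by
    obtain ⟨C, hC⟩ := h.reflect.bounded
    have h3 := continuous_rightInt_diag h.kappa_pos h.reflect.integrable_pot h.reflect.continuous hC
    have h4 := h3.comp continuous_neg
    simp only [leftInt_eq]
    simpa [Function.comp_def] using h4
  exact ((continuous_const.sub h1).add h2).div (continuous_const.mul h.continuous_diag)
    fun x => (mul_pos two_pos (h.diag_pos x)).ne'

theorem eqn_left (h : IsGreenFn κ f G) {x y : ℝ} (hxy : x ≤ y) :
    2 * κ * G x y = (Real.exp (κ * (x - y)) - rightInt κ (fun z => f z * G z y) x) -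
      leftInt κ (fun z => f z * G z y) x := by
  rw [h.eqn, integral_exp_abs_mul h.kappa_pos (h.integrable_mul y),
    abs_of_nonpos (sub_nonpos.2 hxy)]
  rw [show -κ * -(x - y) = κ * (x - y) by ring]; ring

/-- The growing component of `G(·, y)` to the left of `y`. -/
def compA (κ : ℝ) (f : ℝ → ℝ) (G : ℝ → ℝ → ℝ) (y x : ℝ) : ℝ :=
  Real.exp (κ * (x - y)) - rightInt κ (fun z => f z * G z y) x

theorem hasDerivAt_compA (h : IsGreenFn κ f G) (y x : ℝ) :
    HasDerivAt (compA κ f G y) (κ * compA κ f G y x + f x * G x y) x := by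
  have h1 := hasDerivAt_rightInt h.kappa_pos (h.integrable_mul y) (h.continuous_mul y) x
  have h2 : HasDerivAt (fun w => Real.exp (κ * (w - y))) (Real.exp (κ * (x - y)) * (κ * 1)) x :=
    (((hasDerivAt_id x).sub_const y).const_mul κ).exp
  refine (h2.sub h1).congr_deriv ?_
  unfold compA; ring

/-- To the left of both y and y' the functions G(·,y) and G(·,y') solve the same equation, and this
expression is their Wronskian up to the factor 2κ. It is constant there, and it tends to 0 at −∞
since `leftInt` decays while `compA` stays bounded. -/
theorem wronskian_eq_zero (h : IsGreenFn κ f G) {x y y' : ℝ} (hy : x ≤ y) (hy' : x ≤ y') :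
    compA κ f G y x * leftInt κ (fun z => f z * G z y') x -
      compA κ f G y' x * leftInt κ (fun z => f z * G z y) x = 0 := by
  set W : ℝ → ℝ := fun x => compA κ f G y x * leftInt κ (fun z => f z * G z y') x -
      compA κ f G y' x * leftInt κ (fun z => f z * G z y) x with hW
  have hd : ∀ t, t ≤ x → HasDerivAt W 0 t := by
    intro t ht
    have l1 := hasDerivAt_leftInt h.kappa_pos (h.integrable_mul y) (h.continuous_mul y) t
    have l2 := hasDerivAt_leftInt h.kappa_pos (h.integrable_mul y') (h.continuous_mul y') t
    refine (((h.hasDerivAt_compA y t).mul l2).sub ((h.hasDerivAt_compA y' t).mul l1)).congr_deriv ?_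
    have e1 := h.eqn_left (ht.trans hy)
    have e2 := h.eqn_left (ht.trans hy')
    have e1' : 2 * κ * G t y = compA κ f G y t - leftInt κ (fun z => f z * G z y) t := e1
    have e2' : 2 * κ * G t y' = compA κ f G y' t - leftInt κ (fun z => f z * G z y') t := e2
    linear_combination (-f t * G t y') * e1' + (f t * G t y) * e2'
  have hconst : ∀ t, t ≤ x → W x = W t := fun t ht =>
    constant_of_has_deriv_right_zero
      (fun s hs => (hd s hs.2).continuousAt.continuousWithinAt)
      (fun s hs => (hd s hs.2.le).hasDerivWithinAt) x ⟨ht, le_rfl⟩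
  have hb : ∀ y, ∀ t, t ≤ y → |compA κ f G y t| ≤ 1 + ∫ z, |f z * G z y| := by
    intro y t ht
    unfold compA
    refine (abs_sub _ _).trans (add_le_add ?_ (abs_rightInt_le h.kappa_pos (h.integrable_mul y) t))
    rw [Real.abs_exp, Real.exp_le_one_iff]
    nlinarith [h.kappa_pos]
  have hlim : ∀ y y', Tendsto (fun t => compA κ f G y t * leftInt κ (fun z => f z * G z y') t)
      atBot (𝓝 0) := by
    intro y y'
    refine isBoundedUnder_le_mul_tendsto_zero (f := compA κ f G y) ?_
      (tendsto_leftInt h.kappa_pos (h.integrable_mul y'))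
    refine isBoundedUnder_of_eventually_le (a := 1 + ∫ z, |f z * G z y|) ?_
    filter_upwards [eventually_le_atBot y] with t ht
    exact hb y t ht
  have h0 : Tendsto W atBot (𝓝 0) := by
    have := (hlim y y').sub (hlim y' y)
    rwa [sub_zero] at this
  have h1 : Tendsto W atBot (𝓝 (W x)) := by
    refine tendsto_const_nhds.congr' ?_
    filter_upwards [eventually_le_atBot x] with t ht
    exact hconst t ht
  exact tendsto_nhds_unique h1 h0

/-- By the vanishing Wronskian the logarithmic derivative of G(·,y) at x is the same for all y > x;
letting the pole be x itself gives `logSlope`. -/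
theorem hasDerivAt_left (h : IsGreenFn κ f G) {x y : ℝ} (hxy : x < y) :
    HasDerivAt (fun x => G x y) (logSlope κ f G x * G x y) x := by
  have hκ := h.kappa_pos
  have hg := h.diag_pos x
  have l1 := hasDerivAt_leftInt h.kappa_pos (h.integrable_mul y) (h.continuous_mul y) x
  have h1 := ((h.hasDerivAt_compA y x).sub l1).div_const (2 * κ)
  have h2 : HasDerivAt (fun x => G x y) ((κ * compA κ f G y x + f x * G x y -
      (-κ * leftInt κ (fun z => f z * G z y) x + f x * G x y)) / (2 * κ)) x := by
    refine h1.congr_of_eventuallyEq ?_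
    filter_upwards [gt_mem_nhds hxy] with t ht
    have := h.eqn_left ht.le
    simp only [Pi.sub_apply]
    rw [eq_div_iff (by positivity), mul_comm, this]; rfl
  refine h2.congr_deriv ?_
  have hw := h.wronskian_eq_zero hxy.le le_rfl
  have e1 : 2 * κ * G x y = compA κ f G y x - leftInt κ (fun z => f z * G z y) x :=
    h.eqn_left hxy.le
  have e2 : 2 * κ * G x x = compA κ f G x x - leftInt κ (fun z => f z * G z x) x :=
    h.eqn_left le_rfl
  have e3 : 1 - rightInt κ (fun z => f z * G z x) x = compA κ f G x x := by simp [compA]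
  rw [logSlope, e3]
  set A := compA κ f G y x
  set B := leftInt κ (fun z => f z * G z y) x
  set α := compA κ f G x x
  set β := leftInt κ (fun z => f z * G z x) x
  have e4 : (A + B) * (2 * κ * G x x) = (α + β) * (2 * κ * G x y) := by
    rw [e1, e2]; linear_combination (-2) * hw
  have e5 : (A + B) * G x x = (α + β) * G x y := by
    have h3 : (2 * κ) * ((A + B) * G x x) = (2 * κ) * ((α + β) * G x y) := by
      linear_combination e4
    exact mul_left_cancel₀ (by positivity) h3
  have e6 : (κ * A + f x * G x y - (-κ * B + f x * G x y)) / (2 * κ) = (A + B) / 2 := by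
    field_simp; ring
  rw [e6, div_mul_eq_mul_div, div_eq_div_iff two_ne_zero (by positivity)]
  linear_combination 2 * e5

/-- e^M is the solution decaying at −∞, and on x ≤ y the function G(·,y) is a multiple of it. A
primitive of the slope avoids constructing this solution directly. -/
theorem exists_primitive (h : IsGreenFn κ f G) : ∃ M : ℝ → ℝ,
    (∀ x, HasDerivAt M (logSlope κ f G x) x) ∧
      ∀ x y, x ≤ y → G x y = G y y * Real.exp (M x - M y) := by
  have hc := h.continuous_logSlope
  let M : ℝ → ℝ := fun x => ∫ t in (0 : ℝ)..x, logSlope κ f G t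
  have hM : ∀ x, HasDerivAt M (logSlope κ f G x) x := fun x =>
    intervalIntegral.integral_hasDerivAt_right (hc.intervalIntegrable _ _)
      hc.stronglyMeasurable.stronglyMeasurableAtFilter hc.continuousAt
  refine ⟨M, hM, fun x y hxy => ?_⟩
  have hMc : Continuous M := continuous_iff_continuousAt.2 fun x => (hM x).continuousAt
  have h1 := constant_of_has_deriv_right_zero (f := fun t => G t y * Real.exp (-M t))
    (a := x) (b := y) ((h.continuous_left y).mul (by fun_prop)).continuousOn (fun t ht => by
      have h2 := (h.hasDerivAt_left ht.2).mul (hM t).neg.exp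
      refine (h2.congr_deriv ?_).hasDerivWithinAt
      ring) y ⟨hxy, le_rfl⟩
  rw [show M x - M y = -M y + M x by ring, Real.exp_add, ← mul_assoc, h1, mul_assoc,
    ← Real.exp_add]
  simp

/-- The reflected slope is minus the logarithmic derivative of the solution decaying at +∞. That the
slopes differ by 1/g is the unit jump of ∂G across the diagonal. -/
theorem logSlope_reflect (h : IsGreenFn κ f G) (x : ℝ) :
    logSlope κ (fun x => f (-x)) (fun x y => G (-x) (-y)) (-x) =
      1 / G x x - logSlope κ f G x := by
  have hκ := h.kappa_pos
  have hg := h.diag_pos x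
  have e1 : rightInt κ (fun z => f (-z) * G (-z) (- -x)) (-x) =
      leftInt κ (fun z => f z * G z x) x := by rw [leftInt_eq, neg_neg]
  have e2 : leftInt κ (fun z => f (-z) * G (-z) (- -x)) (-x) =
      rightInt κ (fun z => f z * G z x) x := by rw [leftInt_eq]; simp only [neg_neg]
  rw [logSlope, logSlope, e1, e2, neg_neg]
  field_simp; ring

/-- With m = `logSlope`, for x < y one has ∂ₓG = mG and g' = 2mg − 1, so G(x,y)²/g(x) has derivative
G(x,y)²/g(x)². It vanishes at −∞ and equals g(y) at x = y. -/
theorem integral_Iic_sq (h : IsGreenFn κ f G) (y : ℝ) :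
    ∫ x in Iic y, G x y ^ 2 / G x x ^ 2 = G y y := by
  obtain ⟨M, hM, hM'⟩ := h.exists_primitive
  obtain ⟨N, hN, hN'⟩ := h.reflect.exists_primitive
  obtain ⟨c, hc, hdiag⟩ := h.diag_ge
  set n : ℝ → ℝ := fun x => N (-x) with hn
  have hnd : ∀ x, HasDerivAt n (logSlope κ f G x - 1 / G x x) x := fun x => by
    have := (hN (-x)).comp x (hasDerivAt_neg x)
    rw [h.logSlope_reflect] at this
    refine this.congr_deriv ?_
    ring
  -- Symmetry of G equates the factorization from the left with the one from the right; hence g is a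
  -- constant times exp(M + n), which gives g'.
  have hrel : ∀ x y, x ≤ y → G y y * Real.exp (M x - M y) = G x x * Real.exp (n y - n x) := by
    intro x y hxy
    have e1 := hM' x y hxy
    have e2 := hN' (-y) (-x) (neg_le_neg hxy)
    simp only [neg_neg] at e2
    rw [← e1, h.symm, e2]
  have hdg : ∀ x, HasDerivAt (fun x => G x x)
      (G x x * (2 * logSlope κ f G x - 1 / G x x)) x := by
    intro x
    have e : (fun x => G x x) = fun x => G 0 0 * Real.exp (M x + n x - M 0 - n 0) := by
      funext x
      rcases le_total 0 x with h0 | h0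
      · have := hrel 0 x h0
        have h2 := congrArg (fun t => t * Real.exp (M x - M 0)) this
        simp only [mul_assoc, ← Real.exp_add] at h2
        rw [show M 0 - M x + (M x - M 0) = 0 by ring, Real.exp_zero, mul_one] at h2
        rw [h2]; congr 2; ring
      · have := hrel x 0 h0
        have h2 := congrArg (fun t => t * Real.exp (n x - n 0)) this
        simp only [mul_assoc, ← Real.exp_add] at h2
        rw [show n 0 - n x + (n x - n 0) = 0 by ring, Real.exp_zero, mul_one] at h2
        rw [← h2]; congr 2; ring
    have h3 : HasDerivAt (fun x => G 0 0 * Real.exp (M x + n x - M 0 - n 0)) _ x :=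
      ((((hM x).add (hnd x)).sub_const (M 0)).sub_const (n 0)).exp.const_mul (G 0 0)
    rw [e]
    refine h3.congr_deriv ?_
    have h4 := congrFun e x
    rw [h4]
    simp only [Pi.add_apply]
    ring
  -- G(·,y) has a corner at y; the exponential formula continues it smoothly past y, so that F is
  -- differentiable there too.
  let F : ℝ → ℝ := fun x => (G y y * Real.exp (M x - M y)) ^ 2 / G x x
  have hF : ∀ x, x ≤ y → F x = G x y ^ 2 / G x x := fun x hx => by
    simp only [F]; rw [hM' x y hx]
  have hFd : ∀ x, HasDerivAt F ((G y y * Real.exp (M x - M y)) ^ 2 / G x x ^ 2) x := by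
    intro x
    have hg := h.diag_pos x
    have h1 : HasDerivAt (fun x => (G y y * Real.exp (M x - M y)) ^ 2) _ x :=
      ((((hM x).sub_const (M y)).exp).const_mul (G y y)).pow 2
    refine (h1.div (hdg x) hg.ne').congr_deriv ?_
    field_simp
    ring
  have h1 : ∫ x in Iic y, G x y ^ 2 / G x x ^ 2 =
      ∫ x in Iic y, (G y y * Real.exp (M x - M y)) ^ 2 / G x x ^ 2 :=
    setIntegral_congr_fun measurableSet_Iic fun x hx => by rw [hM' x y hx]
  have hint : Integrable fun x => G x y ^ 2 / G x x ^ 2 := by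
    have hm : Continuous fun x => (G x x ^ 2)⁻¹ :=
      (h.continuous_diag.pow 2).inv₀ fun x => pow_ne_zero 2 (h.diag_pos x).ne'
    simp only [div_eq_mul_inv]
    refine (h.integrable_sq y).mul_bdd (c := (c ^ 2)⁻¹) hm.aestronglyMeasurable
      (Eventually.of_forall fun x => ?_)
    rw [Real.norm_of_nonneg (by positivity)]
    exact inv_anti₀ (by positivity) (pow_le_pow_left₀ hc.le (hdiag x) 2)
  rw [h1, integral_Iic_of_hasDerivAt_of_tendsto (f := F) (m := 0)
    (hFd y).continuousAt.continuousWithinAt (fun x _ => hFd x), sub_zero, hF y le_rfl]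
  · have := (h.diag_pos y).ne'
    field_simp
  · exact hint.integrableOn.congr_fun (fun x hx => by beta_reduce; rw [hM' x y hx])
      measurableSet_Iic
  · have h2 : Tendsto (fun x => G x y ^ 2) atBot (𝓝 0) := by
      have := ((h.tendsto_zero y).mono_left _root_.atBot_le_cocompact).pow 2
      simpa using this
    have h3 : Tendsto (fun x => G x y ^ 2 * c⁻¹) atBot (𝓝 0) := by
      simpa using h2.mul_const c⁻¹
    refine squeeze_zero' ?_ ?_ h3
    · exact Eventually.of_forall fun x => div_nonneg (sq_nonneg _) (h.diag_pos x).le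
    · filter_upwards [eventually_le_atBot y] with x hx
      rw [hF x hx, div_eq_mul_inv]
      exact mul_le_mul_of_nonneg_left (inv_anti₀ hc (hdiag x)) (sq_nonneg _)

theorem integrable_sq_div (h : IsGreenFn κ f G) (y : ℝ) :
    Integrable fun x => G x y ^ 2 / (2 * G x x ^ 2) := by
  obtain ⟨c, hc, hdiag⟩ := h.diag_ge
  have hm : Continuous fun x => (2 * G x x ^ 2)⁻¹ :=
    (continuous_const.mul (h.continuous_diag.pow 2)).inv₀ fun x =>
      mul_ne_zero two_ne_zero (pow_ne_zero 2 (h.diag_pos x).ne')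
  simp only [div_eq_mul_inv]
  refine (h.integrable_sq y).mul_bdd (c := (2 * c ^ 2)⁻¹) hm.aestronglyMeasurable
    (Eventually.of_forall fun x => ?_)
  rw [Real.norm_of_nonneg (by positivity)]
  exact inv_anti₀ (by positivity)
    (mul_le_mul_of_nonneg_left (pow_le_pow_left₀ hc.le (hdiag x) 2) two_pos.le)

/-- The derivative of `∫ 1 / (2 g)` in the direction of a point mass at `y` is `g y`. -/
theorem integral_sq_div (h : IsGreenFn κ f G) (y : ℝ) :
    ∫ x, G x y ^ 2 / (2 * G x x ^ 2) = G y y := by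
  have hi := h.integrable_sq_div y
  have h1 := h.integral_Iic_sq y
  -- The half-line x > y follows by reflection; each half contributes g(y)/2.
  have h2 := h.reflect.integral_Iic_sq (-y)
  rw [integral_comp_neg_Iic (-y) fun x => G x (- -y) ^ 2 / G x x ^ 2] at h2
  simp only [neg_neg] at h2
  rw [← intervalIntegral.integral_Iic_add_Ioi (b := y) hi.integrableOn hi.integrableOn]
  have e : ∀ x, G x y ^ 2 / (2 * G x x ^ 2) = 2⁻¹ * (G x y ^ 2 / G x x ^ 2) := fun x => by
    rw [mul_comm, ← div_div]; ring
  simp only [e]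
  rw [integral_const_mul, integral_const_mul, h1, h2]
  ring

end IsGreenFn

end GreenODE

/-! ### The trace formula -/

section Subgradient

/-- Two functions on `[0, 1]` with a common subgradient have the same increment. -/
theorem eq_of_common_subgradient {F H D : ℝ → ℝ}
    (hF : ∀ s ∈ Set.Icc (0 : ℝ) 1, ∀ t ∈ Set.Icc (0 : ℝ) 1, (t - s) * D s ≤ F t - F s)
    (hH : ∀ s ∈ Set.Icc (0 : ℝ) 1, ∀ t ∈ Set.Icc (0 : ℝ) 1, (t - s) * D s ≤ H t - H s)
    (h0 : F 0 = H 0) : F 1 = H 1 := by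
  -- On a partition into n equal pieces, both increments over a piece lie between D/n at its two
  -- ends. The differences telescope to (D(1) − D(0))/n, so no regularity of D is needed.
  have step : ∀ n : ℕ, 0 < n → (n : ℝ) * |F 1 - H 1| ≤ D 1 - D 0 := by
    intro n hn
    have hn' : (0 : ℝ) < n := Nat.cast_pos.2 hn
    let K : ℕ → ℝ := fun i => F (i / n) - H (i / n)
    have hmem : ∀ i : ℕ, i ≤ n → (i / n : ℝ) ∈ Set.Icc (0 : ℝ) 1 := fun i hi =>
      ⟨by positivity, by rw [div_le_one hn']; exact_mod_cast hi⟩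
    have hK : ∀ i ∈ Finset.range n,
        |K (i + 1) - K i| ≤ (D ((i + 1 : ℕ) / n) - D ((i : ℕ) / n)) / n := by
      intro i hi
      have hi' := Finset.mem_range.1 hi
      have m1 := hmem i hi'.le
      have m2 := hmem (i + 1) hi'
      have e : ((i + 1 : ℕ) / n : ℝ) - (i : ℕ) / n = 1 / n := by push_cast; ring
      have f1 := hF _ m1 _ m2
      have f2 := hF _ m2 _ m1
      have g1 := hH _ m1 _ m2
      have g2 := hH _ m2 _ m1
      rw [← neg_sub, neg_mul] at f2 g2
      rw [e] at f1 f2 g1 g2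
      have e2 : ∀ u v : ℝ, (u - v) / n = 1 / n * u - 1 / n * v := fun u v => by ring
      simp only [K]
      rw [e2, abs_le]
      constructor <;> linarith
    have h1 := (Finset.abs_sum_le_sum_abs (fun i => K (i + 1) - K i) (Finset.range n)).trans
      (Finset.sum_le_sum hK)
    rw [Finset.sum_range_sub, ← Finset.sum_div,
      Finset.sum_range_sub fun i : ℕ => D ((i : ℕ) / n)] at h1
    simp only [K, Nat.cast_zero, zero_div, h0, sub_self, sub_zero, div_self hn'.ne'] at h1
    rwa [le_div_iff₀ hn', mul_comm] at h1
  by_contra hne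
  have hpos : 0 < |F 1 - H 1| := abs_pos.2 (sub_ne_zero.2 hne)
  obtain ⟨n, hn⟩ := exists_nat_gt ((D 1 - D 0) / |F 1 - H 1|)
  rw [div_lt_iff₀ hpos] at hn
  have h1 := step (n + 1) n.succ_pos
  push_cast at h1
  linarith

end Subgradient

/-! ### Integration of the subgradient in x -/

section Fubini

open Filter Topology

variable {κ : ℝ} {f : ℝ → ℝ} {G : ℝ → ℝ → ℝ}

/-- The inner integral in x is known exactly from `integral_sq_div`: it is |F(z)| g(z), and g is
bounded. -/
theorem IsGreenFn.integrable_prod (h : IsGreenFn κ f G) {F : ℝ → ℝ} (hF : Integrable F)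
    (hc : Continuous F) :
    Integrable (fun p : ℝ × ℝ => F p.2 * (G p.1 p.2 ^ 2 / (2 * G p.1 p.1 ^ 2)))
      (volume.prod volume) := by
  obtain ⟨C, hC⟩ := h.bounded
  have hd : Continuous fun p : ℝ × ℝ => G p.1 p.1 := h.continuous_diag.comp continuous_fst
  have hcont : Continuous fun p : ℝ × ℝ => F p.2 * (G p.1 p.2 ^ 2 / (2 * G p.1 p.1 ^ 2)) :=
    (hc.comp continuous_snd).mul ((h.continuous.pow 2).div (continuous_const.mul (hd.pow 2))
      fun p => mul_ne_zero two_ne_zero (pow_ne_zero 2 (h.diag_pos p.1).ne'))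
  rw [integrable_prod_iff' hcont.aestronglyMeasurable]
  refine ⟨Eventually.of_forall fun z => (h.integrable_sq_div z).const_mul (F z), ?_⟩
  have e : ∀ z, ∫ x, ‖F z * (G x z ^ 2 / (2 * G x x ^ 2))‖ = ‖F z‖ * G z z := fun z => by
    rw [← h.integral_sq_div z, ← integral_const_mul]
    refine integral_congr_ae (Eventually.of_forall fun x => ?_)
    simp only
    rw [norm_mul, Real.norm_of_nonneg (r := G x z ^ 2 / _) (by positivity)]
  simp only [e]
  exact hF.norm.mul_bdd (c := C) h.continuous_diag.aestronglyMeasurable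
    (Eventually.of_forall fun z => hC z z)

theorem IsGreenFn.integral_integral (h : IsGreenFn κ f G) {F : ℝ → ℝ} (hF : Integrable F)
    (hc : Continuous F) :
    ∫ x, ∫ z, F z * (G x z ^ 2 / (2 * G x x ^ 2)) = ∫ z, F z * G z z := by
  rw [integral_integral_swap (h.integrable_prod hF hc)]
  refine integral_congr_ae (Eventually.of_forall fun z => ?_)
  simp only
  rw [integral_const_mul, h.integral_sq_div]

end Fubini

/-! ### The identity α = −log det₂ for Schwartz potentials -/

section SchwartzPotential

open scoped InnerProductSpace ComplexConjugate
open Filter Topology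

variable {κ : ℝ} (f : 𝓢(ℝ, ℂ)) (hf : ∀ x, (f x).im = 0)

theorem integrable_re_schwartz : Integrable fun x => (f x).re :=
  (f.integrable (μ := volume)).re

theorem continuous_re_schwartz : Continuous fun x => (f x).re :=
  Complex.continuous_re.comp f.continuous

theorem inner_sand_ofSchwartz_self (hκ : 1 ≤ κ) {φ ψ : L2} {u v : ℝ → ℝ}
    (hu : ∀ z, ⟪kerE κ hκ z, φ⟫_ℂ = (u z : ℂ)) (hv : ∀ z, ⟪kerE κ hκ z, ψ⟫_ℂ = (v z : ℂ)) :
    ⟪φ, sand κ hκ (ofSchwartz f hf) ψ⟫_ℂ = ((∫ z, (f z).re * (u z * v z) : ℝ) : ℂ) := by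
  rw [inner_sand_ofSchwartz hκ, ← integral_complex_ofReal]
  refine integral_congr_ae (Eventually.of_forall fun z => ?_)
  simp only
  rw [hu, hv, Complex.conj_ofReal]
  have : f z = ((f z).re : ℂ) := by apply Complex.ext <;> simp [hf z]
  rw [this]
  push_cast
  simp

theorem abs_greenKer_le (hκ : 1 ≤ κ) {q : HMinusOne} (hq : ‖q‖ ≤ 1 / 2) (x y : ℝ) :
    |greenKer κ hκ q x y| ≤ 2 := by
  rw [← Real.norm_eq_abs, ← Complex.norm_real, ← inner_kerE_opInv hκ hq]
  refine (norm_inner_le_norm _ _).trans ?_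
  have h1 := norm_kerE_le_one hκ x
  have h2 := norm_kerE_le_one hκ y
  have h3 := norm_opInv_apply_le (norm_sand_le_half hκ hq) (kerE κ hκ y)
  have h4 := norm_nonneg (opInv (sand κ hκ q) (kerE κ hκ y))
  nlinarith [norm_nonneg (kerE κ hκ x)]

theorem isGreenFn_greenKer (hκ : 1 ≤ κ) {s : ℝ} (hq : ‖s • ofSchwartz f hf‖ ≤ 1 / 2) :
    IsGreenFn κ (fun z => s * (f z).re) (greenKer κ hκ (s • ofSchwartz f hf)) where
  kappa_pos := by linarith
  continuous_pot := continuous_const.mul (continuous_re_schwartz f)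
  integrable_pot := (integrable_re_schwartz f).const_mul s
  continuous := continuous_greenKer hκ _
  bounded := ⟨2, abs_greenKer_le hκ hq⟩
  symm := greenKer_symm hκ hq
  diag_ge := ⟨1 / (9 * κ), by positivity, greenKer_self_ge hκ hq⟩
  eqn x y := by
    have hκ0 : 0 < κ := by linarith
    -- The integral equation is (1+A)(1+A)⁻¹E_y = E_y paired with E_x, the form of A being an
    -- integral against sf.
    have h1 := congrArg (fun v => ⟪kerE κ hκ x, v⟫_ℂ)
      (apply_opInv (norm_sand_le_half hκ hq) (kerE κ hκ y))
    simp only [inner_add_right] at h1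
    rw [inner_kerE_opInv hκ hq, inner_kerE_kerE, sand_smul, smul_apply, inner_smul_right,
      ← sand_smul, inner_sand_ofSchwartz_self f hf hκ (fun z => inner_kerE_kerE hκ z x)
        (fun z => inner_kerE_opInv hκ hq z y)] at h1
    norm_cast at h1
    have h2 : 2 * κ * (s * ∫ z, (f z).re * (Real.exp (-κ * |z - x|) / (2 * κ) *
        greenKer κ hκ (s • ofSchwartz f hf) z y)) = ∫ z, Real.exp (-κ * |x - z|) *
          (s * (f z).re * greenKer κ hκ (s • ofSchwartz f hf) z y) := by
      rw [← mul_assoc, ← integral_const_mul]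
      refine integral_congr_ae (Eventually.of_forall fun z => ?_)
      simp only
      rw [abs_sub_comm z x]
      field_simp
    rw [← h2, eq_sub_iff_add_eq, ← mul_add, h1]
    field_simp
  integrable_sq y := by
    have h := (memLp_greenKer hκ hq y).integrable_norm_pow two_ne_zero
    refine h.congr (Eventually.of_forall fun x => ?_)
    simp only [Complex.norm_real, Real.norm_eq_abs, sq_abs]
    rw [greenKer_symm hκ hq]
  tendsto_zero y := by
    have h := tendsto_inner_kerE hκ (opInv (sand κ hκ (s • ofSchwartz f hf)) (kerE κ hκ y))
    have h2 := (Complex.continuous_re.tendsto 0).comp h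
    simpa [Function.comp_def, greenKer] using h2

theorem form_minVec (hκ : 1 ≤ κ) {p : HMinusOne} (hp : ‖p‖ ≤ 1 / 2) (x : ℝ) :
    1 / 2 * (⟪minVec κ hκ p x, sand κ hκ (ofSchwartz f hf) (minVec κ hκ p x)⟫_ℂ).re =
      ∫ z, (f z).re * (greenKer κ hκ p x z ^ 2 / (2 * greenKer κ hκ p x x ^ 2)) := by
  have h : ∀ z, ⟪kerE κ hκ z, minVec κ hκ p x⟫_ℂ =
      ((greenKer κ hκ p x z / greenKer κ hκ p x x : ℝ) : ℂ) := fun z => by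
    rw [minVec, inner_smul_right, inner_kerE_opInv hκ hp, greenKer_symm hκ hp x z,
      ← Complex.ofReal_mul]
    congr 1; ring
  rw [inner_sand_ofSchwartz_self f hf hκ h h, Complex.ofReal_re, ← integral_const_mul]
  refine integral_congr_ae (Eventually.of_forall fun z => ?_)
  have := (greenKer_self_pos hκ hp x).ne'
  simp only
  field_simp

/-- By `subgrad_zero` the linear term is the minimizer term at p = 0, so both halves have the same
shape and the same identity integrates them. -/
theorem subgrad_ofSchwartz (hκ : 1 ≤ κ) {p : HMinusOne} (hp : ‖p‖ ≤ 1 / 2) (x : ℝ) :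
    subgrad κ hκ p (ofSchwartz f hf) x =
      (∫ z, (f z).re * (greenKer κ hκ 0 x z ^ 2 / (2 * greenKer κ hκ 0 x x ^ 2))) -
        ∫ z, (f z).re * (greenKer κ hκ p x z ^ 2 / (2 * greenKer κ hκ p x x ^ 2)) := by
  have h := subgrad_zero hκ (ofSchwartz f hf) x
  rw [subgrad] at h ⊢
  rw [← form_minVec f hf hκ hp, ← form_minVec f hf hκ (p := 0) (by simp), ← sub_eq_zero.1 h]

theorem isGreenFn_greenKer_zero (hκ : 1 ≤ κ) : IsGreenFn κ (fun _ => 0) (greenKer κ hκ 0) := by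
  have h := isGreenFn_greenKer 0 (fun _ => by simp) hκ (s := 0) (by simp)
  simpa using h

theorem integrable_subgrad (hκ : 1 ≤ κ) {s : ℝ} (hs : ‖s • ofSchwartz f hf‖ ≤ 1 / 2) :
    Integrable (subgrad κ hκ (s • ofSchwartz f hf) (ofSchwartz f hf)) := by
  rw [show subgrad κ hκ (s • ofSchwartz f hf) (ofSchwartz f hf) = _ from
    funext (subgrad_ofSchwartz f hf hκ hs)]
  have hF := integrable_re_schwartz f
  have hc := continuous_re_schwartz f
  exact ((isGreenFn_greenKer_zero hκ).integrable_prod hF hc).integral_prod_left.sub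
    ((isGreenFn_greenKer f hf hκ hs).integrable_prod hF hc).integral_prod_left

theorem integral_subgrad (hκ : 1 ≤ κ) {s : ℝ} (hs : ‖s • ofSchwartz f hf‖ ≤ 1 / 2) :
    ∫ x, subgrad κ hκ (s • ofSchwartz f hf) (ofSchwartz f hf) x =
      ∫ z, (f z).re * (1 / (2 * κ) - greenKer κ hκ (s • ofSchwartz f hf) z z) := by
  have hF := integrable_re_schwartz f
  have hc := continuous_re_schwartz f
  have g0 := isGreenFn_greenKer_zero hκ
  have g1 := isGreenFn_greenKer f hf hκ hs
  rw [show subgrad κ hκ (s • ofSchwartz f hf) (ofSchwartz f hf) = _ from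
    funext (subgrad_ofSchwartz f hf hκ hs)]
  rw [integral_sub (g0.integrable_prod hF hc).integral_prod_left
    (g1.integrable_prod hF hc).integral_prod_left, g0.integral_integral hF hc,
    g1.integral_integral hF hc, ← integral_sub]
  · refine integral_congr_ae (Eventually.of_forall fun z => ?_)
    simp only [greenKer_zero]
    ring
  · exact hF.mul_bdd (c := 2) g0.continuous_diag.aestronglyMeasurable
      (Eventually.of_forall fun z => abs_greenKer_le hκ (by simp) z z)
  · exact hF.mul_bdd (c := 2) g1.continuous_diag.aestronglyMeasurable
      (Eventually.of_forall fun z => abs_greenKer_le hκ hs z z)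

theorem alpha_sub_ge (hκ : 1 ≤ κ) {s t : ℝ} (hs : ‖s • ofSchwartz f hf‖ ≤ 1 / 2)
    (ht : ‖t • ofSchwartz f hf‖ ≤ 1 / 2) :
    (t - s) * ∫ z, (f z).re * (1 / (2 * κ) - greenKer κ hκ (s • ofSchwartz f hf) z z) ≤
      alpha κ (t • ofSchwartz f hf) - alpha κ (s • ofSchwartz f hf) := by
  rw [← integral_subgrad f hf hκ hs, alpha, alpha,
    ← integral_sub (integrable_rho hκ ht) (integrable_rho hκ hs), ← integral_const_mul]
  refine integral_mono ((integrable_subgrad f hf hκ hs).const_mul _)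
    ((integrable_rho hκ ht).sub (integrable_rho hκ hs)) fun x => ?_
  have h := rho_subgrad hκ hs ht x
  rw [← sub_smul, subgrad_smul] at h
  have := sq_nonneg ‖minVec κ hκ (s • ofSchwartz f hf) x - minVec κ hκ (t • ofSchwartz f hf) x‖
  simp only
  linarith

/-- Expansion of ⟨E_z, (1 − (1+A)⁻¹)E_z⟩ in eigenvectors, with 1 − 1/(1+μ) = μ/(1+μ). -/
theorem hasSum_eigen_green (hκ : 1 ≤ κ) {q : HMinusOne} (hq : ‖q‖ ≤ 1 / 2) {ι : Type*}
    (b : HilbertBasis ι ℂ L2) {μ : ι → ℝ} (h : ∀ i, sand κ hκ q (b i) = (μ i : ℂ) • b i) (z : ℝ) :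
    HasSum (fun i => μ i / (1 + μ i) * ‖⟪b i, kerE κ hκ z⟫_ℂ‖ ^ 2)
      (1 / (2 * κ) - greenKer κ hκ q z z) := by
  have hA := norm_sand_le_half hκ hq
  have h1 := b.hasSum_inner_mul_inner (kerE κ hκ z) (kerE κ hκ z - opInv (sand κ hκ q) (kerE κ hκ z))
  rw [inner_sub_right, inner_kerE_opInv hκ hq, inner_kerE_kerE] at h1
  have h2 : ∀ i, ⟪kerE κ hκ z, b i⟫_ℂ * ⟪b i, kerE κ hκ z - opInv (sand κ hκ q) (kerE κ hκ z)⟫_ℂ =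
      ((μ i / (1 + μ i) * ‖⟪b i, kerE κ hκ z⟫_ℂ‖ ^ 2 : ℝ) : ℂ) := fun i => by
    have hμ := (abs_eigenvalue_le (h i) (b.orthonormal.1 i)).trans hA
    have hμ1 : (1 + μ i) ≠ 0 := by linarith [(abs_le.1 hμ).1]
    have hμ2 : ((1 : ℂ) + μ i) ≠ 0 := by exact_mod_cast hμ1
    have e : opInv (sand κ hκ q) (b i) = ((1 : ℂ) + μ i)⁻¹ • b i := by
      symm
      have e1 : b i + (μ i : ℂ) • b i = ((1 : ℂ) + μ i) • b i := by rw [add_smul, one_smul]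
      rw [← eq_opInv hA, map_smul, h, ← smul_add, e1, smul_smul, inv_mul_cancel₀ hμ2, one_smul]
    rw [inner_sub_right, ← inner_opInv_left hA (inner_sand_left hκ q), e, inner_smul_left,
      ← inner_conj_symm (kerE κ hκ z)]
    have e2 : conj ((1 : ℂ) + μ i)⁻¹ = ((1 : ℂ) + μ i)⁻¹ := by simp
    have e3 := Complex.conj_mul' ⟪b i, kerE κ hκ z⟫_ℂ
    rw [e2]
    push_cast
    rw [← e3]
    field_simp
    ring
  simp_rw [h2] at h1
  norm_cast at h1
  simpa using h1

/-- The expansion of the diagonal Green's function is integrated term by term, where ∫ f|⟨b_i,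
E_z⟩|² dz = ⟨b_i, A b_i⟩ = μ_i. The majorant sums to |f|‖E_z‖² = |f|/(2κ). -/
theorem hasSum_eigen_trace (hκ : 1 ≤ κ) {s : ℝ} (hs : ‖s • ofSchwartz f hf‖ ≤ 1 / 2) {w : Set L2}
    (b : HilbertBasis w ℂ L2) {μ : w → ℝ}
    (h : ∀ i, sand κ hκ (ofSchwartz f hf) (b i) = (μ i : ℂ) • b i) :
    HasSum (fun i => μ i * (s * μ i / (1 + s * μ i)))
      (∫ z, (f z).re * (1 / (2 * κ) - greenKer κ hκ (s • ofSchwartz f hf) z z)) := by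
  have hcount : Countable w := countable_of_hilbertBasis b
  have h' : ∀ i, sand κ hκ (s • ofSchwartz f hf) (b i) = ((s * μ i : ℝ) : ℂ) • b i := fun i => by
    rw [sand_smul, smul_apply, h, smul_smul, Complex.ofReal_mul]
  have hβ : ∀ i, |s * μ i / (1 + s * μ i)| ≤ 1 := fun i => by
    have hμ := (abs_eigenvalue_le (h' i) (b.orthonormal.1 i)).trans (norm_sand_le_half hκ hs)
    obtain ⟨h1, h2⟩ := abs_le.1 hμ
    rw [abs_div, div_le_one (abs_pos.2 (by linarith)), abs_of_pos (by linarith : 0 < 1 + s * μ i)]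
    exact hμ.trans (by linarith)
  have hc : ∀ i, Continuous fun z => ‖⟪b i, kerE κ hκ z⟫_ℂ‖ ^ 2 := fun i =>
    (continuous_const.inner (continuous_kerE hκ)).norm.pow 2
  have hF := integrable_re_schwartz f
  have key := hasSum_integral_of_dominated_convergence (μ := volume)
    (F := fun i z => (f z).re * (s * μ i / (1 + s * μ i) * ‖⟪b i, kerE κ hκ z⟫_ℂ‖ ^ 2))
    (f := fun z => (f z).re * (1 / (2 * κ) - greenKer κ hκ (s • ofSchwartz f hf) z z))
    (fun i z => |(f z).re| * ‖⟪b i, kerE κ hκ z⟫_ℂ‖ ^ 2)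
    (fun i => ((continuous_re_schwartz f).mul (continuous_const.mul (hc i))).aestronglyMeasurable)
    (fun i => Eventually.of_forall fun z => ?_)
    (Eventually.of_forall fun z => (hasSum_norm_inner_sq b (kerE κ hκ z)).summable.mul_left _) ?_
    (Eventually.of_forall fun z => (hasSum_eigen_green hκ hs b h' z).mul_left _)
  · refine key.congr_fun fun i => ?_
    have h1 := inner_sand_ofSchwartz hκ f hf (b i) (b i)
    rw [h, inner_smul_right, inner_self_eq_norm_sq_to_K, b.orthonormal.1 i] at h1
    have h2 : ∫ z, f z * (conj ⟪kerE κ hκ z, b i⟫_ℂ * ⟪kerE κ hκ z, b i⟫_ℂ) =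
        ((∫ z, (f z).re * ‖⟪b i, kerE κ hκ z⟫_ℂ‖ ^ 2 : ℝ) : ℂ) := by
      rw [← integral_complex_ofReal]
      refine integral_congr_ae (Eventually.of_forall fun z => ?_)
      have hz : f z = ((f z).re : ℂ) := by apply Complex.ext <;> simp [hf z]
      simp only
      rw [Complex.conj_mul', norm_inner_symm, hz]
      push_cast
      simp
    rw [h2] at h1
    have h3 : μ i = ∫ z, (f z).re * ‖⟪b i, kerE κ hκ z⟫_ℂ‖ ^ 2 := by
      have h4 : (μ i : ℂ) * ((1 : ℝ) : ℂ) ^ 2 =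
        ((∫ z, (f z).re * ‖⟪b i, kerE κ hκ z⟫_ℂ‖ ^ 2 : ℝ) : ℂ) := h1
      simpa using h4
    conv_lhs => rw [h3]
    rw [mul_comm, ← integral_const_mul, ← h3]
    refine integral_congr_ae (Eventually.of_forall fun z => ?_)
    simp only
    ring
  · rw [norm_mul, Real.norm_eq_abs, norm_mul, Real.norm_eq_abs, norm_pow, norm_norm]
    refine mul_le_mul_of_nonneg_left ?_ (abs_nonneg _)
    exact mul_le_of_le_one_left (sq_nonneg _) (hβ i)
  · simp_rw [tsum_mul_left, (hasSum_norm_inner_sq b _).tsum_eq, norm_kerE_sq]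
    exact hF.abs.mul_const _

/-- Along s ↦ sf the eigenvectors are fixed and the eigenvalues are sμ_i, so the scalar tangent-line
inequality may be summed. The lower bound is the same as in `alpha_sub_ge`. -/
theorem logDet_sub_ge (hκ : 1 ≤ κ) {s t : ℝ} (hs : ‖s • ofSchwartz f hf‖ ≤ 1 / 2)
    (ht : ‖t • ofSchwartz f hf‖ ≤ 1 / 2) :
    (t - s) * ∫ z, (f z).re * (1 / (2 * κ) - greenKer κ hκ (s • ofSchwartz f hf) z z) ≤
      logDet κ hκ (t • ofSchwartz f hf) - logDet κ hκ (s • ofSchwartz f hf) := by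
  obtain ⟨w, b, μ, h⟩ := exists_eigenbasis_sand hκ (ofSchwartz f hf)
  have h' : ∀ r : ℝ, ∀ i, sand κ hκ (r • ofSchwartz f hf) (b i) = ((r * μ i : ℝ) : ℂ) • b i :=
    fun r i => by rw [sand_smul, smul_apply, h, smul_smul, Complex.ofReal_mul]
  have hb : ∀ r : ℝ, ‖r • ofSchwartz f hf‖ ≤ 1 / 2 → ∀ i, |r * μ i| ≤ 1 / 2 := fun r hr i =>
    (abs_eigenvalue_le (h' r i) (b.orthonormal.1 i)).trans (norm_sand_le_half hκ hr)
  have hl : ∀ r : ℝ, ‖r • ofSchwartz f hf‖ ≤ 1 / 2 →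
      HasSum (fun i => logFactor (r * μ i)) (logDet κ hκ (r • ofSchwartz f hf)) := fun r hr => by
    rw [logDet_eq hκ hr b (h' r)]
    have hsum := (hasSum_eigen_sq (h' r) (hsInt_nonneg hκ _) (hsSq_sand hκ _ b)).summable
    exact (summable_logFactor hsum (hb r hr)).hasSum
  refine hasSum_le (fun i => ?_) ((hasSum_eigen_trace f hf hκ hs b h).mul_left (t - s))
    ((hl t ht).sub (hl s hs))
  have := logFactor_sub_ge (t := s * μ i) (t' := t * μ i) (by linarith [(abs_le.1 (hb s hs i)).1])
    (by linarith [(abs_le.1 (hb t ht i)).1])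
  refine le_trans (le_of_eq ?_) this
  ring

theorem logDet_zero (hκ : 1 ≤ κ) : logDet κ hκ 0 = 0 := by
  simp [logDet, sand_zero]

theorem alpha_zero (hκ : 1 ≤ κ) : alpha κ 0 = 0 := by
  simp [alpha, rho_zero hκ]

theorem alpha_eq_logDet_ofSchwartz (hκ : 1 ≤ κ) (h : ‖ofSchwartz f hf‖ ≤ 1 / 2) :
    alpha κ (ofSchwartz f hf) = logDet κ hκ (ofSchwartz f hf) := by
  have hs : ∀ s ∈ Set.Icc (0 : ℝ) 1, ‖s • ofSchwartz f hf‖ ≤ 1 / 2 := fun s hs => by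
    rw [norm_smul, Real.norm_of_nonneg hs.1]
    exact (mul_le_of_le_one_left (norm_nonneg _) hs.2).trans h
  have := eq_of_common_subgradient (F := fun s => alpha κ (s • ofSchwartz f hf))
    (H := fun s => logDet κ hκ (s • ofSchwartz f hf))
    (fun s h1 t h2 => alpha_sub_ge f hf hκ (hs s h1) (hs t h2))
    (fun s h1 t h2 => logDet_sub_ge f hf hκ (hs s h1) (hs t h2))
    (by simp [alpha_zero hκ, logDet_zero])
  simpa using this

end SchwartzPotential

/-! ### Extension from Schwartz potentials to the ball in H⁻¹ -/

section Density

open Filter Topology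

variable {κ : ℝ}

/-- A convex function on an open convex set that is bounded above near one point is continuous. This
spares a direct estimate of the dependence of α on q. -/
theorem continuousOn_alpha (hκ : 1 ≤ κ) :
    ContinuousOn (alpha κ) (Metric.ball (0 : HMinusOne) (1 / 2)) := by
  have hconv : ConvexOn ℝ (Metric.ball (0 : HMinusOne) (1 / 2)) (alpha κ) :=
    (convexOn_alpha hκ le_rfl).subset Metric.ball_subset_closedBall (convex_ball _ _)
  obtain ⟨C, hC⟩ := exists_alpha_le hκ
  have h0 : (0 : HMinusOne) ∈ Metric.ball (0 : HMinusOne) (1 / 2) := Metric.mem_ball_self (by norm_num)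
  have h := (hconv.continuousOn_tfae Metric.isOpen_ball ⟨0, h0⟩).out 3 1
  refine h.1 ⟨0, h0, C, ?_⟩
  rw [eventually_map]
  filter_upwards [Metric.ball_mem_nhds (0 : HMinusOne) (show (0 : ℝ) < 1 / 2 by norm_num)] with q hq
  exact hC q (mem_ball_zero_iff.1 hq).le

/-- Both sides are continuous at q and agree at Schwartz potentials arbitrarily close to q. -/
theorem alpha_eq_logDet (hκ : 1 ≤ κ) {q : HMinusOne} (hq : ‖q‖ < 1 / 2) :
    alpha κ q = logDet κ hκ q := by
  have hmem : Metric.ball (0 : HMinusOne) (1 / 2) ∈ 𝓝 q :=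
    Metric.isOpen_ball.mem_nhds (mem_ball_zero_iff.2 hq)
  have h1 : ContinuousAt (alpha κ) q := (continuousOn_alpha hκ).continuousAt hmem
  have h2 : ContinuousAt (logDet κ hκ) q := (analyticAt_logDet hκ (by linarith)).continuousAt
  have h3 : ∃ᶠ p in 𝓝 q, alpha κ p = logDet κ hκ p := by
    rw [Filter.frequently_iff]
    intro U hU
    obtain ⟨ε, hε, hU'⟩ := Metric.mem_nhds_iff.1 (inter_mem hU hmem)
    obtain ⟨f, hf, h⟩ := exists_ofSchwartz_near q hε
    have h4 := hU' (show ofSchwartz f hf ∈ Metric.ball q ε by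
      rwa [Metric.mem_ball, dist_comm, dist_eq_norm])
    exact ⟨_, h4.1, alpha_eq_logDet_ofSchwartz f hf hκ (mem_ball_zero_iff.1 h4.2).le⟩
  have h5 : Tendsto (fun p => alpha κ p - logDet κ hκ p) (𝓝 q) (𝓝 (alpha κ q - logDet κ hκ q)) :=
    h1.sub h2
  by_contra hne
  have h6 := h5.eventually_ne (sub_ne_zero.2 hne)
  obtain ⟨p, hp, hp'⟩ := (h3.and_eventually h6).exists
  exact hp' (sub_eq_zero.2 hp)

end Density

end KdV

end

/-! ### The main theorem -/

theorem proposition2p5 :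
    ∃ δ : ℝ, 0 < δ ∧ ∃ C : ℝ, 0 < C ∧ ∀ κ : ℝ, 1 ≤ κ →
      -- the Green's function is well defined, and the density lies in `L¹ ∩ H¹`
      (∀ q ∈ Metric.closedBall (0 : KdV.HMinusOne) δ,
        (∃! G : ℝ → ℝ → ℝ, KdV.IsGreen κ q G) ∧ (∀ x, 0 < KdV.g κ q x) ∧
        Integrable (KdV.rho κ q) ∧ KdV.MemH1 (fun x => (KdV.rho κ q x : ℂ))) ∧
      -- pointwise nonnegativity and convexity of the density
      (∀ x : ℝ,
        (∀ q ∈ Metric.closedBall (0 : KdV.HMinusOne) δ, 0 ≤ KdV.rho κ q x) ∧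
        ConvexOn ℝ (Metric.closedBall (0 : KdV.HMinusOne) δ) (fun q => KdV.rho κ q x)) ∧
      -- properties of the functional `α`
      (∀ q ∈ Metric.closedBall (0 : KdV.HMinusOne) δ, 0 ≤ KdV.alpha κ q) ∧
      AnalyticOnNhd ℝ (KdV.alpha κ) (Metric.closedBall (0 : KdV.HMinusOne) δ) ∧
      StrictConvexOn ℝ (Metric.closedBall (0 : KdV.HMinusOne) δ) (KdV.alpha κ) ∧
      (∀ q ∈ Metric.closedBall (0 : KdV.HMinusOne) δ,
        C⁻¹ * (1 / κ * ∫ ξ : ℝ, ‖q.hat ξ‖ ^ 2 / (ξ ^ 2 + 4 * κ ^ 2)) ≤ KdV.alpha κ q ∧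
        KdV.alpha κ q ≤ C * (1 / κ * ∫ ξ : ℝ, ‖q.hat ξ‖ ^ 2 / (ξ ^ 2 + 4 * κ ^ 2))) ∧
      -- the determinant formula
      (∀ q ∈ Metric.closedBall (0 : KdV.HMinusOne) δ,
        ∃ A : KdV.L2 →L[ℂ] KdV.L2, KdV.IsSandwich κ q A ∧ KdV.IsHilbertSchmidt A ∧
          ∃ d : ℝ, 0 < d ∧ KdV.HasDet2 A (d : ℂ) ∧ KdV.alpha κ q = -Real.log d) := by
  -- The radius 1/4 keeps the closed ball strictly inside the ball of radius 1/2, so α agrees with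
  -- the analytic function on a neighbourhood of each point. The constant 8 is that of
  -- `logDet_bounds`.
  refine ⟨1 / 4, by norm_num, 8, by norm_num, fun κ hκ => ?_⟩
  have hball : ∀ q ∈ Metric.closedBall (0 : KdV.HMinusOne) (1 / 4), ‖q‖ ≤ 1 / 4 := fun q hq =>
    mem_closedBall_zero_iff.1 hq
  have hle : ∀ q ∈ Metric.closedBall (0 : KdV.HMinusOne) (1 / 4), ‖q‖ ≤ 1 / 2 := fun q hq =>
    (hball q hq).trans (by norm_num)
  have hlt : ∀ q ∈ Metric.closedBall (0 : KdV.HMinusOne) (1 / 4), ‖q‖ < 1 / 2 := fun q hq =>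
    (hball q hq).trans_lt (by norm_num)
  refine ⟨fun q hq => ⟨KdV.existsUnique_isGreen hκ (hle q hq), fun x => ?_,
      KdV.integrable_rho hκ (hle q hq), KdV.memH1_rho hκ (hle q hq)⟩,
    fun x => ⟨fun q hq => KdV.rho_nonneg hκ (hle q hq) x, KdV.convexOn_rho hκ (by norm_num) x⟩,
    fun q hq => KdV.alpha_nonneg hκ (hle q hq), fun q hq => ?_,
    KdV.strictConvexOn_alpha hκ (by norm_num), fun q hq => ?_, fun q hq => ?_⟩
  · rw [KdV.g_eq hκ (hle q hq)]
    exact KdV.greenKer_self_pos hκ (hle q hq) x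
  · refine (KdV.analyticAt_logDet hκ ((hlt q hq).trans (by norm_num))).congr ?_
    filter_upwards [Metric.isOpen_ball.mem_nhds (mem_ball_zero_iff.2 (hlt q hq))] with p hp
    exact (KdV.alpha_eq_logDet hκ (mem_ball_zero_iff.1 hp)).symm
  · rw [KdV.alpha_eq_logDet hκ (hlt q hq)]
    exact KdV.logDet_bounds hκ (hle q hq)
  · refine ⟨KdV.sand κ hκ q, KdV.isSandwich_sand hκ q, KdV.isHilbertSchmidt_sand hκ q,
      Real.exp (-KdV.logDet κ hκ q), Real.exp_pos _, KdV.hasDet2_sand hκ (hle q hq), ?_⟩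
    rw [Real.log_exp, neg_neg, KdV.alpha_eq_logDet hκ (hlt q hq)]
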